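/- For a finite graph $G=(V,E)$, the bandwidth of $G$ is $\min_\sigma\max_{u\sim v}|\sigma(u)-\sigma(v)|$ over all labelings $\sigma$ of $V$ by $1,\dots,|V|$. A set of vertices is contiguous if it is empty or induces a connected subgraph. Two Markov chains are considered. Color chain. The states are the colorings $\omega:V\to\{1,2\}$ with both color classes contiguous. In one step, a vertex $v$ and a color $i$ are chosen independently and uniformly at random, and $v$ is recolored with $i$ if the result is again a state; otherwise nothing changes. Partition chain. The states are the unordered partitions $\{A,V\setminus A\}$ with $A$ and $V\setminus A$ contiguous. In one step, a vertex $v$ and one of the two pieces are chosen independently and uniformly at random, and $v$ is moved to the chosen piece if the result is again a state; otherwise nothing changes. For a transition matrix $P$ with stationary distribution $\pi$ write $t_{\mathrm{mix}}(\delta)=\min\{t:\max_x\|P^t(x,\cdot)-\pi\|_{TV}\le\delta\}$. Let $G_{3\times\ell}$ be the $3\times \ell$ grid graph, and for odd $\ell$ let $G^4_{3\times\ell}$ be the subgraph of the $\ell\times\ell$ grid graph induced by the vertices at graph distance at most $1$ from the middle row or the middle column. (1) For $\ell\ge3$ the graph $G_{3\times\ell}$ has bandwidth $3$. For every $\ell\ge1$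 the color chain on $G_{3\times\ell}$ is ergodic with uniform stationary distribution. Its mixing time is exponential in $|V|=3\ell$: there is $c>0$ such that for every $\delta\in(0,\frac12)$ and all sufficiently large $\ell$, $t_{\mathrm{mix}}(\delta)\ge e^{c|V|}$. Moreover, for all sufficiently large $\ell$ there is a set of $\mathrm{poly}(\ell)$ states that separates a set of $\Omega(2^\ell)$ states from the remaining states, of which there are also $\Omega(2^\ell)$ (that is, there are no transitions between the two sets). (2) For every odd $\ell\geq 1$ the graph $G^4_{3\times\ell}$ has bandwidth at most $12$, and the partition chain on $G^4_{3\times\ell}$ is ergodic with uniform stationary distribution. Its mixing time is exponential in $|V|$ (hence in $\ell$, since $|V|=6\ell-9$ for $\ell\ge3$): there is $c>0$ such that for every $\delta\in(0,\frac12)$ and all sufficiently large odd $\ell$, $t_{\mathrm{mix}}(\delta)\ge e^{c|V|}$. Moreover, for all sufficiently large odd $\ell$ there is a set of at most $\mathrm{poly}(\ell)\,2^{\ell/2}$ states that separates a set of $\Omega(2^\ell)$ states from the remaining states, of which there are also $\Omega(2^\ell)$. -/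

import Mathlib

open scoped ENNReal

noncomputable section

namespace ConnPart

/-! ### Finite Markov chains -/

section Chain

variable {Ω : Type*} [Fintype Ω] [DecidableEq Ω]

/-- The uniform distribution on a finite state space. -/
def uniformDist (Ω : Type*) [Fintype Ω] : Ω → ℝ := fun _ => 1 / (Fintype.card Ω : ℝ)

/-- The total variation distance between two distributions on a finite set. -/
def tvDist (μ ν : Ω → ℝ) : ℝ := (1 / 2) * ∑ x, |μ x - ν x|

/-- `d(t)`: the largest distance from `π`, over all starting states `x`, of the law
`P ^ t (x, ·)` of the chain after `t` steps. -/
def worstDist (P : Matrix Ω Ω ℝ) (π : Ω → ℝ) (t : ℕ) : ℝ :=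
  ⨆ x : Ω, tvDist ((P ^ t) x) π

/-- The mixing time: the least `t` with `d(t) ≤ δ` (and `⊤` if there is no such `t`). -/
def mixingTime (P : Matrix Ω Ω ℝ) (π : Ω → ℝ) (δ : ℝ) : ℕ∞ :=
  sInf ((fun t : ℕ => (t : ℕ∞)) '' {t : ℕ | worstDist P π t ≤ δ})

/-- `P` is the transition matrix of an ergodic (irreducible and aperiodic) Markov chain whose
stationary distribution is `π`. For a finite chain, irreducibility together with aperiodicity
says that some power of `P` is entrywise positive, which is `Matrix.IsPrimitive`. -/
structure IsErgodicChain (P : Matrix Ω Ω ℝ) (π : Ω → ℝ) : Prop where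
  stochastic : P ∈ Matrix.rowStochastic ℝ Ω
  ergodic : P.IsPrimitive
  stationary : Matrix.vecMul π P = π

/-- A cut set of at most `b` states separates (for the transitions of `P`) a region of at least
`s` states from the remaining states, of which there are also at least `s`. -/
def HasBottleneck (P : Matrix Ω Ω ℝ) (s b : ℝ) : Prop :=
  ∃ S C : Finset Ω, Disjoint S C ∧
    (∀ x ∈ S, ∀ y ∈ (S ∪ C)ᶜ, P x y = 0 ∧ P y x = 0) ∧
    s ≤ (S.card : ℝ) ∧ s ≤ (((S ∪ C)ᶜ).card : ℝ) ∧ (C.card : ℝ) ≤ b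

end Chain

/-! ### Graphs -/

/-- The `k × ℓ` grid graph. -/
def gridGraph (k ℓ : ℕ) : SimpleGraph (Fin k × Fin ℓ) :=
  (SimpleGraph.pathGraph k).boxProd (SimpleGraph.pathGraph ℓ)

/-- The vertices of the `ℓ × ℓ` grid (`ℓ` odd) at graph distance at most `1` from the middle
horizontal or from the middle vertical line. -/
def plusSet (ℓ : ℕ) : Set (Fin ℓ × Fin ℓ) :=
  {v | ∃ w : Fin ℓ × Fin ℓ, ((w.1 : ℕ) = ℓ / 2 ∨ (w.2 : ℕ) = ℓ / 2) ∧
    (gridGraph ℓ ℓ).dist v w ≤ 1}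

instance (ℓ : ℕ) : Fintype (plusSet ℓ) := Fintype.ofFinite _

/-- The plus-shaped graph: the subgraph of the `ℓ × ℓ` grid induced by `plusSet ℓ`. -/
def plusGraph (ℓ : ℕ) : SimpleGraph (plusSet ℓ) := (gridGraph ℓ ℓ).induce (plusSet ℓ)

section Graph

variable {V : Type*} [Fintype V]

/-- The bandwidth of `G`: the minimum over all labelings of the vertices by `n = |V|` consecutive
integers of the maximum difference of the labels of adjacent vertices. -/
def bandwidth (G : SimpleGraph V) : ℕ :=
  sInf {b : ℕ | ∃ σ : V ≃ Fin (Fintype.card V),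
    ∀ u v, G.Adj u v → |((σ u : ℕ) : ℤ) - ((σ v : ℕ) : ℤ)| ≤ (b : ℤ)}

/-- The set `A` of vertices is empty or induces a connected subgraph of `G`. -/
def IsContiguous (G : SimpleGraph V) (A : Set V) : Prop := (G.induce A).Preconnected

/-! ### Glauber dynamics on connected colorings -/

/-- Connected `q`-colorings: every color class is empty or induces a connected subgraph. -/
def ConnColoring (G : SimpleGraph V) (q : ℕ) : Type _ :=
  {ω : V → Fin q // ∀ i, IsContiguous G {v | ω v = i}}

instance (G : SimpleGraph V) (q : ℕ) : Fintype (ConnColoring G q) :=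
  @Fintype.ofFinite _ Subtype.finite

instance (G : SimpleGraph V) (q : ℕ) : DecidableEq (ConnColoring G q) := Classical.decEq _

open Classical in
/-- Recolor `v` with color `i` if this gives a connected coloring; otherwise do nothing. -/
def colorStep (G : SimpleGraph V) {q : ℕ} (ω : ConnColoring G q) (v : V) (i : Fin q) :
    ConnColoring G q :=
  if h : ∀ j, IsContiguous G {u | Function.update ω.1 v i u = j} then
    ⟨Function.update ω.1 v i, h⟩ else ω

/-- Glauber dynamics on connected `q`-colorings: `v` and `i` are chosen uniformly at random. -/
def colorChain (G : SimpleGraph V) (q : ℕ) :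
    Matrix (ConnColoring G q) (ConnColoring G q) ℝ :=
  fun ω ω' => ∑ v : V, ∑ i : Fin q,
    (1 / (Fintype.card V : ℝ)) * (1 / (q : ℝ)) * if colorStep G ω v i = ω' then 1 else 0

/-! ### Glauber dynamics on contiguous 2-partitions -/

open Classical in
/-- `p` is an (unordered) partition of the vertex set into two contiguous pieces, one of which may
be empty. -/
def IsContigTwoPartition (G : SimpleGraph V) (p : Finset (Finset V)) : Prop :=
  ∃ A : Finset V, p = {A, Aᶜ} ∧ ∀ D ∈ p, IsContiguous G (D : Set V)

/-- The state space of contiguous 2-partitions of `G`. -/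
def ContigTwoPartition (G : SimpleGraph V) : Type _ :=
  {p : Finset (Finset V) // IsContigTwoPartition G p}

instance (G : SimpleGraph V) : Fintype (ContigTwoPartition G) :=
  @Fintype.ofFinite _ Subtype.finite

instance (G : SimpleGraph V) : DecidableEq (ContigTwoPartition G) := Classical.decEq _

open Classical in
/-- Remove `v` from its current piece and make it a member of the piece `D`. -/
def moveTo (p : Finset (Finset V)) (v : V) (D : Finset V) : Finset (Finset V) :=
  p.image fun A => if A = D then insert v A else A.erase v

open Classical in
/-- Move `v` to the piece `D` if this gives a contiguous 2-partition; otherwise do nothing. -/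
def partitionStep (G : SimpleGraph V) (p : ContigTwoPartition G) (v : V) (D : Finset V) :
    ContigTwoPartition G :=
  if h : IsContigTwoPartition G (moveTo p.1 v D) then ⟨moveTo p.1 v D, h⟩ else p

/-- Glauber dynamics on contiguous 2-partitions: a vertex `v` and a piece `D` of the current
partition are chosen uniformly at random. -/
def partitionChain (G : SimpleGraph V) :
    Matrix (ContigTwoPartition G) (ContigTwoPartition G) ℝ :=
  fun p p' => ∑ v : V, ∑ D ∈ p.1,
    (1 / (Fintype.card V : ℝ)) * (1 / (p.1.card : ℝ)) *
      if partitionStep G p v D = p' then 1 else 0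

end Graph

end ConnPart

end

/-!
A symmetric chain crosses a small cut set slowly: started uniformly on one side of the cut, it loses
at each step at most the ratio of the cut set to that side, so some state of that side stays far
from uniform for a number of steps of the order of the inverse ratio. Irreducibility holds because
in either graph a monochromatic coloring can be reached by peeling a color class vertex by vertex.

The cut sets come from planarity. A set of cells of the square lattice whose edges carry no
nontrivial cohomology mod 2 behaves like a disk, and if both color classes of such a region are
connected, then the color changes at most twice along its outer boundary. In the `3 × ℓ` grid all
columns with differently colored ends are therefore tilted the same way, and a single move cannot
reverse the tilt: the two kinds of tilted colorings are separated by the level ones, where both ends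
of every column agree. In a level coloring each row changes color only a bounded number of times, so
there are only polynomially many of them. In the plus, at most two of the four arms contain a cross
section with differently colored ends; a single move affects one arm, so passing from the two
vertical arms to any other pair of arms requires a state in which at most one arm is split, and such
a state is determined, up to polynomially many choices, by the middle row of that arm.
-/

noncomputable section

namespace ConnPart

/-! ### Doubly stochastic chains -/

section DoublyStochastic

variable {Ω : Type*} [Fintype Ω] [DecidableEq Ω] {P Q : Matrix Ω Ω ℝ}

lemma mem_doublyStochastic_of_isSymm (h : P ∈ Matrix.rowStochastic ℝ Ω) (hs : P.IsSymm) :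
    P ∈ doublyStochastic ℝ Ω :=
  mem_doublyStochastic_iff_sum.2 ⟨fun _ _ => Matrix.nonneg_of_mem_rowStochastic h,
    Matrix.sum_row_of_mem_rowStochastic h, fun y =>
      (Finset.sum_congr rfl fun x _ => hs.apply y x).trans
        (Matrix.sum_row_of_mem_rowStochastic h y)⟩

lemma sum_row_le_one (h : P ∈ doublyStochastic ℝ Ω) (x : Ω) (S : Finset Ω) :
    ∑ y ∈ S, P x y ≤ 1 := by
  rw [← sum_row_of_mem_doublyStochastic h x]
  exact Finset.sum_le_univ_sum_of_nonneg fun y => nonneg_of_mem_doublyStochastic h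

lemma sum_col_le_one (h : P ∈ doublyStochastic ℝ Ω) (y : Ω) (S : Finset Ω) :
    ∑ x ∈ S, P x y ≤ 1 := by
  rw [← sum_col_of_mem_doublyStochastic h y]
  exact Finset.sum_le_univ_sum_of_nonneg fun x => nonneg_of_mem_doublyStochastic h

lemma mul_apply_pos (hP : P ∈ doublyStochastic ℝ Ω) (hQ : Q ∈ doublyStochastic ℝ Ω) {x y z : Ω}
    (hxy : 0 < P x y) (hyz : 0 < Q y z) : 0 < (P * Q) x z :=
  (mul_pos hxy hyz).trans_le <| Finset.single_le_sum (f := fun w => P x w * Q w z)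
    (fun _ _ => mul_nonneg (nonneg_of_mem_doublyStochastic hP)
      (nonneg_of_mem_doublyStochastic hQ)) (Finset.mem_univ y)

lemma exists_pow_pos_of_reflTransGen (h : P ∈ doublyStochastic ℝ Ω) {x y : Ω}
    (hxy : Relation.ReflTransGen (fun a b => 0 < P a b) x y) : ∃ t, 0 < (P ^ t) x y := by
  induction hxy with
  | refl => exact ⟨0, by simp⟩
  | tail _ hbc ih =>
    obtain ⟨t, ht⟩ := ih
    exact ⟨t + 1, pow_succ P t ▸ mul_apply_pos (pow_mem h t) h ht hbc⟩

lemma pow_apply_pos_of_le (h : P ∈ doublyStochastic ℝ Ω) (hd : ∀ x, 0 < P x x) {x y : Ω}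
    {s t : ℕ} (hst : s ≤ t) (hs : 0 < (P ^ s) x y) : 0 < (P ^ t) x y := by
  induction t, hst using Nat.le_induction with
  | base => exact hs
  | succ t _ ih => exact pow_succ P t ▸ mul_apply_pos (pow_mem h t) h ih (hd y)

lemma isPrimitive_of_reflTransGen (h : P ∈ doublyStochastic ℝ Ω) (hd : ∀ x, 0 < P x x)
    (hr : ∀ x y, Relation.ReflTransGen (fun a b => 0 < P a b) x y) : P.IsPrimitive := by
  choose t ht using fun q : Ω × Ω => exists_pow_pos_of_reflTransGen h (hr q.1 q.2)
  refine ⟨fun _ _ => nonneg_of_mem_doublyStochastic h, Finset.univ.sup t + 1, Nat.succ_pos _,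
    fun x y => pow_apply_pos_of_le h hd ?_ (ht (x, y))⟩
  exact (Finset.le_sup (Finset.mem_univ (x, y))).trans (Nat.le_succ _)

lemma vecMul_uniformDist (h : P ∈ doublyStochastic ℝ Ω) :
    Matrix.vecMul (uniformDist Ω) P = uniformDist Ω := by
  funext y
  simp only [Matrix.vecMul, dotProduct, uniformDist]
  rw [← Finset.mul_sum, sum_col_of_mem_doublyStochastic h, mul_one]

lemma isErgodicChain_of_isSymm (h : P ∈ Matrix.rowStochastic ℝ Ω) (hs : P.IsSymm)
    (hd : ∀ x, 0 < P x x) (o : Ω)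
    (ho : ∀ x, Relation.ReflTransGen (fun a b => 0 < P a b) x o) :
    IsErgodicChain P (uniformDist Ω) := by
  have hds := mem_doublyStochastic_of_isSymm h hs
  have hsymm : Std.Symm fun a b => 0 < P a b := ⟨fun a b hab => hab.trans_eq (hs.apply b a)⟩
  exact ⟨h, isPrimitive_of_reflTransGen hds hd fun x y => (ho x).trans (symm (ho y)),
    vecMul_uniformDist hds⟩

/-- The total probability of the transitions out of `S`. For a doubly stochastic matrix it bounds
how fast the uniform distribution on `S` leaks out of `S`. -/
def flowOut (P : Matrix Ω Ω ℝ) (S : Finset Ω) : ℝ := ∑ x ∈ S, ∑ y ∈ Sᶜ, P x y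

lemma flowOut_one (S : Finset Ω) : flowOut (1 : Matrix Ω Ω ℝ) S = 0 :=
  Finset.sum_eq_zero fun _ hx => Finset.sum_eq_zero fun _ hy =>
    Matrix.one_apply_ne fun hxy => Finset.mem_compl.1 hy (hxy ▸ hx)

lemma flowOut_mul_le (hP : P ∈ doublyStochastic ℝ Ω) (hQ : Q ∈ doublyStochastic ℝ Ω)
    (S : Finset Ω) : flowOut (P * Q) S ≤ flowOut P S + flowOut Q S := by
  have hP0 : ∀ x y, 0 ≤ P x y := fun _ _ => nonneg_of_mem_doublyStochastic hP
  have hQ0 : ∀ x, 0 ≤ ∑ y ∈ Sᶜ, Q x y := fun _ =>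
    Finset.sum_nonneg fun _ _ => nonneg_of_mem_doublyStochastic hQ
  have split_middle : flowOut (P * Q) S =
      ∑ z ∈ Sᶜ, (∑ x ∈ S, P x z) * (∑ y ∈ Sᶜ, Q z y) +
        ∑ z ∈ S, (∑ x ∈ S, P x z) * (∑ y ∈ Sᶜ, Q z y) := by
    rw [add_comm, Finset.sum_add_sum_compl]
    simp only [flowOut, Matrix.mul_apply, Finset.sum_mul_sum]
    rw [Finset.sum_comm (s := Finset.univ)]
    exact Finset.sum_congr rfl fun x _ => Finset.sum_comm
  rw [split_middle]
  refine add_le_add ?_ ?_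
  · refine le_of_le_of_eq ?_ Finset.sum_comm
    exact Finset.sum_le_sum fun z _ => mul_le_of_le_one_right
      (Finset.sum_nonneg fun x _ => hP0 x z) (sum_row_le_one hQ z _)
  · exact Finset.sum_le_sum fun z _ => mul_le_of_le_one_left (hQ0 z) (sum_col_le_one hP z _)

lemma flowOut_pow_le (h : P ∈ doublyStochastic ℝ Ω) (S : Finset Ω) (t : ℕ) :
    flowOut (P ^ t) S ≤ t * flowOut P S := by
  induction t with
  | zero => simp [flowOut_one]
  | succ t ih =>
    rw [pow_succ, Nat.cast_succ, add_one_mul]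
    exact (flowOut_mul_le (pow_mem h t) h S).trans (by gcongr)

lemma flowOut_le_card (h : P ∈ doublyStochastic ℝ Ω) {S C : Finset Ω}
    (hSC : ∀ x ∈ S, ∀ y ∈ (S ∪ C)ᶜ, P x y = 0) : flowOut P S ≤ C.card := by
  have hP0 : ∀ x y, 0 ≤ P x y := fun _ _ => nonneg_of_mem_doublyStochastic h
  have only_into_C : ∀ x ∈ S, ∑ y ∈ Sᶜ, P x y ≤ ∑ y ∈ C, P x y := fun x hx => by
    have : ∑ y ∈ Sᶜ ∩ C, P x y = ∑ y ∈ Sᶜ, P x y :=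
      Finset.sum_subset Finset.inter_subset_left fun y hy hyC => hSC x hx y <| by
        simp only [Finset.mem_inter, Finset.mem_compl, Finset.mem_union] at *
        tauto
    rw [← this]
    exact Finset.sum_le_sum_of_subset_of_nonneg Finset.inter_subset_right fun y _ _ => hP0 x y
  calc flowOut P S ≤ ∑ x ∈ S, ∑ y ∈ C, P x y := Finset.sum_le_sum only_into_C
    _ = ∑ y ∈ C, ∑ x ∈ S, P x y := Finset.sum_comm
    _ ≤ ∑ _y ∈ C, 1 := Finset.sum_le_sum fun y _ => sum_col_le_one h y S
    _ = C.card := by simp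

end DoublyStochastic

/-! ### Bottlenecks and mixing times -/

section Bottleneck

variable {Ω : Type*} [Fintype Ω]

lemma sum_uniformDist (S : Finset Ω) : ∑ y ∈ S, uniformDist Ω y = S.card / Fintype.card Ω := by
  simp only [uniformDist, Finset.sum_const, nsmul_eq_mul, mul_one_div]

lemma sum_sub_sum_le_tvDist {μ ν : Ω → ℝ} (h : ∑ x, μ x = ∑ x, ν x) (T : Finset Ω) :
    ∑ x ∈ T, ν x - ∑ x ∈ T, μ x ≤ tvDist μ ν := by
  classical
  have on_T : ∑ x ∈ T, ν x - ∑ x ∈ T, μ x ≤ ∑ x ∈ T, |μ x - ν x| := by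
    rw [← Finset.sum_sub_distrib]
    exact Finset.sum_le_sum fun x _ => (le_abs_self _).trans_eq (abs_sub_comm _ _)
  have on_compl : ∑ x ∈ Tᶜ, μ x - ∑ x ∈ Tᶜ, ν x ≤ ∑ x ∈ Tᶜ, |μ x - ν x| := by
    rw [← Finset.sum_sub_distrib]
    exact Finset.sum_le_sum fun x _ => le_abs_self _
  have split_μ := Finset.sum_add_sum_compl T μ
  have split_ν := Finset.sum_add_sum_compl T ν
  have split_abs := Finset.sum_add_sum_compl T fun x => |μ x - ν x|
  unfold tvDist
  linarith

variable [DecidableEq Ω] {P : Matrix Ω Ω ℝ}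

lemma half_sub_le_worstDist (h : P ∈ doublyStochastic ℝ Ω) {S : Finset Ω} (hS : S.Nonempty)
    (hhalf : 2 * S.card ≤ Fintype.card Ω) (t : ℕ) :
    1 / 2 - t * flowOut P S / S.card ≤ worstDist P (uniformDist Ω) t := by
  have hSpos : (0 : ℝ) < S.card := by exact_mod_cast hS.card_pos
  have hΩpos : (0 : ℝ) < Fintype.card Ω := by exact_mod_cast Fintype.card_pos_iff.2 ⟨hS.choose⟩
  obtain ⟨x, -, hescape⟩ : ∃ x ∈ S, ∑ y ∈ Sᶜ, (P ^ t) x y ≤ t * flowOut P S / S.card := by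
    refine Finset.exists_le_of_sum_le hS ((flowOut_pow_le h S t).trans_eq ?_)
    rw [Finset.sum_const, nsmul_eq_mul, mul_div_cancel₀ _ hSpos.ne']
  have hstationary : (1 : ℝ) / 2 ≤ ∑ y ∈ Sᶜ, uniformDist Ω y := by
    have hcard : Fintype.card Ω ≤ Sᶜ.card * 2 := by
      have := Finset.card_add_card_compl S
      omega
    rw [sum_uniformDist, div_le_div_iff₀ two_pos hΩpos, one_mul]
    exact_mod_cast hcard
  have htotal : ∑ y, (P ^ t) x y = ∑ y, uniformDist Ω y := by
    rw [sum_row_of_mem_doublyStochastic (pow_mem h t), sum_uniformDist, Finset.card_univ,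
      div_self hΩpos.ne']
  have hworst : tvDist ((P ^ t) x) (uniformDist Ω) ≤ worstDist P (uniformDist Ω) t :=
    le_ciSup (f := fun x => tvDist ((P ^ t) x) (uniformDist Ω)) (Set.finite_range _).bddAbove x
  linarith [sum_sub_sum_le_tvDist htotal Sᶜ]

lemma HasBottleneck.exists_le_half {s b : ℝ} (hB : HasBottleneck P s b) :
    ∃ S C : Finset Ω, (∀ x ∈ S, ∀ y ∈ (S ∪ C)ᶜ, P x y = 0) ∧ s ≤ S.card ∧ C.card ≤ b ∧
      2 * S.card ≤ Fintype.card Ω := by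
  obtain ⟨S, C, hdisj, hSC, hS, hR, hC⟩ := hB
  have hcompl := Finset.card_add_card_compl (S ∪ C)
  have hunion := Finset.card_union_of_disjoint hdisj
  rcases le_total (2 * S.card) (Fintype.card Ω) with h | h
  · exact ⟨S, C, fun x hx y hy => (hSC x hx y hy).1, hS, hC, h⟩
  · refine ⟨(S ∪ C)ᶜ, C, fun x hx y hy => (hSC y ?_ x hx).2, hR, hC, by omega⟩
    simp only [Finset.mem_compl, Finset.mem_union, not_or, not_and, not_not] at hx hy
    tauto

lemma HasBottleneck.mul_le_mul {s b : ℝ} (hB : HasBottleneck P s b)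
    (h : P ∈ doublyStochastic ℝ Ω) (hs : 0 < s) {δ : ℝ} (hδ : δ ≤ 1 / 2) {t : ℕ}
    (ht : worstDist P (uniformDist Ω) t ≤ δ) : (1 / 2 - δ) * s ≤ t * b := by
  obtain ⟨S, C, hSC, hsS, hCb, hhalf⟩ := hB.exists_le_half
  have hSpos : (0 : ℝ) < S.card := hs.trans_le hsS
  have hS : S.Nonempty := Finset.card_pos.1 (by exact_mod_cast hSpos)
  have hgap : 1 / 2 - δ ≤ t * flowOut P S / S.card := by
    linarith [half_sub_le_worstDist h hS hhalf t]
  calc (1 / 2 - δ) * s ≤ (1 / 2 - δ) * S.card := by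
        have := sub_nonneg.2 hδ
        gcongr
    _ ≤ t * flowOut P S := (le_div_iff₀ hSpos).1 hgap
    _ ≤ t * b := by
        gcongr
        exact (flowOut_le_card h hSC).trans hCb

lemma HasBottleneck.le_mixingTime {s b : ℝ} (hB : HasBottleneck P s b)
    (h : P ∈ doublyStochastic ℝ Ω) (hs : 0 < s) (hb : 0 < b) {δ T : ℝ} (hδ : δ ≤ 1 / 2)
    (hT : T * b ≤ (1 / 2 - δ) * s) :
    ENNReal.ofReal T ≤ ((mixingTime P (uniformDist Ω) δ : ℕ∞) : ℝ≥0∞) := by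
  have hceil : (⌈T⌉₊ : ℕ∞) ≤ mixingTime P (uniformDist Ω) δ := by
    refine le_sInf ?_
    rintro _ ⟨t, ht, rfl⟩
    have hTt : T ≤ t := le_of_mul_le_mul_right (hT.trans (hB.mul_le_mul h hs hδ ht)) hb
    exact Nat.cast_le.2 (Nat.ceil_le.2 hTt)
  calc ENNReal.ofReal T ≤ ENNReal.ofReal (⌈T⌉₊ : ℝ) := ENNReal.ofReal_le_ofReal (Nat.le_ceil T)
    _ = ((⌈T⌉₊ : ℕ∞) : ℝ≥0∞) := by simp
    _ ≤ _ := ENat.toENNReal_le.2 hceil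

end Bottleneck

/-! ### Contiguous sets -/

section Contiguous

variable {V : Type*} {G : SimpleGraph V} {A X : Set V}

/-- `X` is a union of connected components of the graph induced on `A`, neither empty nor all of
`A`; its existence is what makes `A` disconnected. -/
structure IsClosedPart (G : SimpleGraph V) (A X : Set V) : Prop where
  ssubset : X ⊂ A
  nonempty : X.Nonempty
  closed : ∀ u ∈ X, ∀ w ∈ A, G.Adj u w → w ∈ X

lemma IsClosedPart.sdiff (h : IsClosedPart G A X) : IsClosedPart G A (A \ X) where
  ssubset := h.nonempty.elim fun _x hx =>
    ⟨Set.sdiff_subset, fun hsub => (hsub (h.ssubset.1 hx)).2 hx⟩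
  nonempty := Set.sdiff_nonempty.2 h.ssubset.2
  closed _u hu w hw huw := ⟨hw, fun hwX => hu.2 (h.closed w hwX _ hu.1 huw.symm)⟩

lemma isContiguous_iff_forall_not_isClosedPart :
    IsContiguous G A ↔ ∀ X, ¬ IsClosedPart G A X := by
  constructor
  · rintro h X hX
    obtain ⟨x, hx⟩ := hX.nonempty
    obtain ⟨a, ha, haX⟩ := Set.exists_of_ssubset hX.ssubset
    obtain ⟨p⟩ := h ⟨x, hX.ssubset.1 hx⟩ ⟨a, ha⟩
    obtain ⟨d, -, hd, hd'⟩ := p.exists_boundary_dart {u | u.1 ∈ X} hx haX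
    exact hd' (hX.closed _ hd _ d.snd.2 d.adj)
  · rintro h ⟨x, hx⟩ ⟨y, hy⟩
    by_contra hxy
    let component := {w | ∃ hw : w ∈ A, (G.induce A).Reachable ⟨x, hx⟩ ⟨w, hw⟩}
    exact h component
      { ssubset := ⟨fun _ hw => hw.1, fun hsub => hxy (hsub hy).2⟩
        nonempty := ⟨x, hx, SimpleGraph.Reachable.refl _⟩
        closed := fun u hu w hw huw =>
          ⟨hw, hu.2.trans (SimpleGraph.Adj.reachable (by simpa using huw))⟩ }

lemma IsContiguous.exists_adj_notMem (h : IsContiguous G A) (hXA : X ⊂ A) (hX : X.Nonempty) :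
    ∃ u ∈ X, ∃ w ∈ A, G.Adj u w ∧ w ∉ X := by
  by_contra! hclosed
  exact isContiguous_iff_forall_not_isClosedPart.1 h X ⟨hXA, hX, hclosed⟩

lemma IsContiguous.eq_of_forall_adj {α : Type*} {f : V → α} (h : IsContiguous G A)
    (hf : ∀ u ∈ A, ∀ w ∈ A, G.Adj u w → f u = f w) {u w : V} (hu : u ∈ A) (hw : w ∈ A) :
    f u = f w := by
  by_contra hne
  obtain ⟨x, hx, y, hy, hxy, hyX⟩ := h.exists_adj_notMem (X := {z ∈ A | f u = f z})
    ⟨fun _ hz => hz.1, fun hsub => hne (hsub hw).2⟩ ⟨u, hu, rfl⟩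
  exact hyX ⟨hy, hx.2.trans (hf x hx.1 y hy hxy)⟩

lemma isContiguous_of_forall
    (h : ∀ f : V → Prop, (∀ u ∈ A, ∀ w ∈ A, G.Adj u w → f u = f w) →
      ∀ u ∈ A, ∀ w ∈ A, f u = f w) : IsContiguous G A := by
  refine isContiguous_iff_forall_not_isClosedPart.2 fun X hX => ?_
  obtain ⟨x, hx⟩ := hX.nonempty
  obtain ⟨a, ha, haX⟩ := Set.exists_of_ssubset hX.ssubset
  refine haX ((h (· ∈ X) (fun u hu w hw huw => propext ?_) x (hX.ssubset.1 hx) a ha).mp hx)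
  exact ⟨fun huX => hX.closed u huX w hw huw, fun hwX => hX.closed w hwX u hu huw.symm⟩

lemma isContiguous_of_subsingleton (h : A.Subsingleton) : IsContiguous G A :=
  isContiguous_of_forall fun _ _ _ hu _ hw => by rw [h hu hw]

/-- Descending along neighbors of smaller rank leads from everywhere to the root `o`. -/
lemma isContiguous_of_rank (o : V) (rank : V → ℕ)
    (h : ∀ u ∈ A, u = o ∨ ∃ w ∈ A, G.Adj u w ∧ rank w < rank u) : IsContiguous G A := by
  refine isContiguous_of_forall fun f hf => ?_
  have eq_root : ∀ n, ∀ u ∈ A, rank u = n → f u = f o := by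
    intro n
    induction n using Nat.strong_induction_on with
    | _ n ih =>
      intro u hu hn
      rcases h u hu with rfl | ⟨w, hw, huw, hlt⟩
      · rfl
      · exact (hf u hu w hw huw).trans (ih _ (hn ▸ hlt) w hw rfl)
  exact fun u hu w hw => (eq_root _ u hu rfl).trans (eq_root _ w hw rfl).symm

lemma IsContiguous.insert (h : IsContiguous G A) {v z : V} (hz : z ∈ A) (hvz : G.Adj v z) :
    IsContiguous G (insert v A) := by
  refine isContiguous_of_forall fun f hf => ?_
  have eq_z : ∀ u ∈ Insert.insert v A, f u = f z := by
    rintro u (rfl | hu)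
    · exact hf _ (Or.inl rfl) _ (Or.inr hz) hvz
    · exact h.eq_of_forall_adj (fun a ha b hb => hf a (Or.inr ha) b (Or.inr hb)) hu hz
  exact fun u hu w hw => (eq_z u hu).trans (eq_z w hw).symm

/-- A state of the two chains, seen as one of its two classes: `A` and its complement are
contiguous. -/
def IsSplit (G : SimpleGraph V) (A : Set V) : Prop := IsContiguous G A ∧ IsContiguous G Aᶜ

lemma IsSplit.compl (h : IsSplit G A) : IsSplit G Aᶜ := ⟨h.2, by rw [compl_compl]; exact h.1⟩

lemma isSplit_empty (huniv : IsContiguous G Set.univ) : IsSplit G ∅ :=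
  ⟨isContiguous_of_subsingleton Set.subsingleton_empty, by rwa [Set.compl_empty]⟩

lemma compl_sdiff_singleton (A : Set V) (v : V) : (A \ {v})ᶜ = insert v Aᶜ := by
  rw [Set.compl_sdiff, Set.union_comm, Set.insert_eq, Set.union_comm]

lemma IsSplit.sdiff_singleton (h : IsSplit G A) {v z : V} (hz : z ∉ A) (hvz : G.Adj v z)
    (hv : IsContiguous G (A \ {v})) : IsSplit G (A \ {v}) :=
  ⟨hv, by rw [compl_sdiff_singleton]; exact h.2.insert hz hvz⟩

/-- From every nonempty contiguous set with contiguous complement one can remove a vertex, keeping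
both sides contiguous. This is what makes the two chains irreducible. -/
def IsPeelable (G : SimpleGraph V) : Prop :=
  ∀ A : Set V, IsSplit G A → A.Nonempty → ∃ v ∈ A, IsSplit G (A \ {v})

lemma exists_isClosedPart_sdiff_subset {C : Set V} {v w : V} (hA : IsContiguous G A)
    (hC : IsClosedPart G (A \ {v}) C) (hwC : w ∈ C) (hw : ¬ IsContiguous G (A \ {w})) :
    ∃ Y ⊂ C, IsClosedPart G (A \ {w}) Y := by
  obtain ⟨Y, hY, hvY⟩ : ∃ Y, IsClosedPart G (A \ {w}) Y ∧ v ∉ Y := by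
    rw [isContiguous_iff_forall_not_isClosedPart] at hw
    push Not at hw
    obtain ⟨X, hX⟩ := hw
    by_cases hvX : v ∈ X
    · exact ⟨_, hX.sdiff, fun h => h.2 hvX⟩
    · exact ⟨X, hX, hvX⟩
  have hwA : w ∈ A := (hC.ssubset.1 hwC).1
  have hYA : Y ⊂ A := hY.ssubset.trans_subset Set.sdiff_subset
  have hYw : w ∉ Y := fun h => (hY.ssubset.1 h).2 rfl
  have hYC : Y ⊆ C := by
    by_contra hYC
    obtain ⟨u, ⟨huY, huC⟩, x, hx, hux, hxYC⟩ := hA.exists_adj_notMem (X := Y \ C)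
      ⟨fun u hu => hYA.1 hu.1, fun h => hYw (h hwA).1⟩ (Set.sdiff_nonempty.2 hYC)
    have hxC : x ∉ C := fun h => huC <|
      hC.closed x h u ⟨hYA.1 huY, fun huv => hvY (huv ▸ huY)⟩ hux.symm
    exact hxYC ⟨hY.closed u huY x ⟨hx, fun hxw => hxC (hxw ▸ hwC)⟩ hux, hxC⟩
  exact ⟨Y, ⟨hYC, fun h => hYw (h hwC)⟩, hY⟩

/-- A component `C` of `A \ {v}` has a vertex `w` next to the complement of `A`, as `v` does not cut
it off in the whole graph; if `w` cannot be removed either, it cuts a smaller component off. -/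
lemma exists_isSplit_sdiff_of_isClosedPart [Finite V] (hcut : ∀ v : V, IsContiguous G {v}ᶜ)
    (hA : IsSplit G A) {C : Set V} {v : V} (hC : IsClosedPart G (A \ {v}) C) :
    ∃ w ∈ A, IsSplit G (A \ {w}) := by
  induction C using WellFoundedLT.induction generalizing v with
  | ind C ih =>
    obtain ⟨w, hwC, z, hz, hwz, hzC⟩ : ∃ w ∈ C, ∃ z ∈ ({v}ᶜ : Set V), G.Adj w z ∧ z ∉ C :=
      (hcut v).exists_adj_notMem
        (hC.ssubset.trans_subset (Set.sdiff_subset_sdiff_left (Set.subset_univ A) |>.trans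
          (Set.compl_eq_univ_sdiff _).ge)) hC.nonempty
    have hzA : z ∉ A := fun h => hzC (hC.closed w hwC z ⟨h, hz⟩ hwz)
    by_cases hw : IsContiguous G (A \ {w})
    · exact ⟨w, (hC.ssubset.1 hwC).1, hA.sdiff_singleton hzA hwz hw⟩
    · obtain ⟨Y, hYC, hY⟩ := exists_isClosedPart_sdiff_subset hA.1 hC hwC hw
      exact ih Y hYC hY

lemma isPeelable_of_forall_compl_singleton [Finite V] (huniv : IsContiguous G Set.univ)
    (hcut : ∀ v : V, IsContiguous G {v}ᶜ) : IsPeelable G := by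
  intro A hA hne
  rcases eq_or_ne A Set.univ with rfl | hAuniv
  · obtain ⟨a, ha⟩ := hne
    refine ⟨a, ha, ?_⟩
    rw [← Set.compl_eq_univ_sdiff]
    exact ⟨hcut a, by
      rw [compl_compl]; exact isContiguous_of_subsingleton Set.subsingleton_singleton⟩
  · obtain ⟨v, hv, z, -, hvz, hz⟩ := huniv.exists_adj_notMem (Set.ssubset_univ_iff.2 hAuniv) hne
    by_cases hcon : IsContiguous G (A \ {v})
    · exact ⟨v, hv, hA.sdiff_singleton hz hvz hcon⟩
    · rw [isContiguous_iff_forall_not_isClosedPart] at hcon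
      push Not at hcon
      exact exists_isSplit_sdiff_of_isClosedPart hcut hA hcon.choose_spec

lemma IsPeelable.induction [Finite V] (h : IsPeelable G) {Q : ∀ A, IsSplit G A → Prop}
    (empty : ∀ h, Q ∅ h)
    (insert : ∀ A, ∀ v ∈ A, ∀ (h : IsSplit G A) (hv : IsSplit G (A \ {v})), Q (A \ {v}) hv → Q A h)
    (hA : IsSplit G A) : Q A hA := by
  induction A using WellFoundedLT.induction with
  | ind A ih =>
    rcases A.eq_empty_or_nonempty with rfl | hne
    · exact empty hA
    · obtain ⟨v, hv, hsplit⟩ := h A hA hne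
      exact insert A v hv hA hsplit (ih _ (Set.sdiff_singleton_ssubset.2 hv) hsplit)

end Contiguous

/-! ### Chains of uniform local updates -/

section UniformUpdate

variable {Ω V ι : Type*} [DecidableEq Ω] [Fintype V] {choices : Ω → Finset ι}
  {step : Ω → V → ι → Ω}

/-- The chain that draws a site `v` and one of the `choices` available in the current state `x`
uniformly at random and moves to `step x v i`: the common form of the two chains. -/
def uniformUpdateMatrix (choices : Ω → Finset ι) (step : Ω → V → ι → Ω) : Matrix Ω Ω ℝ :=
  fun x y => ∑ v : V, ∑ i ∈ choices x,
    (1 / (Fintype.card V : ℝ)) * (1 / ((choices x).card : ℝ)) * if step x v i = y then 1 else 0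

lemma uniformUpdateMatrix_summand_nonneg (x y : Ω) (v : V) (i : ι) :
    0 ≤ (1 / (Fintype.card V : ℝ)) * (1 / ((choices x).card : ℝ)) *
      if step x v i = y then 1 else 0 := by
  split_ifs <;> positivity

lemma uniformUpdateMatrix_nonneg (x y : Ω) : 0 ≤ uniformUpdateMatrix choices step x y :=
  Finset.sum_nonneg fun v _ => Finset.sum_nonneg fun i _ =>
    uniformUpdateMatrix_summand_nonneg x y v i

lemma uniformUpdateMatrix_pos {x y : Ω} {v : V} {i : ι} (hi : i ∈ choices x)
    (h : step x v i = y) : 0 < uniformUpdateMatrix choices step x y := by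
  have hV : 0 < Fintype.card V := Fintype.card_pos_iff.2 ⟨v⟩
  have hx : 0 < (choices x).card := Finset.card_pos.2 ⟨i, hi⟩
  refine Finset.sum_pos' (fun v _ => Finset.sum_nonneg fun i _ => ?_) ⟨v, Finset.mem_univ v,
    Finset.sum_pos' (fun i _ => ?_) ⟨i, hi, ?_⟩⟩
  · exact uniformUpdateMatrix_summand_nonneg x y v i
  · exact uniformUpdateMatrix_summand_nonneg x y v i
  · rw [if_pos h]
    positivity

lemma exists_step_eq_of_uniformUpdateMatrix_ne_zero {x y : Ω}
    (h : uniformUpdateMatrix choices step x y ≠ 0) : ∃ v, ∃ i ∈ choices x, step x v i = y := by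
  obtain ⟨v, -, hv⟩ := Finset.exists_ne_zero_of_sum_ne_zero h
  obtain ⟨i, hi, hvi⟩ := Finset.exists_ne_zero_of_sum_ne_zero hv
  exact ⟨v, i, hi, by_contra fun hne => right_ne_zero_of_mul hvi (if_neg hne)⟩

lemma uniformUpdateMatrix_mem_rowStochastic [Fintype Ω] [Nonempty V]
    (hchoices : ∀ x, (choices x).Nonempty) :
    uniformUpdateMatrix choices step ∈ Matrix.rowStochastic ℝ Ω := by
  refine Matrix.mem_rowStochastic_iff_sum.2 ⟨uniformUpdateMatrix_nonneg, fun x => ?_⟩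
  have hx : ((choices x).card : ℝ) ≠ 0 := by exact_mod_cast (hchoices x).card_ne_zero
  simp only [uniformUpdateMatrix]
  rw [Finset.sum_comm]
  simp_rw [Finset.sum_comm (s := Finset.univ (α := Ω)), ← Finset.mul_sum, Finset.sum_ite_eq,
    Finset.mem_univ, if_true, Finset.sum_const, Finset.card_univ, nsmul_eq_mul, mul_one]
  field_simp

lemma uniformUpdateMatrix_isSymm (hcard : ∀ x y, (choices x).card = (choices y).card)
    (hstep : ∀ x y, x ≠ y → ∀ v,
      {i ∈ choices x | step x v i = y}.card = {i ∈ choices y | step y v i = x}.card) :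
    (uniformUpdateMatrix choices step).IsSymm := by
  refine Matrix.IsSymm.ext fun x y => ?_
  rcases eq_or_ne x y with rfl | hne
  · rfl
  · simp only [uniformUpdateMatrix, ← Finset.mul_sum, Finset.sum_boole, hcard x y,
      hstep x y hne]

end UniformUpdate

/-! ### The color chain -/

section ColorChain

variable {V : Type*} {G : SimpleGraph V} {q : ℕ}

lemma setOf_eq_one (ω : V → Fin 2) : {v | ω v = 1} = {v | ω v = 0}ᶜ := by
  ext v
  simp only [Set.mem_compl_iff, Set.mem_ofPred_eq]
  omega

lemma ConnColoring.isSplit (ω : ConnColoring G 2) : IsSplit G {v | ω.1 v = 0} :=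
  ⟨ω.2 0, by rw [← setOf_eq_one]; exact ω.2 1⟩

open Classical in
/-- The coloring in which `A` is the class of color `0`. -/
def coloringOf (G : SimpleGraph V) (A : Set V) (h : IsSplit G A) : ConnColoring G 2 :=
  ⟨fun v => if v ∈ A then 0 else 1, by
    intro i
    fin_cases i
    · simpa using h.1
    · simpa [← Set.compl_def] using h.2⟩

lemma coloringOf_eq_zero {A : Set V} (h : IsSplit G A) (v : V) :
    (coloringOf G A h).1 v = 0 ↔ v ∈ A := by
  simp [coloringOf]

lemma coloringOf_injective {A B : Set V} {hA : IsSplit G A} {hB : IsSplit G B}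
    (h : coloringOf G A hA = coloringOf G B hB) : A = B := by
  ext v
  rw [← coloringOf_eq_zero hA, h, coloringOf_eq_zero hB]

lemma coloringOf_setOf_eq_zero (ω : ConnColoring G 2) : coloringOf G _ ω.isSplit = ω := by
  refine Subtype.ext (funext fun v => ?_)
  have := coloringOf_eq_zero ω.isSplit v
  simp only [Set.mem_ofPred_eq] at this
  omega

open Classical in
lemma colorStep_eq_or (ω : ConnColoring G q) (v : V) (i : Fin q) :
    (colorStep G ω v i).1 = Function.update ω.1 v i ∨ colorStep G ω v i = ω := by
  by_cases h : ∀ j, IsContiguous G {u | Function.update ω.1 v i u = j}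
  · exact Or.inl (congrArg Subtype.val (dif_pos h))
  · exact Or.inr (dif_neg h)

open Classical in
lemma colorStep_eq_of_coe_eq {ω ω' : ConnColoring G q} {v : V} {i : Fin q}
    (h : ω'.1 = Function.update ω.1 v i) : colorStep G ω v i = ω' := by
  have hstate : ∀ j, IsContiguous G {u | Function.update ω.1 v i u = j} := h ▸ ω'.2
  exact (dif_pos hstate).trans (Subtype.ext h.symm)

lemma colorStep_eq_iff {ω ω' : ConnColoring G q} (hne : ω ≠ ω') (v : V) (i : Fin q) :
    colorStep G ω v i = ω' ↔ ω'.1 v = i ∧ ∀ u, u ≠ v → ω.1 u = ω'.1 u := by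
  classical
  have coe_eq_iff : ω'.1 = Function.update ω.1 v i ↔
      ω'.1 v = i ∧ ∀ u, u ≠ v → ω.1 u = ω'.1 u := by
    rw [Function.eq_update_iff]
    exact and_congr_right' (forall₂_congr fun _ _ => eq_comm)
  rw [← coe_eq_iff]
  refine ⟨?_, colorStep_eq_of_coe_eq⟩
  rintro rfl
  exact (colorStep_eq_or ω v i).resolve_right hne.symm

variable [Fintype V]

lemma colorChain_eq_uniformUpdateMatrix (G : SimpleGraph V) (q : ℕ) :
    colorChain G q = uniformUpdateMatrix (fun _ => Finset.univ) (colorStep G) := by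
  ext ω ω'
  simp only [colorChain, uniformUpdateMatrix, Finset.card_univ, Fintype.card_fin]

lemma colorChain_mem_rowStochastic [Nonempty V] [NeZero q] :
    colorChain G q ∈ Matrix.rowStochastic ℝ (ConnColoring G q) :=
  colorChain_eq_uniformUpdateMatrix G q ▸
    uniformUpdateMatrix_mem_rowStochastic fun _ => Finset.univ_nonempty

lemma colorChain_isSymm : (colorChain G q).IsSymm := by
  classical
  have card_colors : ∀ ω ω' : ConnColoring G q, ω ≠ ω' → ∀ v, Finset.card
      ({i | colorStep G ω v i = ω'} : Finset (Fin q)) =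
        if ∀ u, u ≠ v → ω.1 u = ω'.1 u then 1 else 0 := by
    intro ω ω' hne v
    simp only [colorStep_eq_iff hne]
    split_ifs with h
    · simp only [and_iff_left h, Finset.filter_eq, Finset.mem_univ, if_true,
        Finset.card_singleton]
    · simp [h]
  rw [colorChain_eq_uniformUpdateMatrix]
  refine uniformUpdateMatrix_isSymm (fun _ _ => rfl) fun ω ω' hne v => ?_
  rw [card_colors ω ω' hne, card_colors ω' ω hne.symm]
  simp only [eq_comm]

lemma exists_of_colorChain_ne_zero {ω ω' : ConnColoring G q} (h : colorChain G q ω ω' ≠ 0) :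
    ω = ω' ∨ ∃ v, ∀ u, u ≠ v → ω.1 u = ω'.1 u := by
  rw [colorChain_eq_uniformUpdateMatrix] at h
  obtain ⟨v, i, -, hstep⟩ := exists_step_eq_of_uniformUpdateMatrix_ne_zero h
  exact or_iff_not_imp_left.2 fun hne => ⟨v, ((colorStep_eq_iff hne v i).1 hstep).2⟩

open Classical in
lemma colorChain_pos {ω ω' : ConnColoring G q} {v : V} {i : Fin q}
    (h : ω'.1 = Function.update ω.1 v i) : 0 < colorChain G q ω ω' :=
  colorChain_eq_uniformUpdateMatrix G q ▸
    uniformUpdateMatrix_pos (Finset.mem_univ i) (colorStep_eq_of_coe_eq h)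

lemma isErgodicChain_colorChain [Nonempty V] (huniv : IsContiguous G Set.univ)
    (hG : IsPeelable G) : IsErgodicChain (colorChain G 2) (uniformDist _) := by
  classical
  have stay : ∀ ω : ConnColoring G 2, 0 < colorChain G 2 ω ω := fun ω =>
    colorChain_pos (v := Classical.arbitrary V) (Function.update_eq_self _ ω.1).symm
  have reach : ∀ A (h : IsSplit G A),
      Relation.ReflTransGen (fun ω ω' => 0 < colorChain G 2 ω ω') (coloringOf G A h)
        (coloringOf G ∅ (isSplit_empty huniv)) := by
    intro A h
    induction A, h using hG.induction with
    | empty => exact Relation.ReflTransGen.refl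
    | insert A v hv h hs ih =>
      refine Relation.ReflTransGen.head (colorChain_pos (v := v) (i := 1) (funext fun u => ?_)) ih
      rcases eq_or_ne u v with rfl | hu
      · simp [coloringOf]
      · simp [coloringOf, hu]
  refine isErgodicChain_of_isSymm colorChain_mem_rowStochastic colorChain_isSymm stay
    (coloringOf G ∅ (isSplit_empty huniv)) fun ω => ?_
  rw [← coloringOf_setOf_eq_zero ω]
  exact reach _ ω.isSplit

end ColorChain

/-! ### The partition chain -/

section PartitionChain

variable {V : Type*} {G : SimpleGraph V}

open Classical in
/-- The pair of sets obtained from a partition by moving `v` from its piece to the other one. -/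
def flipAt (p : Finset (Finset V)) (v : V) : Finset (Finset V) := p.image fun A => symmDiff A {v}

open Classical in
lemma flipAt_flipAt (p : Finset (Finset V)) (v : V) : flipAt (flipAt p v) v = p := by
  simp [flipAt, Finset.image_image, Function.comp_def]

open Classical in
lemma flipAt_eq_comm {p p' : Finset (Finset V)} {v : V} : flipAt p v = p' ↔ flipAt p' v = p :=
  ⟨fun h => h ▸ flipAt_flipAt p v, fun h => h ▸ flipAt_flipAt p' v⟩

variable [Fintype V]

open Classical in
lemma pair_compl_eq_iff {A B : Finset V} :
    ({A, Aᶜ} : Finset (Finset V)) = {B, Bᶜ} ↔ A = B ∨ A = Bᶜ := by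
  constructor
  · intro h
    simpa using (h ▸ Finset.mem_insert_self A _ : A ∈ ({B, Bᶜ} : Finset (Finset V)))
  · rintro (rfl | rfl)
    · rfl
    · rw [compl_compl, Finset.pair_comm]

open Classical in
lemma flipAt_pair (A : Finset V) (v : V) :
    flipAt {A, Aᶜ} v = {symmDiff A {v}, (symmDiff A {v})ᶜ} := by
  have symmDiff_compl : symmDiff Aᶜ {v} = (symmDiff A {v})ᶜ := by
    ext u
    simp only [Finset.mem_symmDiff, Finset.mem_compl]
    tauto
  rw [flipAt, Finset.image_insert, Finset.image_singleton, symmDiff_compl]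

open Classical in
lemma moveTo_pair_of_mem {A : Finset V} {v : V} (hv : v ∈ A) :
    moveTo {A, Aᶜ} v A = {A, Aᶜ} := by
  have : Nonempty V := ⟨v⟩
  simp [moveTo, Finset.image_insert, compl_ne_self, Finset.insert_eq_of_mem hv, hv]

open Classical in
lemma moveTo_pair_of_notMem {A : Finset V} {v : V} (hv : v ∉ A) :
    moveTo {A, Aᶜ} v A = flipAt {A, Aᶜ} v := by
  have : Nonempty V := ⟨v⟩
  have symmDiff_eq : symmDiff A {v} = insert v A := by
    rw [Finset.symmDiff_eq_union (Finset.disjoint_singleton_right.2 hv), Finset.union_comm,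
      Finset.insert_eq]
  rw [flipAt_pair, symmDiff_eq, moveTo, Finset.image_insert, Finset.image_singleton, if_pos rfl,
    if_neg (compl_ne_self (a := A)), Finset.compl_insert]

open Classical in
/-- The partition into `A` and its complement. -/
def partitionOf (G : SimpleGraph V) (A : Set V) (h : IsSplit G A) : ContigTwoPartition G :=
  ⟨{A.toFinset, A.toFinsetᶜ}, A.toFinset, rfl, by
    intro D hD
    rcases Finset.mem_insert.1 hD with rfl | hD
    · simpa using h.1
    · rw [Finset.mem_singleton.1 hD]
      simpa using h.2⟩

lemma partitionOf_eq_iff {A B : Set V} (hA : IsSplit G A) (hB : IsSplit G B) :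
    partitionOf G A hA = partitionOf G B hB ↔ A = B ∨ A = Bᶜ := by
  classical
  refine Subtype.ext_iff.trans (pair_compl_eq_iff.trans ?_)
  rw [← Set.toFinset_compl, Set.toFinset_inj, Set.toFinset_inj]

namespace ContigTwoPartition

lemma exists_eq (p : ContigTwoPartition G) :
    ∃ (A : Set V) (h : IsSplit G A), p = partitionOf G A h := by
  classical
  obtain ⟨p, A, rfl, hA⟩ := p
  refine ⟨A, ⟨hA A (by simp), ?_⟩, Subtype.ext ?_⟩
  · have := hA Aᶜ (by simp)
    rwa [Finset.coe_compl] at this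
  · simp [partitionOf]

/-- One of the two pieces of a partition, picked arbitrarily. -/
def piece (p : ContigTwoPartition G) : Set V := p.exists_eq.choose

lemma isSplit_piece (p : ContigTwoPartition G) : IsSplit G p.piece :=
  p.exists_eq.choose_spec.choose

lemma partitionOf_piece (p : ContigTwoPartition G) : partitionOf G p.piece p.isSplit_piece = p :=
  p.exists_eq.choose_spec.choose_spec.symm

open Classical in
lemma exists_pair (p : ContigTwoPartition G) (v : V) :
    ∃ A : Finset V, p.1 = {A, Aᶜ} ∧ v ∉ A := by
  obtain ⟨A, hp, -⟩ := p.2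
  by_cases hv : v ∈ A
  · exact ⟨Aᶜ, by rw [compl_compl, Finset.pair_comm, hp], by simpa using hv⟩
  · exact ⟨A, hp, hv⟩

lemma nonempty (p : ContigTwoPartition G) : p.1.Nonempty := by
  classical
  obtain ⟨A, hp, -⟩ := p.2
  exact hp ▸ Finset.insert_nonempty _ _

lemma card_eq_two [Nonempty V] (p : ContigTwoPartition G) : p.1.card = 2 := by
  classical
  obtain ⟨A, hp, -⟩ := p.2
  rw [hp, Finset.card_pair compl_ne_self.symm]

end ContigTwoPartition

lemma partitionStep_eq_or (p : ContigTwoPartition G) (v : V) (D : Finset V) :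
    (partitionStep G p v D).1 = moveTo p.1 v D ∨ partitionStep G p v D = p := by
  by_cases h : IsContigTwoPartition G (moveTo p.1 v D)
  · exact Or.inl (congrArg Subtype.val (dif_pos h))
  · exact Or.inr (dif_neg h)

lemma partitionStep_eq_of_moveTo_eq {p p' : ContigTwoPartition G} {v : V} {D : Finset V}
    (h : moveTo p.1 v D = p'.1) : partitionStep G p v D = p' := by
  have hstate : IsContigTwoPartition G (moveTo p.1 v D) := h ▸ p'.2
  exact (dif_pos hstate).trans (Subtype.ext h)

lemma partitionStep_eq_iff {p p' : ContigTwoPartition G} (hne : p ≠ p') (v : V) (D : Finset V) :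
    partitionStep G p v D = p' ↔ moveTo p.1 v D = p'.1 := by
  classical
  refine ⟨?_, partitionStep_eq_of_moveTo_eq⟩
  rintro rfl
  exact ((partitionStep_eq_or p v D).resolve_right hne.symm).symm

open Classical in
/-- Of the two pieces, only the one that does not contain `v` yields a move. -/
lemma exists_partitionStep_iff {p p' : ContigTwoPartition G} (hne : p ≠ p') {v : V} :
    ∃ D₀ ∈ p.1, ∀ D ∈ p.1, partitionStep G p v D = p' ↔ D = D₀ ∧ flipAt p.1 v = p'.1 := by
  have : Nonempty V := ⟨v⟩
  obtain ⟨A, hp, hv⟩ := p.exists_pair v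
  have move_compl : moveTo p.1 v Aᶜ = p.1 := by
    have := moveTo_pair_of_mem (A := Aᶜ) (v := v) (by simpa using hv)
    rwa [compl_compl, Finset.pair_comm, ← hp] at this
  refine ⟨A, hp ▸ Finset.mem_insert_self A _, fun D hD => ?_⟩
  rw [partitionStep_eq_iff hne]
  rw [hp, Finset.mem_insert, Finset.mem_singleton] at hD
  rcases hD with rfl | rfl
  · rw [hp, moveTo_pair_of_notMem hv]
    simp
  · rw [move_compl]
    exact iff_of_false (fun h => hne (Subtype.ext h)) fun h => compl_ne_self h.1

lemma partitionChain_eq_uniformUpdateMatrix (G : SimpleGraph V) :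
    partitionChain G = uniformUpdateMatrix (fun p => p.1) (partitionStep G) := rfl

lemma partitionChain_mem_rowStochastic [Nonempty V] :
    partitionChain G ∈ Matrix.rowStochastic ℝ (ContigTwoPartition G) :=
  uniformUpdateMatrix_mem_rowStochastic ContigTwoPartition.nonempty

lemma partitionChain_isSymm [Nonempty V] : (partitionChain G).IsSymm := by
  classical
  have card_pieces : ∀ p p' : ContigTwoPartition G, p ≠ p' → ∀ v,
      {D ∈ p.1 | partitionStep G p v D = p'}.card = if flipAt p.1 v = p'.1 then 1 else 0 := by
    intro p p' hne v
    obtain ⟨D₀, hD₀, hstep⟩ := exists_partitionStep_iff hne (v := v)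
    rw [Finset.filter_congr hstep]
    split_ifs with h <;> simp [h, hD₀, Finset.filter_eq']
  rw [partitionChain_eq_uniformUpdateMatrix]
  refine uniformUpdateMatrix_isSymm (fun p p' => by rw [p.card_eq_two, p'.card_eq_two])
    fun p p' hne v => ?_
  rw [card_pieces p p' hne, card_pieces p' p hne.symm]
  exact if_congr flipAt_eq_comm rfl rfl

lemma exists_of_partitionChain_ne_zero {p p' : ContigTwoPartition G}
    (h : partitionChain G p p' ≠ 0) : p = p' ∨ ∃ v, (∀ u, u ≠ v → (u ∈ p.piece ↔ u ∈ p'.piece)) ∨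
      (∀ u, u ≠ v → (u ∈ p.piece ↔ u ∉ p'.piece)) := by
  classical
  obtain ⟨v, D, hD, hstep⟩ := exists_step_eq_of_uniformUpdateMatrix_ne_zero h
  refine or_iff_not_imp_left.2 fun hne => ⟨v, ?_⟩
  obtain ⟨_, -, hiff⟩ := exists_partitionStep_iff hne (v := v)
  have hflip := ((hiff D hD).1 hstep).2
  rw [← p.partitionOf_piece, ← p'.partitionOf_piece] at hflip
  simp only [partitionOf, flipAt_pair, pair_compl_eq_iff] at hflip
  refine hflip.imp ?_ ?_ <;>
  · intro heq u hu
    simpa [Finset.mem_symmDiff, hu] using congrArg (u ∈ ·) heq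

open Classical in
lemma partitionChain_pos_of_flipAt {p p' : ContigTwoPartition G} {v : V}
    (h : flipAt p.1 v = p'.1) : 0 < partitionChain G p p' := by
  obtain ⟨A, hp, hv⟩ := p.exists_pair v
  refine uniformUpdateMatrix_pos (v := v) (i := A) (hp ▸ Finset.mem_insert_self A _)
    (partitionStep_eq_of_moveTo_eq ?_)
  rw [← h, hp, moveTo_pair_of_notMem hv]

lemma partitionChain_self_pos [Nonempty V] (p : ContigTwoPartition G) :
    0 < partitionChain G p p := by
  classical
  obtain ⟨v⟩ := ‹Nonempty V›
  obtain ⟨A, hp, hv⟩ := p.exists_pair v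
  have hp' : p.1 = {Aᶜ, Aᶜᶜ} := by rw [compl_compl, Finset.pair_comm, hp]
  refine uniformUpdateMatrix_pos (v := v) (i := Aᶜ) (hp' ▸ Finset.mem_insert_self _ _)
    (partitionStep_eq_of_moveTo_eq ?_)
  rw [hp', moveTo_pair_of_mem (by simpa using hv)]

lemma isErgodicChain_partitionChain [Nonempty V] (huniv : IsContiguous G Set.univ)
    (hG : IsPeelable G) : IsErgodicChain (partitionChain G) (uniformDist _) := by
  classical
  have reach : ∀ A (h : IsSplit G A),
      Relation.ReflTransGen (fun p p' => 0 < partitionChain G p p') (partitionOf G A h)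
        (partitionOf G ∅ (isSplit_empty huniv)) := by
    intro A h
    induction A, h using hG.induction with
    | empty => exact Relation.ReflTransGen.refl
    | insert A v hv h hs ih =>
      have symmDiff_eq : symmDiff A.toFinset {v} = (A \ {v}).toFinset := by
        rw [symmDiff_of_ge (by simpa using hv), Set.toFinset_sdiff, Set.toFinset_singleton]
      exact Relation.ReflTransGen.head (partitionChain_pos_of_flipAt (v := v)
        (by simp only [partitionOf, flipAt_pair, symmDiff_eq]; congr!)) ih
  refine isErgodicChain_of_isSymm partitionChain_mem_rowStochastic partitionChain_isSymm
    partitionChain_self_pos (partitionOf G ∅ (isSplit_empty huniv)) fun p => ?_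
  rw [← p.partitionOf_piece]
  exact reach _ p.isSplit_piece

end PartitionChain

/-! ### Domain walls in the planar square lattice -/

section Planar

/-- The square lattice on the quadrant `ℕ × ℕ`. -/
def squareLattice : SimpleGraph (ℕ × ℕ) := (SimpleGraph.hasse ℕ).boxProd (SimpleGraph.hasse ℕ)

/-- An edge of the square lattice: `(x, y, false)` joins `(x, y)` to `(x + 1, y)`, and
`(x, y, true)` joins `(x, y)` to `(x, y + 1)`. -/
abbrev LatEdge := ℕ × ℕ × Bool

/-- The lower or left end of an edge. -/
def LatEdge.src (e : LatEdge) : ℕ × ℕ := (e.1, e.2.1)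

/-- The upper or right end of an edge. -/
def LatEdge.tgt (e : LatEdge) : ℕ × ℕ := bif e.2.2 then (e.1, e.2.1 + 1) else (e.1 + 1, e.2.1)

lemma squareLattice_adj_iff {u v : ℕ × ℕ} : squareLattice.Adj u v ↔
    ((u.1 + 1 = v.1 ∨ v.1 + 1 = u.1) ∧ u.2 = v.2) ∨
      (u.2 + 1 = v.2 ∨ v.2 + 1 = u.2) ∧ u.1 = v.1 := by
  simp only [squareLattice, SimpleGraph.boxProd_adj, SimpleGraph.hasse_adj,
    Nat.covBy_iff_add_one_eq]

lemma squareLattice_adj_iff_exists_latEdge {u v : ℕ × ℕ} : squareLattice.Adj u v ↔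
    ∃ e : LatEdge, (u = e.src ∧ v = e.tgt) ∨ (v = e.src ∧ u = e.tgt) := by
  simp only [squareLattice_adj_iff, LatEdge.src, LatEdge.tgt, Prod.exists, Bool.exists_bool,
    Prod.ext_iff, cond_true, cond_false]
  grind

/-- The corners of the unit square with lower left corner `s`. -/
def corner (s : ℕ × ℕ) (q : Bool × Bool) : ℕ × ℕ := (s.1 + q.1.toNat, s.2 + q.2.toNat)

/-- The sides of the unit square with lower left corner `s`: the flag `p.2` selects the vertical
sides, and `p.1` selects the side that does not contain `s`. -/
def side (s : ℕ × ℕ) (p : Bool × Bool) : LatEdge :=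
  bif p.2 then (s.1 + p.1.toNat, s.2, true) else (s.1, s.2 + p.1.toNat, false)

lemma src_side (s : ℕ × ℕ) (p : Bool × Bool) :
    (side s p).src = corner s (bif p.2 then (p.1, false) else (false, p.1)) := by
  rcases p with ⟨_, _ | _⟩ <;> rfl

lemma tgt_side (s : ℕ × ℕ) (p : Bool × Bool) :
    (side s p).tgt = corner s (bif p.2 then (p.1, true) else (true, p.1)) := by
  rcases p with ⟨_, _ | _⟩ <;> rfl

lemma snd_snd_side (s : ℕ × ℕ) (p : Bool × Bool) : (side s p).2.2 = p.2 := by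
  rcases p with ⟨_, _ | _⟩ <;> rfl

lemma side_injective (s : ℕ × ℕ) : Function.Injective (side s) := by
  rintro ⟨_ | _, _ | _⟩ ⟨_ | _, _ | _⟩ h <;> simp_all [side]

lemma side_left_injective (p : Bool × Bool) : Function.Injective (side · p) := by
  rintro s s' h
  rcases p with ⟨_, _ | _⟩ <;> simp_all [side, Prod.ext_iff]

variable {W : Finset (ℕ × ℕ)} {χ : ℕ × ℕ → Bool} {s : ℕ × ℕ} {p q q' : Bool × Bool}

/-- The unit square with lower left corner `s` is contained in the region `W`. -/
def IsSquare (W : Finset (ℕ × ℕ)) (s : ℕ × ℕ) : Prop := ∀ q, corner s q ∈ W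

/-- Simple connectedness of a lattice region: every mod 2 cochain on its edges that vanishes
around all unit squares is a coboundary. -/
def IsSimplyConn (W : Finset (ℕ × ℕ)) : Prop :=
  ∀ f : LatEdge → ZMod 2, (∀ s, IsSquare W s → ∑ p, f (side s p) = 0) →
    ∃ φ : ℕ × ℕ → ZMod 2, ∀ e : LatEdge, e.src ∈ W → e.tgt ∈ W → φ e.tgt = φ e.src + f e

/-- The edge `e` of the region `W` joins points of different colors. -/
def IsCut (W : Finset (ℕ × ℕ)) (χ : ℕ × ℕ → Bool) (e : LatEdge) : Prop :=
  e.src ∈ W ∧ e.tgt ∈ W ∧ χ e.src ≠ χ e.tgt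

open Classical in
/-- The sides of the square `s` crossed by a domain wall. -/
def cutSides (W : Finset (ℕ × ℕ)) (χ : ℕ × ℕ → Bool) (s : ℕ × ℕ) : Finset (Bool × Bool) :=
  {p | IsCut W χ (side s p)}

/-- The sides `p` and `q` of the square `s` are consecutive in the domain wall running through
`s`; where two walls meet, one of them crosses the two sides at the lower left corner and the
other one the two sides at the upper right corner. -/
structure IsPaired (W : Finset (ℕ × ℕ)) (χ : ℕ × ℕ → Bool) (s : ℕ × ℕ) (p q : Bool × Bool) :
    Prop where
  ne : p ≠ q
  left_mem : p ∈ cutSides W χ s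
  right_mem : q ∈ cutSides W χ s
  fst_eq : cutSides W χ s = Finset.univ → p.1 = q.1

lemma mem_cutSides : p ∈ cutSides W χ s ↔ IsCut W χ (side s p) := by simp [cutSides]

lemma IsSquare.even_card_cutSides (hs : IsSquare W s) : Even (cutSides W χ s).card := by
  classical
  have parity : ∀ c : Bool × Bool → Bool, Even (Finset.card {p : Bool × Bool |
      c (bif p.2 then (p.1, false) else (false, p.1)) ≠
        c (bif p.2 then (p.1, true) else (true, p.1))}) := by decide
  convert parity fun q => χ (corner s q) using 2
  ext p
  simp [mem_cutSides, IsCut, src_side, tgt_side, hs _]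

lemma IsPaired.symm (h : IsPaired W χ s p q) : IsPaired W χ s q p :=
  ⟨h.ne.symm, h.right_mem, h.left_mem, fun huniv => (h.fst_eq huniv).symm⟩

lemma IsPaired.right_unique (hs : IsSquare W s) (h : IsPaired W χ s p q)
    (h' : IsPaired W χ s p q') : q = q' := by
  by_contra hne
  have three_le : 3 ≤ (cutSides W χ s).card := by
    rw [← Finset.card_eq_three.2 ⟨p, q, q', h.ne, h'.ne, hne, rfl⟩]
    refine Finset.card_le_card ?_
    simp [Finset.insert_subset_iff, h.left_mem, h.right_mem, h'.right_mem]
  have huniv : cutSides W χ s = Finset.univ := by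
    refine Finset.eq_univ_of_card _ (le_antisymm (Finset.card_le_univ _) ?_)
    have := hs.even_card_cutSides (χ := χ)
    rw [show Fintype.card (Bool × Bool) = 4 from rfl]
    grind
  have pigeonhole : ∀ p q q' : Bool × Bool, p ≠ q → p ≠ q' → p.1 = q.1 → p.1 = q'.1 → q = q' := by
    decide
  exact hne (pigeonhole p q q' h.ne h'.ne (h.fst_eq huniv) (h'.fst_eq huniv))

lemma IsSquare.sum_side_eq_zero (hs : IsSquare W s) {f : LatEdge → ZMod 2}
    (hzero : ∀ e, ¬ IsCut W χ e → f e = 0)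
    (hpair : ∀ p q, IsPaired W χ s p q → f (side s p) = f (side s q)) :
    ∑ p, f (side s p) = 0 := by
  by_cases huniv : cutSides W χ s = Finset.univ
  · have opposite : ∀ b, f (side s (b, true)) = f (side s (b, false)) := fun b =>
      hpair _ _ ⟨by simp, by simp [huniv], by simp [huniv], fun _ => rfl⟩
    simp [Fintype.sum_prod_type, opposite, CharTwo.add_self_eq_zero]
  rw [← Finset.sum_subset (cutSides W χ s).subset_univ
    fun p _ hp => hzero _ (mt mem_cutSides.2 hp)]
  rcases (cutSides W χ s).eq_empty_or_nonempty with hempty | ⟨p₀, hp₀⟩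
  · simp [hempty]
  have const : ∀ p ∈ cutSides W χ s, f (side s p) = f (side s p₀) := fun p hp => by
    rcases eq_or_ne p p₀ with rfl | hne
    · rfl
    · exact hpair _ _ ⟨hne, hp, hp₀, fun h => absurd h huniv⟩
  obtain ⟨n, hn⟩ := hs.even_card_cutSides (χ := χ)
  rw [Finset.sum_eq_card_nsmul const, hn, add_nsmul, CharTwo.add_self_eq_zero]

open Classical in
/-- The edges of `W` crossed by a domain wall of the coloring `χ`. -/
def cutEdges (W : Finset (ℕ × ℕ)) (χ : ℕ × ℕ → Bool) : Finset LatEdge :=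
  ((W ×ˢ (Finset.univ : Finset Bool)).image fun q => (q.1.1, q.1.2, q.2)).filter (IsCut W χ)

lemma mem_cutEdges {e : LatEdge} : e ∈ cutEdges W χ ↔ IsCut W χ e := by
  simp only [cutEdges, Finset.mem_filter, and_iff_right_iff_imp, Finset.mem_image]
  exact fun h => ⟨(e.src, e.2.2), by simpa using h.1, rfl⟩

/-- The domain walls of a coloring, as a graph on the cut edges: consecutive cut edges are
adjacent. -/
def wallGraph (W : Finset (ℕ × ℕ)) (χ : ℕ × ℕ → Bool) : SimpleGraph (cutEdges W χ) where
  Adj e e' := ∃ s p q, IsSquare W s ∧ IsPaired W χ s p q ∧ side s p = e ∧ side s q = e'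
  symm := ⟨fun _ _ ⟨s, p, q, hs, h, hp, hq⟩ => ⟨s, q, p, hs, h.symm, hq, hp⟩⟩
  loopless := ⟨fun _ ⟨s, _, _, _, h, hp, hq⟩ => h.ne (side_injective s (hp.trans hq.symm))⟩

/-- Both color classes of the coloring `χ` of the region `W` are contiguous. -/
def HasConnClasses (W : Finset (ℕ × ℕ)) (χ : ℕ × ℕ → Bool) : Prop :=
  ∀ b, IsContiguous squareLattice {p | p ∈ W ∧ χ p = b}

lemma HasConnClasses.add_eq_of_isCut {M : Type*} [AddCommMagma M] (hχ : HasConnClasses W χ)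
    {φ : ℕ × ℕ → M}
    (hφ : ∀ e : LatEdge, e.src ∈ W → e.tgt ∈ W → χ e.src = χ e.tgt → φ e.src = φ e.tgt)
    {e e' : LatEdge} (he : IsCut W χ e) (he' : IsCut W χ e') :
    φ e.src + φ e.tgt = φ e'.src + φ e'.tgt := by
  have const : ∀ {u v}, u ∈ W → v ∈ W → χ u = χ v → φ u = φ v := fun {u v} hu hv huv =>
    (hχ (χ v)).eq_of_forall_adj (f := φ) (by
      rintro x ⟨hx, hxv⟩ y ⟨hy, hyv⟩ hxy
      obtain ⟨d, ⟨rfl, rfl⟩ | ⟨rfl, rfl⟩⟩ := squareLattice_adj_iff_exists_latEdge.1 hxy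
      · exact hφ d hx hy (hxv.trans hyv.symm)
      · exact (hφ d hy hx (hyv.trans hxv.symm)).symm) ⟨hu, huv⟩ ⟨hv, rfl⟩
  obtain ⟨hs, ht, hne⟩ := he
  obtain ⟨hs', ht', hne'⟩ := he'
  rw [← Bool.eq_not_iff] at hne hne'
  by_cases h : χ e.src = χ e'.src
  · rw [const hs hs' h, const ht ht' (Bool.not_inj (by rw [← hne, ← hne', h]))]
  · rw [← ne_eq, ← Bool.eq_not_iff] at h
    rw [const hs ht' (by rw [h, hne', Bool.not_not]),
      const ht hs' (Bool.not_inj (by rw [← h, ← hne])), add_comm]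

/-- The indicator of a component of the wall graph is a cocycle, hence the coboundary of some `φ`;
as `φ` is constant on the color classes, the indicator is constant on the cut edges. -/
lemma wallGraph_preconnected (hW : IsSimplyConn W) (hχ : HasConnClasses W χ) :
    (wallGraph W χ).Preconnected := by
  classical
  rintro ⟨e₀, he₀⟩ ⟨e₁, he₁⟩
  let f : LatEdge → ZMod 2 := fun e =>
    if ∃ he : e ∈ cutEdges W χ, (wallGraph W χ).Reachable ⟨e₀, he₀⟩ ⟨e, he⟩ then 1 else 0
  have hzero : ∀ e, ¬ IsCut W χ e → f e = 0 := fun e he => if_neg fun h => he (mem_cutEdges.1 h.1)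
  have reachable_of_isPaired : ∀ s p q, IsSquare W s → IsPaired W χ s p q →
      (∃ he, (wallGraph W χ).Reachable ⟨e₀, he₀⟩ ⟨side s p, he⟩) →
      ∃ he, (wallGraph W χ).Reachable ⟨e₀, he₀⟩ ⟨side s q, he⟩ := fun s p q hs h ⟨_, hreach⟩ =>
    ⟨mem_cutEdges.2 (mem_cutSides.1 h.right_mem),
      hreach.trans (SimpleGraph.Adj.reachable ⟨s, p, q, hs, h, rfl, rfl⟩)⟩
  obtain ⟨φ, hφ⟩ := hW f fun s hs => hs.sum_side_eq_zero hzero fun p q h =>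
    if_congr ⟨reachable_of_isPaired s p q hs h, reachable_of_isPaired s q p hs h.symm⟩ rfl rfl
  have eq_add : ∀ e ∈ cutEdges W χ, f e = φ e.src + φ e.tgt := fun e he => by
    rw [hφ e (mem_cutEdges.1 he).1 (mem_cutEdges.1 he).2.1, ← add_assoc,
      CharTwo.add_self_eq_zero, zero_add]
  have f_eq : f e₁ = f e₀ := by
    rw [eq_add e₁ he₁, eq_add e₀ he₀]
    refine hχ.add_eq_of_isCut (fun e hs ht h => ?_) (mem_cutEdges.1 he₁) (mem_cutEdges.1 he₀)
    rw [hφ e hs ht, hzero e fun hcut => hcut.2.2 h, add_zero]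
  have f_ne : f e₁ ≠ 0 := by
    rw [f_eq, show f e₀ = 1 from if_pos ⟨he₀, SimpleGraph.Reachable.refl _⟩]
    exact one_ne_zero
  exact (ite_ne_right_iff.1 f_ne).1.2

/-- The edge `e` lies on the outer boundary of `W`: it is a side of at most one square. -/
def IsOuter (W : Finset (ℕ × ℕ)) (e : LatEdge) : Prop :=
  {s | IsSquare W s ∧ e ∈ Set.range (side s)}.Subsingleton

open Classical in
lemma degree_wallGraph_le_two (e : cutEdges W χ) : (wallGraph W χ).degree e ≤ 2 := by
  have adj : ∀ a, (wallGraph W χ).Adj e a →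
      ∃ s p q, IsSquare W s ∧ IsPaired W χ s p q ∧ side s p = e ∧ side s q = a := fun _ h => h
  choose! square p q hsquare hpair hp hq using adj
  rw [← SimpleGraph.card_neighborFinset_eq_degree, ← Fintype.card_bool, ← Finset.card_univ]
  refine Finset.card_le_card_of_injOn (fun a => (p a).1)
    (fun a _ => Finset.mem_coe.2 (Finset.mem_univ _)) fun a ha b hb hab => ?_
  simp only [SimpleGraph.coe_neighborFinset, SimpleGraph.mem_neighborSet] at ha hb
  have p_eq : p a = p b :=
    Prod.ext hab (by rw [← snd_snd_side (square a), hp a ha, ← hp b hb, snd_snd_side])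
  have square_eq : square a = square b :=
    side_left_injective (p b) (((p_eq ▸ hp a ha).trans (hp b hb).symm))
  have q_eq : q a = q b := (hpair a ha).right_unique (hsquare a ha)
    (p_eq ▸ square_eq ▸ hpair b hb)
  exact Subtype.ext (by rw [← hq a ha, ← hq b hb, square_eq, q_eq])

open Classical in
lemma IsOuter.degree_wallGraph_le_one {e : cutEdges W χ} (he : IsOuter W e) :
    (wallGraph W χ).degree e ≤ 1 := by
  rw [← SimpleGraph.card_neighborFinset_eq_degree]
  refine Finset.card_le_one.2 fun a ha b hb => ?_
  rw [SimpleGraph.mem_neighborFinset] at ha hb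
  obtain ⟨s, p, q, hs, hpq, hp, hq⟩ := ha
  obtain ⟨s', p', q', hs', hpq', hp', hq'⟩ := hb
  obtain rfl : s = s' := he ⟨hs, p, hp⟩ ⟨hs', p', hp'⟩
  obtain rfl : p = p' := side_injective s (hp.trans hp'.symm)
  exact Subtype.ext (by rw [← hq, ← hq', hpq.right_unique hs hpq'])

open Classical in
lemma card_le_two_of_degree_le {V : Type*} [Fintype V] {G : SimpleGraph V}
    (hG : G.Preconnected) {S : Finset V} (hdeg : ∀ v, G.degree v ≤ 2)
    (hS : ∀ v ∈ S, G.degree v ≤ 1) : S.card ≤ 2 := by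
  rcases isEmpty_or_nonempty V with _ | _
  · simp [Finset.eq_empty_of_isEmpty S]
  have hcard := (SimpleGraph.Connected.mk hG).card_vert_le_card_edgeSet_add_one
  have hsum : ∑ v, (G.degree v + if v ∈ S then 1 else 0) ≤ ∑ _v : V, 2 :=
    Finset.sum_le_sum fun v _ => by
      split_ifs with h
      · exact Nat.succ_le_succ (hS v h)
      · exact hdeg v
  rw [Finset.sum_add_distrib, SimpleGraph.sum_degrees_eq_twice_card_edges] at hsum
  simp only [Finset.sum_ite_mem, Finset.univ_inter, Finset.sum_const, Finset.card_univ,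
    smul_eq_mul, mul_one] at hsum
  rw [Nat.card_eq_fintype_card, Nat.card_eq_fintype_card, ← SimpleGraph.edgeFinset_card] at hcard
  omega

open Classical in
lemma card_outer_cutEdges_le (hW : IsSimplyConn W) (hχ : HasConnClasses W χ) :
    ((cutEdges W χ).filter (IsOuter W)).card ≤ 2 := by
  rw [Finset.card_filter, ← Finset.sum_coe_sort, ← Finset.card_filter]
  refine card_le_two_of_degree_le (wallGraph_preconnected hW hχ) degree_wallGraph_le_two
    fun e he => IsOuter.degree_wallGraph_le_one (Finset.mem_filter.1 he).2

end Planar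

/-! ### Rectangles -/

section Rectangle

variable {a b c d : ℕ}

/-- The rectangle `[a, b) × [c, d)` of lattice points. -/
def rect (a b c d : ℕ) : Finset (ℕ × ℕ) := Finset.Ico a b ×ˢ Finset.Ico c d

lemma mem_rect {p : ℕ × ℕ} : p ∈ rect a b c d ↔ (a ≤ p.1 ∧ p.1 < b) ∧ c ≤ p.2 ∧ p.2 < d := by
  simp [rect, Finset.mem_product]

/-- The potential of `f` at a point is the sum of `f` along the path from the lower left corner
that first runs horizontally and then vertically. -/
lemma isSimplyConn_rect (a b c d : ℕ) : IsSimplyConn (rect a b c d) := by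
  intro f hf
  refine ⟨fun p => ∑ i ∈ Finset.Ico a p.1, f (i, c, false) +
    ∑ j ∈ Finset.Ico c p.2, f (p.1, j, true), fun ⟨x, y, vertical⟩ hs ht => ?_⟩
  cases vertical <;>
    simp only [LatEdge.src, LatEdge.tgt, cond_false, cond_true, mem_rect] at hs ht ⊢
  · rw [Finset.sum_Ico_succ_top hs.1.1]
    obtain ⟨⟨hax, -⟩, hcy, hyd⟩ := hs
    have hxb := ht.1.2
    clear ht
    induction y, hcy using Nat.le_induction with
    | base => simp
    | succ y hy ih =>
      have hsq := hf (x, y) (by simp [IsSquare, corner, mem_rect]; omega)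
      simp only [Fintype.sum_prod_type, Fintype.sum_bool, side, cond_true, cond_false,
        Bool.toNat_true, Bool.toNat_false, add_zero] at hsq
      rw [Finset.sum_Ico_succ_top hy, Finset.sum_Ico_succ_top hy]
      linear_combination ih (by omega) + hsq - CharTwo.add_self_eq_zero (f (x, y, true))
        - CharTwo.add_self_eq_zero (f (x, y + 1, false))
  · rw [Finset.sum_Ico_succ_top hs.2.1, add_assoc]

lemma eq_of_forall_eq_succ {α : Type*} {f : ℕ → α}
    (h : ∀ i, a ≤ i → i + 1 < b → f i = f (i + 1)) {i j : ℕ} (hai : a ≤ i) (hib : i < b)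
    (haj : a ≤ j) (hjb : j < b) : f i = f j := by
  wlog hij : i ≤ j generalizing i j
  · exact (this haj hjb hai hib (le_of_not_ge hij)).symm
  induction j, hij using Nat.le_induction with
  | base => rfl
  | succ j hj ih => exact (ih (by omega) (by omega)).trans (h j (by omega) hjb)

/-- Rows and columns avoiding `v` lead from every point to the row `y` and the column `x`, which
avoid `v`. -/
lemma isContiguous_rect_sdiff_singleton (hab : a + 2 ≤ b) (hcd : c + 2 ≤ d) (v : ℕ × ℕ) :
    IsContiguous squareLattice (rect a b c d \ {v}) := by
  refine isContiguous_of_forall fun f hf => ?_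
  simp only [Set.mem_sdiff, Finset.mem_coe, mem_rect, Set.mem_singleton_iff] at hf ⊢
  have row : ∀ y, c ≤ y → y < d → y ≠ v.2 → ∀ i j, a ≤ i → i < b → a ≤ j → j < b →
      f (i, y) = f (j, y) := fun y hcy hyd hyv _ _ hi hi' hj hj' =>
    eq_of_forall_eq_succ (f := fun i => f (i, y)) (fun i hai hib =>
      hf _ ⟨⟨⟨hai, by omega⟩, hcy, hyd⟩, fun h => hyv (by rw [← h])⟩ _
        ⟨⟨⟨by omega, hib⟩, hcy, hyd⟩, fun h => hyv (by rw [← h])⟩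
        (squareLattice_adj_iff.2 (by simp))) hi hi' hj hj'
  have col : ∀ x, a ≤ x → x < b → x ≠ v.1 → ∀ i j, c ≤ i → i < d → c ≤ j → j < d →
      f (x, i) = f (x, j) := fun x hax hxb hxv _ _ hi hi' hj hj' =>
    eq_of_forall_eq_succ (f := fun i => f (x, i)) (fun i hci hid =>
      hf _ ⟨⟨⟨hax, hxb⟩, hci, by omega⟩, fun h => hxv (by rw [← h])⟩ _
        ⟨⟨⟨hax, hxb⟩, by omega, hid⟩, fun h => hxv (by rw [← h])⟩
        (squareLattice_adj_iff.2 (by simp))) hi hi' hj hj'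
  obtain ⟨x, hax, hxb, hxv⟩ : ∃ x, a ≤ x ∧ x < b ∧ x ≠ v.1 := by
    by_cases h : a = v.1
    exacts [⟨a + 1, by omega⟩, ⟨a, by omega⟩]
  obtain ⟨y, hcy, hyd, hyv⟩ : ∃ y, c ≤ y ∧ y < d ∧ y ≠ v.2 := by
    by_cases h : c = v.2
    exacts [⟨c + 1, by omega⟩, ⟨c, by omega⟩]
  have eq_base : ∀ i j, a ≤ i → i < b → c ≤ j → j < d → (i, j) ≠ v → f (i, j) = f (x, y) := by
    intro i j hai hib hcj hjd hij
    by_cases hj : j = v.2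
    · rw [col i hai hib (fun hi => hij (Prod.ext hi hj)) j y hcj hjd hcy hyd,
        row y hcy hyd hyv i x hai hib hax hxb]
    · rw [row j hcj hjd hj i x hai hib hax hxb, col x hax hxb hxv j y hcj hjd hcy hyd]
  rintro ⟨i, j⟩ ⟨⟨⟨h1, h2⟩, h3, h4⟩, h5⟩ ⟨i', j'⟩ ⟨⟨⟨h1', h2'⟩, h3', h4'⟩, h5'⟩
  rw [eq_base i j h1 h2 h3 h4 h5, eq_base i' j' h1' h2' h3' h4' h5']

lemma isContiguous_rect (hab : a + 2 ≤ b) (hcd : c + 2 ≤ d) :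
    IsContiguous squareLattice (rect a b c d) := by
  have := isContiguous_rect_sdiff_singleton hab hcd (b, d)
  rwa [Set.sdiff_singleton_eq_self (by simp [mem_rect])] at this

lemma IsSquare.mono {W W' : Finset (ℕ × ℕ)} (hW : W ⊆ W') {s : ℕ × ℕ} (hs : IsSquare W s) :
    IsSquare W' s := fun q => hW (hs q)

/-- The mod 2 case of the van Kampen theorem: two potentials of a cochain differ by a constant on
the connected intersection, so they can be glued. -/
lemma IsSimplyConn.union {W₁ W₂ : Finset (ℕ × ℕ)} (h₁ : IsSimplyConn W₁) (h₂ : IsSimplyConn W₂)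
    (hedge : ∀ e : LatEdge, e.src ∈ W₁ ∪ W₂ → e.tgt ∈ W₁ ∪ W₂ →
      (e.src ∈ W₁ ∧ e.tgt ∈ W₁) ∨ (e.src ∈ W₂ ∧ e.tgt ∈ W₂))
    (hinter : IsContiguous squareLattice (↑W₁ ∩ ↑W₂)) : IsSimplyConn (W₁ ∪ W₂) := by
  intro f hf
  obtain ⟨φ₁, hφ₁⟩ := h₁ f fun s hs => hf s (hs.mono Finset.subset_union_left)
  obtain ⟨φ₂, hφ₂⟩ := h₂ f fun s hs => hf s (hs.mono Finset.subset_union_right)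
  have sub_eq : ∀ e : LatEdge, e.src ∈ W₁ ∧ e.src ∈ W₂ → e.tgt ∈ W₁ ∧ e.tgt ∈ W₂ →
      φ₁ e.src - φ₂ e.src = φ₁ e.tgt - φ₂ e.tgt := fun e hs ht => by
    rw [hφ₁ e hs.1 ht.1, hφ₂ e hs.2 ht.2, add_sub_add_right_eq_sub]
  obtain ⟨k, hk⟩ : ∃ k, ∀ u, u ∈ W₁ ∧ u ∈ W₂ → φ₁ u - φ₂ u = k := by
    rcases (↑W₁ ∩ ↑W₂ : Set (ℕ × ℕ)).eq_empty_or_nonempty with hempty | ⟨o, ho⟩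
    · exact ⟨0, fun u hu => (hempty.le hu).elim⟩
    refine ⟨φ₁ o - φ₂ o, fun u hu => hinter.eq_of_forall_adj (f := fun u => φ₁ u - φ₂ u)
      (fun x hx y hy hxy => ?_) hu ho⟩
    obtain ⟨e, ⟨rfl, rfl⟩ | ⟨rfl, rfl⟩⟩ := squareLattice_adj_iff_exists_latEdge.1 hxy
    exacts [sub_eq e hx hy, (sub_eq e hy hx).symm]
  let φ u := if u ∈ W₁ then φ₁ u else φ₂ u + k
  have φ_eq : ∀ u ∈ W₂, φ u = φ₂ u + k := fun u hu => by
    by_cases h : u ∈ W₁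
    · rw [show φ u = φ₁ u from if_pos h, ← hk u ⟨h, hu⟩, add_sub_cancel]
    · exact if_neg h
  refine ⟨φ, fun e hs ht => ?_⟩
  rcases hedge e hs ht with ⟨hs, ht⟩ | ⟨hs, ht⟩
  · rw [show φ e.src = φ₁ e.src from if_pos hs, show φ e.tgt = φ₁ e.tgt from if_pos ht,
      hφ₁ e hs ht]
  · rw [φ_eq _ hs, φ_eq _ ht, hφ₂ e hs ht, add_right_comm]

end Rectangle

/-! ### Graphs embedded in the square lattice -/

section Embedding

variable {V : Type*} {G : SimpleGraph V}

lemma isContiguous_image_iff {V' : Type*} {H : SimpleGraph V'} (pos : G ↪g H) {A : Set V} :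
    IsContiguous H (pos '' A) ↔ IsContiguous G A := by
  refine (SimpleGraph.Iso.preconnected_iff ?_).symm
  exact ⟨Equiv.Set.image pos A pos.injective, by simp⟩

/-- The coloring of the lattice points that marks the vertices in `A` by `true`. -/
def markColoring (pos : V → ℕ × ℕ) (A : Set V) : ℕ × ℕ → Bool :=
  open Classical in fun p => decide (p ∈ pos '' A)

lemma markColoring_eq_of_ne {pos : V → ℕ × ℕ} {A B : Set V} {v : V}
    (h : ∀ u, u ≠ v → (u ∈ A ↔ u ∈ B)) {q : ℕ × ℕ} (hq : q ≠ pos v) :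
    markColoring pos A q = markColoring pos B q := by
  have ne_of_pos : ∀ u, pos u = q → u ≠ v := fun u hu huv => hq (huv ▸ hu.symm)
  rw [markColoring, markColoring, decide_eq_decide]
  exact exists_congr fun u => and_congr_left fun hu => h u (ne_of_pos u hu)

variable {W : Finset (ℕ × ℕ)} (pos : G ↪g squareLattice) {A : Set V}

lemma markColoring_eq_true_iff {v : V} : markColoring pos A (pos v) = true ↔ v ∈ A := by
  simp [markColoring]

lemma markColoring_eq_markColoring_iff {B : Set V} {v : V} :
    markColoring pos A (pos v) = markColoring pos B (pos v) ↔ (v ∈ A ↔ v ∈ B) := by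
  rw [Bool.eq_iff_iff, markColoring_eq_true_iff, markColoring_eq_true_iff]

lemma markColoring_eq_not_markColoring_iff {B : Set V} {v : V} :
    markColoring pos A (pos v) = !markColoring pos B (pos v) ↔ (v ∈ A ↔ v ∉ B) := by
  rw [Bool.eq_iff_iff, Bool.not_eq_true', ← Bool.not_eq_true, markColoring_eq_true_iff,
    markColoring_eq_true_iff]

lemma IsSplit.hasConnClasses_markColoring (hA : IsSplit G A) (hW : Set.range pos = W) :
    HasConnClasses W (markColoring pos A) := by
  have class_eq : ∀ b, {p | p ∈ W ∧ markColoring pos A p = b} =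
      pos '' {v | markColoring pos A (pos v) = b} := fun b => by
    ext p
    rw [Set.mem_ofPred_eq, ← Finset.mem_coe, ← hW]
    exact ⟨by rintro ⟨⟨v, rfl⟩, hv⟩; exact ⟨v, hv, rfl⟩,
      by rintro ⟨v, hv, rfl⟩; exact ⟨⟨v, rfl⟩, hv⟩⟩
  intro b
  rw [class_eq, isContiguous_image_iff]
  cases b
  · simpa [← Bool.not_eq_true, markColoring_eq_true_iff, ← Set.compl_def] using hA.2
  · simpa [markColoring_eq_true_iff] using hA.1

lemma isContiguous_compl_singleton_of_range (hW : Set.range pos = W)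
    (h : ∀ p, IsContiguous squareLattice (W \ {p})) (v : V) : IsContiguous G {v}ᶜ := by
  have := h (pos v)
  rwa [← hW, ← Set.image_univ, ← Set.image_singleton, ← Set.image_sdiff pos.injective,
    isContiguous_image_iff, ← Set.compl_eq_univ_sdiff] at this

lemma isContiguous_univ_of_range (hW : Set.range pos = W) (h : IsContiguous squareLattice W) :
    IsContiguous G Set.univ := by
  rwa [← hW, ← Set.image_univ, isContiguous_image_iff] at h

end Embedding

/-! ### Rows with few color changes -/

section Rows

variable {f g : ℕ → Bool} {m i j k : ℕ}

/-- The positions `i` with `i + 1 < m` at which the row `f` changes its color. -/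
def changes (f : ℕ → Bool) (m : ℕ) : Finset ℕ :=
  {i ∈ Finset.range (m - 1) | f i ≠ f (i + 1)}

lemma mem_changes : i ∈ changes f m ↔ i + 1 < m ∧ f i ≠ f (i + 1) := by
  simp only [changes, Finset.mem_filter, Finset.mem_range, Nat.lt_sub_iff_add_lt]

lemma changes_subset_range (f : ℕ → Bool) (m : ℕ) : changes f m ⊆ Finset.range m := fun _ hi =>
  Finset.mem_range.2 (Nat.lt_of_succ_lt (mem_changes.1 hi).1)

lemma exists_mem_changes (hij : i ≤ j) (hj : j < m) (h : f i ≠ f j) :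
    ∃ k ∈ changes f m, i ≤ k ∧ k < j := by
  contrapose! h
  induction j, hij using Nat.le_induction with
  | base => rfl
  | succ j hij ih =>
    rw [ih (by lia) fun k hk hik => j.le_succ.trans (h k hk hik)]
    by_contra hne
    exact absurd (h j (mem_changes.2 ⟨hj, hne⟩) hij) (by lia)

/-- The color of the first entry of a row together with the positions of its color changes. -/
def rowCode (f : ℕ → Bool) (m : ℕ) : Bool × Finset ℕ := (f 0, changes f m)

lemma eq_of_rowCode_eq (h : rowCode f m = rowCode g m) : ∀ i < m, f i = g i := by
  obtain ⟨hzero, hchanges⟩ := Prod.mk.inj h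
  intro i hi
  induction i with
  | zero => exact hzero
  | succ i ih =>
    have hstep := Finset.ext_iff.1 hchanges i
    rw [mem_changes, mem_changes, ih (by lia), and_congr_right_iff] at hstep
    specialize hstep hi
    revert hstep
    cases g i <;> cases f (i + 1) <;> cases g (i + 1) <;> simp

/-- The codes of the rows of length `m` with at most `k` color changes. -/
def rowCodes (m k : ℕ) : Finset (Bool × Finset ℕ) :=
  Finset.univ ×ˢ {s ∈ (Finset.range m).powerset | s.card ≤ k}

lemma rowCode_mem_rowCodes (h : (changes f m).card ≤ k) : rowCode f m ∈ rowCodes m k := by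
  simp only [rowCodes, rowCode, Finset.mem_product, Finset.mem_univ, true_and, Finset.mem_filter,
    Finset.mem_powerset]
  exact ⟨changes_subset_range f m, h⟩

lemma rowCode_mem_rowCodes_self (f : ℕ → Bool) (m : ℕ) : rowCode f m ∈ rowCodes m m :=
  rowCode_mem_rowCodes ((Finset.card_le_card (changes_subset_range f m)).trans
    (Finset.card_range m).le)

lemma card_filter_card_le_powerset {α : Type*} (s : Finset α) (k : ℕ) :
    {t ∈ s.powerset | t.card ≤ k}.card ≤ (s.card + 1) ^ k := by
  classical
  induction k with
  | zero =>
    simp only [Nat.le_zero, Finset.card_eq_zero, Finset.filter_eq', pow_zero]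
    split_ifs <;> simp
  | succ k ih =>
    have hsub : {t ∈ s.powerset | t.card ≤ k + 1} ⊆
        ({t ∈ s.powerset | t.card ≤ k} ×ˢ s.insertNone).image
          fun q => q.2.elim q.1 (insert · q.1) := by
      intro t ht
      obtain ⟨hts, hcard⟩ := Finset.mem_filter.1 ht
      rw [Finset.mem_powerset] at hts
      rcases t.eq_empty_or_nonempty with rfl | ⟨a, ha⟩
      · exact Finset.mem_image.2 ⟨(∅, none), by simp, rfl⟩
      · refine Finset.mem_image.2 ⟨(t.erase a, some a), ?_, Finset.insert_erase ha⟩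
        simp only [Finset.mem_product, Finset.mem_filter, Finset.mem_powerset,
          Finset.some_mem_insertNone, Finset.card_erase_of_mem ha]
        exact ⟨⟨(t.erase_subset a).trans hts, by lia⟩, hts ha⟩
    calc {t ∈ s.powerset | t.card ≤ k + 1}.card
        ≤ ({t ∈ s.powerset | t.card ≤ k} ×ˢ s.insertNone).card :=
          (Finset.card_le_card hsub).trans Finset.card_image_le
      _ = {t ∈ s.powerset | t.card ≤ k}.card * (s.card + 1) := by
          rw [Finset.card_product, Finset.card_insertNone]
      _ ≤ (s.card + 1) ^ (k + 1) := by
          rw [pow_succ]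
          exact Nat.mul_le_mul_right _ ih

lemma card_rowCodes_le (m k : ℕ) : (rowCodes m k).card ≤ 2 * (m + 1) ^ k := by
  rw [rowCodes, Finset.card_product, Finset.card_univ, Fintype.card_bool]
  simpa using card_filter_card_le_powerset (Finset.range m) k

lemma card_rowCodes_self_le (m : ℕ) : (rowCodes m m).card ≤ 2 * 2 ^ m := by
  rw [rowCodes, Finset.card_product, Finset.card_univ, Fintype.card_bool]
  exact Nat.mul_le_mul_left _ ((Finset.card_filter_le _ _).trans (by simp))

lemma eq_of_card_filter_changes_eq (hij : i ≤ j) (hj : j < m)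
    (h : {k ∈ changes f m | k < i}.card = {k ∈ changes f m | k < j}.card) : f i = f j := by
  by_contra hne
  obtain ⟨k, hk, hik, hkj⟩ := exists_mem_changes hij hj hne
  refine (Finset.card_lt_card (Finset.ssubset_iff_of_subset ?_ |>.2 ⟨k, ?_, ?_⟩)).ne h
  · exact Finset.monotone_filter_right _ fun a _ ha => lt_of_lt_of_le ha hij
  · exact Finset.mem_filter.2 ⟨hk, hkj⟩
  · exact fun hmem => (Finset.mem_filter.1 hmem).2.not_ge hik

lemma exists_eq_between_changes (hi : i ∈ changes g m \ changes f m)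
    (hj : j ∈ changes g m \ changes f m) (hij : i < j) (hf : f i = f j)
    (hfg : f i = g i ↔ f j = g j) :
    ∃ a b c, a < b ∧ b < c ∧ c < m ∧ f b = g b ∧ g a ≠ g b ∧ g c ≠ g b := by
  simp only [Finset.mem_sdiff, mem_changes, not_and, not_not] at hi hj
  obtain ⟨⟨him, hgi⟩, hfi⟩ := hi
  obtain ⟨⟨hjm, hgj⟩, -⟩ := hj
  by_cases hi_eq : f i = g i
  · have hj_eq := hfg.1 hi_eq
    have hne : i + 1 ≠ j := by grind
    exact ⟨i + 1, j, j + 1, by lia, by lia, by lia, hj_eq, by grind, hgj.symm⟩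
  · have succ_eq : f (i + 1) = g (i + 1) := by
      rw [← hfi him, Bool.eq_not_iff.2 hi_eq, Bool.eq_not_iff.2 hgi, Bool.not_not]
    have hne : i + 1 ≠ j := by grind
    exact ⟨i, i + 1, j, by lia, by lia, by lia, succ_eq, hgi, by grind⟩

/-- A change of `g` that is not a change of `f` is determined by whether `f` and `g` agree there
and by the number of changes of `f` preceding it. -/
lemma card_changes_le_of_not_separated (hf : (changes f m).card ≤ k)
    (hsep : ∀ a b c, a < b → b < c → c < m → f b = g b → ¬(g a ≠ g b ∧ g c ≠ g b)) :
    (changes g m).card ≤ k + 2 * (k + 1) := by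
  let mark : ℕ → Bool × ℕ := fun i => (decide (f i = g i), {l ∈ changes f m | l < i}.card)
  have mark_ne : ∀ i ∈ changes g m \ changes f m, ∀ j ∈ changes g m \ changes f m, i < j →
      mark i ≠ mark j := by
    intro i hi j hj hij heq
    obtain ⟨hfg, hcard⟩ := Prod.mk.inj heq
    have hjm := Nat.lt_of_succ_lt (mem_changes.1 (Finset.mem_sdiff.1 hj).1).1
    obtain ⟨a, b, c, hab, hbc, hc, hb, hga, hgc⟩ := exists_eq_between_changes hi hj hij
      (eq_of_card_filter_changes_eq hij.le hjm hcard) (decide_eq_decide.1 hfg)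
    exact hsep a b c hab hbc hc hb ⟨hga, hgc⟩
  have hnew : (changes g m \ changes f m).card ≤
      ((Finset.univ : Finset Bool) ×ˢ Finset.range (k + 1)).card := by
    refine Finset.card_le_card_of_injOn mark (fun i _ => ?_) fun i hi j hj hij => ?_
    · simp only [mark, Finset.mem_coe, Finset.mem_product, Finset.mem_univ, true_and,
        Finset.mem_range]
      exact Nat.lt_succ_of_le ((Finset.card_filter_le _ _).trans hf)
    · exact le_antisymm (not_lt.1 fun h => mark_ne j hj i hi h hij.symm)
        (not_lt.1 fun h => mark_ne i hi j hj h hij)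
  rw [Finset.card_product, Finset.card_univ, Fintype.card_bool, Finset.card_range] at hnew
  have := Finset.card_le_card_sdiff_add_card (s := changes g m) (t := changes f m)
  lia

end Rows

/-! ### Strips of width three -/

section Strip

/-- The edges on the outer boundary of the region `W`, as unordered pairs of points. -/
def outerEdges (W : Finset (ℕ × ℕ)) : Set (Sym2 (ℕ × ℕ)) :=
  (fun e : LatEdge => s(e.src, e.tgt)) '' {e | IsOuter W e}

open Classical in
/-- The outer edges at which the color changes. -/
def outerCuts (W : Finset (ℕ × ℕ)) (χ : ℕ × ℕ → Bool) : Finset (Sym2 (ℕ × ℕ)) :=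
  ((cutEdges W χ).filter (IsOuter W)).image fun e => s(e.src, e.tgt)

variable {W : Finset (ℕ × ℕ)} {χ : ℕ × ℕ → Bool}

lemma card_outerCuts_le (hW : IsSimplyConn W) (hχ : HasConnClasses W χ) :
    (outerCuts W χ).card ≤ 2 :=
  Finset.card_image_le.trans (card_outer_cutEdges_le hW hχ)

lemma mem_outerCuts {p q : ℕ × ℕ} (hp : p ∈ W) (hq : q ∈ W) (hχ : χ p ≠ χ q)
    (h : s(p, q) ∈ outerEdges W) : s(p, q) ∈ outerCuts W χ := by
  classical
  obtain ⟨e, houter, heq⟩ := h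
  refine Finset.mem_image.2 ⟨e, Finset.mem_filter.2 ⟨mem_cutEdges.2 ?_, houter⟩, heq⟩
  obtain ⟨rfl, rfl⟩ | ⟨rfl, rfl⟩ := Sym2.eq_iff.1 heq
  · exact ⟨hp, hq, hχ⟩
  · exact ⟨hq, hp, hχ.symm⟩

/-- The points `cell r i` with `i < m` form a strip of three rows in the region `W` that is
attached to the rest of `W` only along its column `0`; the sides of the strip and its tip, the
column `m - 1`, lie on the outer boundary of `W`. -/
structure IsStrip (W : Finset (ℕ × ℕ)) (m : ℕ) (cell : Fin 3 → ℕ → ℕ × ℕ) : Prop where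
  mem : ∀ r, ∀ i < m, cell r i ∈ W
  inj : ∀ {r r' i i'}, i < m → i' < m → cell r i = cell r' i' → r = r' ∧ i = i'
  side : ∀ r ≠ 1, ∀ i, i + 1 < m → s(cell r i, cell r (i + 1)) ∈ outerEdges W
  tip : ∀ r ≠ 1, ∀ i, i + 1 = m → s(cell r i, cell 1 i) ∈ outerEdges W
  sep : ∀ r, ∀ i < m, 0 < i → ∀ q ∈ W, squareLattice.Adj (cell r i) q →
    ∃ r', ∃ i' < m, i ≤ i' + 1 ∧ q = cell r' i'

/-- The row `r` of a coloring of a strip. -/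
def stripRow (χ : ℕ × ℕ → Bool) (cell : Fin 3 → ℕ → ℕ × ℕ) (r : Fin 3) (i : ℕ) : Bool :=
  χ (cell r i)

namespace IsStrip

variable {m i j : ℕ} {cell : Fin 3 → ℕ → ℕ × ℕ}

lemma mk_mem_outerCuts (h : IsStrip W m cell) {r : Fin 3} (hr : r ≠ 1)
    (hi : i ∈ changes (stripRow χ cell r) m) : s(cell r i, cell r (i + 1)) ∈ outerCuts W χ := by
  obtain ⟨him, hne⟩ := mem_changes.1 hi
  exact mem_outerCuts (h.mem _ _ (by lia)) (h.mem _ _ him) hne (h.side r hr i him)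

lemma card_changes_outer_le (h : IsStrip W m cell) (hW : IsSimplyConn W)
    (hχ : HasConnClasses W χ) {r : Fin 3} (hr : r ≠ 1) :
    (changes (stripRow χ cell r) m).card ≤ 2 := by
  refine le_trans (Finset.card_le_card_of_injOn (fun i => s(cell r i, cell r (i + 1)))
    (fun i hi => h.mk_mem_outerCuts hr hi) fun i hi j hj heq => ?_) (card_outerCuts_le hW hχ)
  obtain ⟨him, -⟩ := mem_changes.1 hi
  obtain ⟨hjm, -⟩ := mem_changes.1 hj
  rcases Sym2.eq_iff.1 heq with ⟨heq, -⟩ | ⟨heq, heq'⟩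
  · exact (h.inj (by lia) (by lia) heq).2
  · have := (h.inj (by lia) hjm heq).2
    have := (h.inj him (by lia) heq').2
    lia

lemma not_separated (h : IsStrip W m cell) (hχ : HasConnClasses W χ) {a b c : ℕ} (hab : a < b)
    (hbc : b < c) (hc : c < m) (hcol : ∀ r, χ (cell r b) = χ (cell 1 b)) {r r' : Fin 3} :
    ¬(χ (cell r a) ≠ χ (cell 1 b) ∧ χ (cell r' c) ≠ χ (cell 1 b)) := by
  rintro ⟨ha, hc'⟩
  have hssubset : {p | ∃ k r, b < k ∧ k < m ∧ cell r k = p ∧ χ p = !χ (cell 1 b)} ⊂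
      {p | p ∈ W ∧ χ p = !χ (cell 1 b)} := by
    refine Set.ssubset_iff_exists.2 ⟨?_, cell r a, ⟨h.mem _ _ (by lia), Bool.eq_not_iff.2 ha⟩, ?_⟩
    · rintro _ ⟨k, s, -, hk, rfl, hχk⟩
      exact ⟨h.mem s k hk, hχk⟩
    · rintro ⟨k, s, hbk, hk, heq, -⟩
      have := (h.inj hk (by lia) heq).2
      lia
  obtain ⟨_, ⟨k, s, hbk, hk, rfl, -⟩, w, ⟨hw, hχw⟩, hadj, hnotMem⟩ :=
    (hχ _).exists_adj_notMem hssubset ⟨cell r' c, c, r', hbc, hc, rfl, Bool.eq_not_iff.2 hc'⟩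
  obtain ⟨t, i, hi, hki, rfl⟩ := h.sep s k hk (by lia) w hw hadj
  rcases (show b ≤ i by lia).eq_or_lt with rfl | hbi
  · exact Bool.eq_not_iff.1 hχw (hcol t)
  · exact hnotMem ⟨i, t, hbi, hi, rfl, hχw⟩

lemma card_changes_middle_le (h : IsStrip W m cell) (hW : IsSimplyConn W)
    (hχ : HasConnClasses W χ) (heq : ∀ i < m, χ (cell 0 i) = χ (cell 2 i)) :
    (changes (stripRow χ cell 1) m).card ≤ 8 := by
  refine card_changes_le_of_not_separated (f := stripRow χ cell 0)
    (h.card_changes_outer_le hW hχ (by decide)) fun a b c hab hbc hc hb =>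
      h.not_separated hχ hab hbc hc ?_
  refine Fin.forall_fin_succ.2 ⟨hb, Fin.forall_fin_two.2 ⟨rfl, ?_⟩⟩
  exact (heq b (hbc.trans hc)).symm.trans hb

lemma exists_mem_outerCuts (h : IsStrip W m cell) (hi : i < m)
    (hne : χ (cell 0 i) ≠ χ (cell 2 i)) :
    ∃ r k r' k', i ≤ k ∧ i ≤ k' ∧ k < m ∧ k' < m ∧
      s(cell r k, cell r' k') ∈ outerCuts W χ := by
  obtain ⟨l, rfl⟩ : ∃ l, m = l + 1 := ⟨m - 1, by lia⟩
  by_cases hrow : ∃ r ≠ 1, χ (cell r i) ≠ χ (cell r l)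
  · obtain ⟨r, hr, hχ⟩ := hrow
    obtain ⟨k, hk, hik, hkl⟩ := exists_mem_changes (f := stripRow χ cell r) (m := l + 1)
      (Nat.le_of_lt_succ hi) l.lt_succ_self hχ
    exact ⟨r, k, r, k + 1, hik, by lia, by lia, by lia, h.mk_mem_outerCuts hr hk⟩
  · push Not at hrow
    rw [hrow 0 (by decide), hrow 2 (by decide)] at hne
    obtain ⟨r, hr, hχ⟩ : ∃ r ≠ 1, χ (cell r l) ≠ χ (cell 1 l) := by
      by_contra! hcol
      exact hne ((hcol 0 (by decide)).trans (hcol 2 (by decide)).symm)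
    exact ⟨r, l, 1, l, by lia, by lia, by lia, by lia, mem_outerCuts (h.mem _ _ l.lt_succ_self)
      (h.mem _ _ l.lt_succ_self) hχ (h.tip r hr l rfl)⟩

/-- Otherwise the color would change three times along the boundary of the strip: on both sides
between the columns `i` and `j`, and beyond column `j`. -/
lemma not_opposite (h : IsStrip W m cell) (hW : IsSimplyConn W) (hχ : HasConnClasses W χ)
    (hij : i ≤ j) (hj : j < m) (hi : χ (cell 0 i) ≠ χ (cell 2 i))
    (h₀ : χ (cell 0 i) ≠ χ (cell 0 j)) : χ (cell 2 i) = χ (cell 2 j) := by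
  by_contra h₂
  obtain ⟨k, hk, -, hkj⟩ := exists_mem_changes (f := stripRow χ cell 0) hij hj h₀
  obtain ⟨l, hl, -, hlj⟩ := exists_mem_changes (f := stripRow χ cell 2) hij hj h₂
  obtain ⟨r, a, r', a', ha, ha', ham, ham', hmem⟩ := h.exists_mem_outerCuts (χ := χ) hj <| by
    rw [Bool.eq_not_iff.2 h₀, Bool.eq_not_iff.2 h₂] at hi
    exact fun heq => hi (congrArg _ heq)
  have sides_ne : s(cell 0 k, cell 0 (k + 1)) ≠ s(cell 2 l, cell 2 (l + 1)) := fun heq => by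
    obtain ⟨heq, -⟩ | ⟨heq, -⟩ := Sym2.eq_iff.1 heq
    all_goals
      have := (h.inj (by lia) (by have := (mem_changes.1 hl).1; lia) heq).1
      contradiction
  have side_ne : ∀ t, ∀ b < j, ∀ q, s(cell t b, q) ≠ s(cell r a, cell r' a') := by
    intro t b hb q heq
    obtain ⟨heq, -⟩ | ⟨heq, -⟩ := Sym2.eq_iff.1 heq
    all_goals
      have := (h.inj (by lia) (by lia) heq).2
      lia
  have : 2 < (outerCuts W χ).card := Finset.two_lt_card.2
    ⟨_, h.mk_mem_outerCuts (by decide) hk, _, h.mk_mem_outerCuts (by decide) hl, _, hmem,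
      sides_ne, side_ne _ _ hkj _, side_ne _ _ hlj _⟩
  exact this.not_ge (card_outerCuts_le hW hχ)

lemma tilt_eq (h : IsStrip W m cell) (hW : IsSimplyConn W) (hχ : HasConnClasses W χ)
    (hi : i < m) (hj : j < m) (hχi : χ (cell 0 i) ≠ χ (cell 2 i))
    (hχj : χ (cell 0 j) ≠ χ (cell 2 j)) : χ (cell 0 i) = χ (cell 0 j) := by
  wlog hij : i ≤ j generalizing i j
  · exact (this hj hi hχj hχi (not_le.1 hij).le).symm
  by_contra h₀
  have h₂ := h.not_opposite hW hχ hij hj hχi h₀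
  rw [Bool.eq_not_iff.2 h₀, h₂] at hχi
  exact hχi (Bool.eq_not_iff.2 hχj.symm).symm

lemma tilt_eq_of_forall_ne (h : IsStrip W m cell) (hW : IsSimplyConn W)
    {χ' : ℕ × ℕ → Bool} (hχ : HasConnClasses W χ) (hχ' : HasConnClasses W χ') {p : ℕ × ℕ}
    (hp : ∀ q ≠ p, χ q = χ' q) (hi : i < m) (hj : j < m) (hχi : χ (cell 0 i) ≠ χ (cell 2 i))
    (hχj : χ' (cell 0 j) ≠ χ' (cell 2 j)) : χ (cell 0 i) = χ' (cell 0 j) := by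
  by_cases hpj : ∀ r ≠ 1, cell r j ≠ p
  · have h₀ := hp _ (hpj 0 (by decide))
    have h₂ := hp _ (hpj 2 (by decide))
    exact (h.tilt_eq hW hχ hi hj hχi (by rwa [h₀, h₂])).trans h₀
  push Not at hpj
  obtain ⟨r, hr, rfl⟩ := hpj
  have eq_of_ne : ∀ r', (r', i) ≠ (r, j) → χ (cell r' i) = χ' (cell r' i) := fun r' hne =>
    hp _ fun heq => hne (Prod.ext_iff.2 (h.inj hi hj heq))
  by_cases hij : i = j
  · subst hij
    rcases eq_or_ne r 0 with rfl | hr₀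
    · have h₂ := eq_of_ne 2 (by simp)
      rw [Bool.eq_not_iff.2 hχi, Bool.eq_not_iff.2 hχj, h₂]
    · exact eq_of_ne 0 (by simpa using hr₀.symm)
  · have h₀ := eq_of_ne 0 (by simp [hij])
    have h₂ := eq_of_ne 2 (by simp [hij])
    exact h₀.trans (h.tilt_eq hW hχ' hi hj (by rwa [← h₀, ← h₂]) hχj)

end IsStrip

end Strip

/-! ### Grid graphs -/

section Grid

variable {k ℓ n : ℕ}

lemma gridGraph_adj_iff {u v : Fin k × Fin ℓ} : (gridGraph k ℓ).Adj u v ↔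
    ((u.1.1 + 1 = v.1.1 ∨ v.1.1 + 1 = u.1.1) ∧ u.2.1 = v.2.1) ∨
      (u.2.1 + 1 = v.2.1 ∨ v.2.1 + 1 = u.2.1) ∧ u.1.1 = v.1.1 := by
  simp only [gridGraph, SimpleGraph.boxProd_adj, SimpleGraph.pathGraph_adj, Fin.ext_iff]

/-- The grid graph as a rectangle in the square lattice. -/
def gridEmbedding (k ℓ : ℕ) : gridGraph k ℓ ↪g squareLattice where
  toFun v := (v.1, v.2)
  inj' _ _ h := Prod.ext (Fin.ext (Prod.mk.inj h).1) (Fin.ext (Prod.mk.inj h).2)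
  map_rel_iff' := squareLattice_adj_iff.trans gridGraph_adj_iff.symm

lemma range_gridEmbedding (k ℓ : ℕ) : Set.range (gridEmbedding k ℓ) = rect 0 k 0 ℓ := by
  ext p
  rw [Finset.mem_coe, mem_rect]
  constructor
  · rintro ⟨v, rfl⟩
    exact ⟨⟨Nat.zero_le _, v.1.2⟩, Nat.zero_le _, v.2.2⟩
  · rintro ⟨⟨-, hp₁⟩, -, hp₂⟩
    exact ⟨(⟨p.1, hp₁⟩, ⟨p.2, hp₂⟩), rfl⟩

lemma isContiguous_univ_gridGraph (k ℓ : ℕ) : IsContiguous (gridGraph k ℓ) Set.univ :=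
  (SimpleGraph.Iso.preconnected_iff (SimpleGraph.induceUnivIso _)).2 <|
    (SimpleGraph.pathGraph_preconnected k).boxProd (SimpleGraph.pathGraph_preconnected ℓ)

lemma isContiguous_pathGraph_iff_ordConnected {A : Set (Fin n)} :
    IsContiguous (SimpleGraph.pathGraph n) A ↔ A.OrdConnected := by
  simp only [Set.ordConnected_iff]
  constructor
  · intro h a ha b hb _ c ⟨hac, hcb⟩
    by_contra hc
    have := h.eq_of_forall_adj (f := fun x => decide (x < c)) (fun x hx y hy hxy => ?_) ha hb
    · grind
    · have hxc : x ≠ c := fun h => hc (h ▸ hx)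
      have hyc : y ≠ c := fun h => hc (h ▸ hy)
      rw [SimpleGraph.pathGraph_adj] at hxy
      rw [decide_eq_decide]
      lia
  · intro h
    rcases A.eq_empty_or_nonempty with rfl | hne
    · exact isContiguous_of_subsingleton Set.subsingleton_empty
    · obtain ⟨o, ho, hmin⟩ := A.toFinite.exists_minimal hne
      refine isContiguous_of_rank o Fin.val fun u hu => or_iff_not_imp_left.2 fun huo => ?_
      have hou : o < u :=
        (not_lt.1 fun hlt => hlt.not_ge (hmin hu hlt.le)).lt_of_ne (Ne.symm huo)
      refine ⟨⟨u - 1, by lia⟩, h o ho u hu hou.le ⟨?_, ?_⟩, ?_, ?_⟩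
      all_goals simp only [SimpleGraph.pathGraph_adj, Fin.le_def]; lia

lemma isLowerSet_or_isUpperSet_of_ordConnected {α : Type*} [LinearOrder α] {A : Set α}
    (hA : A.OrdConnected) (hAc : Aᶜ.OrdConnected) : IsLowerSet A ∨ IsUpperSet A := by
  by_contra! h
  simp only [IsLowerSet, IsUpperSet, not_forall] at h
  obtain ⟨⟨a, b, hba, ha, hb⟩, c, d, hcd, hc, hd⟩ := h
  rcases le_total b c with hbc | hcb
  · exact hAc.out hb hd ⟨hbc, hcd⟩ hc
  · exact hb (hA.out hc ha ⟨hcb, hba⟩)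

lemma isPeelable_pathGraph (n : ℕ) : IsPeelable (SimpleGraph.pathGraph n) := by
  have isSplit_iff : ∀ A : Set (Fin n), IsSplit (SimpleGraph.pathGraph n) A ↔
      IsLowerSet A ∨ IsUpperSet A := fun A => by
    simp only [IsSplit, isContiguous_pathGraph_iff_ordConnected]
    refine ⟨fun h => isLowerSet_or_isUpperSet_of_ordConnected h.1 h.2, ?_⟩
    rintro (h | h)
    exacts [⟨h.ordConnected, h.compl.ordConnected⟩, ⟨h.ordConnected, h.compl.ordConnected⟩]
  intro A hA hne
  rcases (isSplit_iff A).1 hA with h | h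
  · obtain ⟨a, ha, hmax⟩ := A.toFinite.exists_maximal hne
    exact ⟨a, ha, (isSplit_iff _).2 (Or.inl (h.erase fun b hb hab => (hmax hb hab).antisymm hab))⟩
  · obtain ⟨a, ha, hmin⟩ := A.toFinite.exists_minimal hne
    exact ⟨a, ha, (isSplit_iff _).2 (Or.inr (h.erase fun b hb hab => hab.antisymm (hmin hb hab)))⟩

lemma IsPeelable.of_iso {V V' : Type*} {G : SimpleGraph V} {H : SimpleGraph V'} (e : G ≃g H)
    (h : IsPeelable H) : IsPeelable G := by
  have isSplit_image : ∀ A, IsSplit H (e '' A) ↔ IsSplit G A := fun A => by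
    rw [IsSplit, ← Set.image_compl_eq e.bijective]
    exact and_congr (isContiguous_image_iff e.toEmbedding) (isContiguous_image_iff e.toEmbedding)
  intro A hA hne
  obtain ⟨_, ⟨v, hv, rfl⟩, hsplit⟩ := h (e '' A) ((isSplit_image A).2 hA) (hne.image e)
  rw [← Set.image_singleton, ← Set.image_sdiff e.injective, isSplit_image] at hsplit
  exact ⟨v, hv, hsplit⟩

lemma isPeelable_gridGraph (k ℓ : ℕ) : IsPeelable (gridGraph k ℓ) := by
  obtain rfl | rfl | hk := show k = 0 ∨ k = 1 ∨ 2 ≤ k by lia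
  · exact fun A _ ⟨v, _⟩ => v.1.elim0
  · exact (isPeelable_pathGraph ℓ).of_iso
      ⟨Equiv.uniqueProd _ _, by simp [gridGraph, Subsingleton.elim _ (0 : Fin 1)]⟩
  obtain rfl | rfl | hℓ := show ℓ = 0 ∨ ℓ = 1 ∨ 2 ≤ ℓ by lia
  · exact fun A _ ⟨v, _⟩ => v.2.elim0
  · exact (isPeelable_pathGraph k).of_iso
      ⟨Equiv.prodUnique _ _, by simp [gridGraph, Subsingleton.elim _ (0 : Fin 1)]⟩
  exact isPeelable_of_forall_compl_singleton (isContiguous_univ_gridGraph k ℓ)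
    (isContiguous_compl_singleton_of_range _ (range_gridEmbedding k ℓ)
      (isContiguous_rect_sdiff_singleton (by lia) (by lia)))

lemma isErgodicChain_colorChain_gridGraph (hk : 1 ≤ k) (hℓ : 1 ≤ ℓ) :
    IsErgodicChain (colorChain (gridGraph k ℓ) 2) (uniformDist _) :=
  have : Nonempty (Fin k × Fin ℓ) := ⟨(⟨0, hk⟩, ⟨0, hℓ⟩)⟩
  isErgodicChain_colorChain (isContiguous_univ_gridGraph k ℓ) (isPeelable_gridGraph k ℓ)

end Grid

/-! ### The grid of width three -/

section WidthThree

lemma mem_outerEdges_vertical {W : Finset (ℕ × ℕ)} {x y : ℕ}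
    (h : ¬IsSquare W (x, y) ∨ ∀ x', x' + 1 = x → ¬IsSquare W (x', y)) :
    s((x, y), (x, y + 1)) ∈ outerEdges W := by
  have mem_range : ∀ s, (x, y, true) ∈ Set.range (side s) →
      s = (x, y) ∨ s.1 + 1 = x ∧ s.2 = y := by
    rintro ⟨a, b⟩ ⟨⟨_ | _, _ | _⟩, hp⟩ <;> simp_all [side]
  refine ⟨(x, y, true), ?_, rfl⟩
  rintro ⟨a, b⟩ ⟨hs, hp⟩ ⟨a', b'⟩ ⟨hs', hp'⟩
  have := mem_range _ hp
  have := mem_range _ hp'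
  grind

lemma mem_outerEdges_horizontal {W : Finset (ℕ × ℕ)} {x y : ℕ}
    (h : ¬IsSquare W (x, y) ∨ ∀ y', y' + 1 = y → ¬IsSquare W (x, y')) :
    s((x, y), (x + 1, y)) ∈ outerEdges W := by
  have mem_range : ∀ s, (x, y, false) ∈ Set.range (side s) →
      s = (x, y) ∨ s.1 = x ∧ s.2 + 1 = y := by
    rintro ⟨a, b⟩ ⟨⟨_ | _, _ | _⟩, hp⟩ <;> simp_all [side]
  refine ⟨(x, y, false), ?_, rfl⟩
  rintro ⟨a, b⟩ ⟨hs, hp⟩ ⟨a', b'⟩ ⟨hs', hp'⟩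
  have := mem_range _ hp
  have := mem_range _ hp'
  grind

variable {ℓ : ℕ}

lemma isStrip_rect (ℓ : ℕ) : IsStrip (rect 0 3 0 ℓ) ℓ fun r i => (r, i) where
  mem r i hi := mem_rect.2 ⟨⟨Nat.zero_le _, r.2⟩, Nat.zero_le _, hi⟩
  inj _ _ h := ⟨Fin.ext (Prod.mk.inj h).1, (Prod.mk.inj h).2⟩
  side r hr i _ := by
    refine mem_outerEdges_vertical ?_
    obtain rfl | rfl : r = 0 ∨ r = 2 := by lia
    · exact Or.inr fun x' hx' => absurd hx' x'.succ_ne_zero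
    · exact Or.inl fun h => by simpa [corner, mem_rect] using h (true, true)
  tip r hr i hi := by
    have outer : ∀ x, s((x, i), (x + 1, i)) ∈ outerEdges (rect 0 3 0 ℓ) := fun x =>
      mem_outerEdges_horizontal <| Or.inl fun h => by
        have := mem_rect.1 (h (true, true))
        simp only [corner, Bool.toNat_true] at this
        lia
    obtain rfl | rfl : r = 0 ∨ r = 2 := by lia
    exacts [outer 0, Sym2.eq_swap ▸ outer 1]
  sep r i _ _ q hq hadj := by
    rw [mem_rect] at hq
    rw [squareLattice_adj_iff] at hadj
    exact ⟨⟨q.1, hq.1.2⟩, q.2, hq.2.2, by simp only at hadj; lia, rfl⟩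

/-- The class of color `0` of a state of the color chain, as a coloring of lattice points. -/
def ConnColoring.mark (ω : ConnColoring (gridGraph 3 ℓ) 2) : ℕ × ℕ → Bool :=
  markColoring (gridEmbedding 3 ℓ) {v | ω.1 v = 0}

lemma ConnColoring.hasConnClasses_mark (ω : ConnColoring (gridGraph 3 ℓ) 2) :
    HasConnClasses (rect 0 3 0 ℓ) ω.mark :=
  ω.isSplit.hasConnClasses_markColoring _ (range_gridEmbedding 3 ℓ)

lemma ConnColoring.eq_of_mark_eq {ω ω' : ConnColoring (gridGraph 3 ℓ) 2}
    (h : ∀ r : Fin 3, ∀ i < ℓ, ω.mark (r, i) = ω'.mark (r, i)) : ω = ω' := by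
  have zero_iff : ∀ v, ω.1 v = 0 ↔ ω'.1 v = 0 := fun v => by
    have := Bool.eq_iff_iff.1 (h v.1 v.2 v.2.2)
    exact (markColoring_eq_true_iff (gridEmbedding 3 ℓ)).symm.trans
      (this.trans (markColoring_eq_true_iff (gridEmbedding 3 ℓ)))
  refine Subtype.ext (funext fun v => ?_)
  have := zero_iff v
  lia

lemma mark_coloringOf_eq_true_iff {A : Set (Fin 3 × Fin ℓ)} (hA : IsSplit (gridGraph 3 ℓ) A)
    (v : Fin 3 × Fin ℓ) : (coloringOf _ A hA).mark (v.1, v.2) = true ↔ v ∈ A := by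
  simp only [ConnColoring.mark, coloringOf_eq_zero, Set.ofPred_mem_eq]
  exact markColoring_eq_true_iff (gridEmbedding 3 ℓ) (v := v)

open Classical in
/-- The states for which some column of the grid has ends of different colors, with the color `b`
of the end in row `0` (`true` standing for the color `0`). -/
def tiltedStates (ℓ : ℕ) (b : Bool) : Finset (ConnColoring (gridGraph 3 ℓ) 2) :=
  {ω | ∃ i < ℓ, ω.mark (0, i) = b ∧ ω.mark (2, i) = !b}

open Classical in
/-- The states for which both ends of each column of the grid have the same color. -/
def levelStates (ℓ : ℕ) : Finset (ConnColoring (gridGraph 3 ℓ) 2) :=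
  {ω | ∀ i < ℓ, ω.mark (0, i) = ω.mark (2, i)}

lemma mem_tiltedStates {b : Bool} {ω : ConnColoring (gridGraph 3 ℓ) 2} :
    ω ∈ tiltedStates ℓ b ↔ ∃ i < ℓ, ω.mark (0, i) = b ∧ ω.mark (2, i) = !b := by
  simp [tiltedStates]

lemma mem_levelStates {ω : ConnColoring (gridGraph 3 ℓ) 2} :
    ω ∈ levelStates ℓ ↔ ∀ i < ℓ, ω.mark (0, i) = ω.mark (2, i) := by
  simp [levelStates]

lemma colorChain_eq_zero_of_mem_tiltedStates {b : Bool} {ω ω' : ConnColoring (gridGraph 3 ℓ) 2}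
    (hω : ω ∈ tiltedStates ℓ b) (hω' : ω' ∈ tiltedStates ℓ !b) :
    colorChain (gridGraph 3 ℓ) 2 ω ω' = 0 := by
  obtain ⟨i, hi, h₀, h₂⟩ := mem_tiltedStates.1 hω
  obtain ⟨j, hj, h₀', h₂'⟩ := mem_tiltedStates.1 hω'
  by_contra hne
  obtain ⟨p, hp⟩ : ∃ p, ∀ q ≠ p, ω.mark q = ω'.mark q := by
    rcases exists_of_colorChain_ne_zero hne with rfl | ⟨v, hv⟩
    · exact ⟨(0, 0), fun _ _ => rfl⟩
    · exact ⟨_, fun q hq => markColoring_eq_of_ne (v := v) (by simp +contextual [hv]) hq⟩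
  have := (isStrip_rect ℓ).tilt_eq_of_forall_ne (isSimplyConn_rect 0 3 0 ℓ)
    ω.hasConnClasses_mark ω'.hasConnClasses_mark hp hi hj (by simp [h₀, h₂]) (by simp [h₀', h₂'])
  simp [h₀, h₀'] at this

lemma disjoint_tiltedStates_levelStates (ℓ : ℕ) (b : Bool) :
    Disjoint (tiltedStates ℓ b) (levelStates ℓ) := by
  refine Finset.disjoint_left.2 fun ω htilted hlevel => ?_
  obtain ⟨i, hi, h₀, h₂⟩ := mem_tiltedStates.1 htilted
  simpa [h₀, h₂] using mem_levelStates.1 hlevel i hi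

lemma compl_tiltedStates_union_levelStates (ℓ : ℕ) (b : Bool) :
    (tiltedStates ℓ b ∪ levelStates ℓ)ᶜ = tiltedStates ℓ !b := by
  ext ω
  simp only [Finset.mem_compl, Finset.mem_union, mem_tiltedStates, mem_levelStates]
  constructor
  · intro h
    push Not at h
    obtain ⟨hb, i, hi, hne⟩ := h
    rcases eq_or_ne (ω.mark (0, i)) b with h₀ | h₀
    · exact absurd (Bool.eq_not_iff.2 (h₀ ▸ hne.symm)) (hb i hi h₀)
    · have h₂ := Bool.not_inj ((Bool.eq_not_iff.2 hne).symm.trans (Bool.eq_not_iff.2 h₀))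
      exact ⟨i, hi, Bool.eq_not_iff.2 h₀, h₂.trans (Bool.not_not b).symm⟩
  · rintro ⟨i, hi, h₀, h₂⟩ (⟨j, hj, h₀', h₂'⟩ | h)
    · have := (isStrip_rect ℓ).tilt_eq (isSimplyConn_rect 0 3 0 ℓ) ω.hasConnClasses_mark hi hj
        (by simp [h₀, h₂]) (by simp [h₀', h₂'])
      simp [h₀, h₀'] at this
    · simpa [h₀, h₂] using h i hi

lemma card_levelStates_le (ℓ : ℕ) : (levelStates ℓ).card ≤ (2 * (ℓ + 1) ^ 8) ^ 3 := by
  have hstrip := isStrip_rect ℓ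
  have hconn := isSimplyConn_rect 0 3 0 ℓ
  calc (levelStates ℓ).card
      ≤ (Fintype.piFinset fun _ : Fin 3 => rowCodes ℓ 8).card := by
        refine Finset.card_le_card_of_injOn
          (fun ω r => rowCode (stripRow ω.mark (fun r i => (r, i)) r) ℓ) (fun ω hω => ?_)
          fun ω _ ω' _ h => ConnColoring.eq_of_mark_eq fun r => eq_of_rowCode_eq (congrFun h r)
        refine Finset.mem_coe.2 (Fintype.mem_piFinset.2 fun r => rowCode_mem_rowCodes ?_)
        by_cases hr : r = 1
        · subst hr
          exact hstrip.card_changes_middle_le hconn ω.hasConnClasses_mark (mem_levelStates.1 hω)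
        · exact (hstrip.card_changes_outer_le hconn ω.hasConnClasses_mark hr).trans (by simp)
    _ = (rowCodes ℓ 8).card ^ 3 := by simp
    _ ≤ (2 * (ℓ + 1) ^ 8) ^ 3 := Nat.pow_le_pow_left (card_rowCodes_le ℓ 8) 3

/-- The outer row `0` together with the part `B` of the middle row. -/
def outerRowSet (ℓ : ℕ) (B : Finset (Fin ℓ)) : Set (Fin 3 × Fin ℓ) :=
  {v | v.1 = 0 ∨ (v.1 = 1 ∧ v.2 ∈ B)}

lemma outerRowSet_injective (ℓ : ℕ) : Function.Injective (outerRowSet ℓ) := by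
  intro B B' h
  ext j
  simpa [outerRowSet] using Set.ext_iff.1 h (1, j)

lemma isContiguous_of_outer_row_subset {A : Set (Fin 3 × Fin ℓ)} {o : Fin 3} (ho : o ≠ 1)
    (hrow : ∀ j, (o, j) ∈ A) (hA : ∀ v ∈ A, v.1 = o ∨ v.1 = 1) :
    IsContiguous (gridGraph 3 ℓ) A := by
  rcases A.eq_empty_or_nonempty with rfl | ⟨⟨x, y⟩, -⟩
  · exact isContiguous_of_subsingleton Set.subsingleton_empty
  refine isContiguous_of_rank (o, ⟨0, y.pos⟩) (fun v => v.2 + if v.1 = o then 0 else 1) ?_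
  rintro ⟨x, y⟩ hv
  by_cases hx : x = o
  · subst hx
    rcases Nat.eq_zero_or_pos y with hy | hy
    · exact Or.inl (Prod.ext rfl (Fin.ext hy))
    · refine Or.inr ⟨(x, ⟨y - 1, by lia⟩), hrow _, gridGraph_adj_iff.2 (Or.inr ⟨?_, rfl⟩), ?_⟩
      · exact Or.inr (Nat.sub_add_cancel hy)
      · simpa using Nat.sub_lt hy Nat.one_pos
  · have := (hA _ hv).resolve_left hx
    exact Or.inr ⟨(o, y), hrow y, gridGraph_adj_iff.2 (Or.inl ⟨by simp only at this; lia, rfl⟩),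
      by simp [hx]⟩

lemma isSplit_outerRowSet (ℓ : ℕ) (B : Finset (Fin ℓ)) :
    IsSplit (gridGraph 3 ℓ) (outerRowSet ℓ B) := by
  constructor
  · exact isContiguous_of_outer_row_subset (o := 0) (by decide) (fun j => Or.inl rfl)
      fun v hv => hv.imp_right And.left
  · refine isContiguous_of_outer_row_subset (o := 2) (by decide) (by simp [outerRowSet])
      fun v hv => ?_
    have hv₀ : v.1 ≠ 0 := fun h => hv (Or.inl h)
    lia

lemma two_pow_le_card_of_injective {Ω : Type*} {n : ℕ} {S : Finset Ω}
    {F : Finset (Fin n) → Ω} (hF : Function.Injective F) (hS : ∀ B, F B ∈ S) :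
    2 ^ n ≤ S.card := by
  simpa using Finset.card_le_card_of_injOn (s := Finset.univ) F (fun B _ => hS B) hF.injOn

lemma coloringOf_mem_tiltedStates {A : Set (Fin 3 × Fin ℓ)} (hA : IsSplit (gridGraph 3 ℓ) A)
    {b : Bool} {i : Fin ℓ} (h₀ : (0, i) ∈ A ↔ b = true) (h₂ : (2, i) ∈ A ↔ b = false) :
    coloringOf _ A hA ∈ tiltedStates ℓ b := by
  refine mem_tiltedStates.2 ⟨i, i.2, ?_, ?_⟩
  · rw [Bool.eq_iff_iff, ← h₀]
    exact mark_coloringOf_eq_true_iff hA (0, i)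
  · rw [Bool.eq_iff_iff, Bool.not_eq_true', ← h₂]
    exact mark_coloringOf_eq_true_iff hA (2, i)

lemma two_pow_le_card_tiltedStates (hℓ : 1 ≤ ℓ) (b : Bool) :
    2 ^ ℓ ≤ (tiltedStates ℓ b).card := by
  let i : Fin ℓ := ⟨0, hℓ⟩
  cases b
  · exact two_pow_le_card_of_injective
      (F := fun B => coloringOf _ _ (isSplit_outerRowSet ℓ B).compl)
      (fun B B' h => outerRowSet_injective ℓ (compl_injective (coloringOf_injective h)))
      fun B => coloringOf_mem_tiltedStates (i := i) _ (by simp [outerRowSet])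
        (by simp [outerRowSet])
  · exact two_pow_le_card_of_injective (F := fun B => coloringOf _ _ (isSplit_outerRowSet ℓ B))
      (fun B B' h => outerRowSet_injective ℓ (coloringOf_injective h))
      fun B => coloringOf_mem_tiltedStates (i := i) _ (by simp [outerRowSet])
        (by simp [outerRowSet])

lemma hasBottleneck_colorChain_gridGraph (hℓ : 1 ≤ ℓ) :
    HasBottleneck (colorChain (gridGraph 3 ℓ) 2) (2 ^ ℓ) (2 ^ 27 * (ℓ : ℝ) ^ 24) := by
  refine ⟨tiltedStates ℓ true, levelStates ℓ, disjoint_tiltedStates_levelStates ℓ true, ?_, ?_, ?_,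
    ?_⟩
  · rw [compl_tiltedStates_union_levelStates]
    exact fun ω hω ω' hω' => ⟨colorChain_eq_zero_of_mem_tiltedStates hω hω',
      colorChain_eq_zero_of_mem_tiltedStates hω' (by rwa [Bool.not_not])⟩
  · exact_mod_cast two_pow_le_card_tiltedStates hℓ true
  · rw [compl_tiltedStates_union_levelStates]
    exact_mod_cast two_pow_le_card_tiltedStates hℓ (!true)
  · have := calc (levelStates ℓ).card ≤ (2 * (ℓ + 1) ^ 8) ^ 3 := card_levelStates_le ℓ
      _ ≤ (2 * (2 * ℓ) ^ 8) ^ 3 := by gcongr; lia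
      _ = 2 ^ 27 * ℓ ^ 24 := by ring
    exact_mod_cast this

end WidthThree

/-! ### The plus-shaped graph -/

section Plus

variable {h : ℕ}

lemma gridGraph_dist_le_one_iff {k ℓ : ℕ} {u v : Fin k × Fin ℓ} :
    (gridGraph k ℓ).dist u v ≤ 1 ↔ u = v ∨ (gridGraph k ℓ).Adj u v := by
  have hconn : (gridGraph k ℓ).Preconnected :=
    (SimpleGraph.pathGraph_preconnected k).boxProd (SimpleGraph.pathGraph_preconnected ℓ)
  rw [← SimpleGraph.dist_eq_one_iff_adj, ← (hconn u v).dist_eq_zero_iff]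
  lia

lemma mem_plusSet_iff {v : Fin (2 * h + 1) × Fin (2 * h + 1)} : v ∈ plusSet (2 * h + 1) ↔
    (h ≤ v.1.1 + 1 ∧ v.1.1 ≤ h + 1) ∨ (h ≤ v.2.1 + 1 ∧ v.2.1 ≤ h + 1) := by
  have half_eq : (2 * h + 1) / 2 = h := by lia
  simp only [plusSet, Set.mem_ofPred_eq, half_eq, gridGraph_dist_le_one_iff, gridGraph_adj_iff]
  constructor
  · rintro ⟨w, hw, rfl | hvw⟩ <;> lia
  · rintro (hv | hv)
    · refine ⟨(⟨h, by lia⟩, v.2), Or.inl rfl, ?_⟩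
      simp only [Prod.ext_iff, Fin.ext_iff]
      lia
    · refine ⟨(v.1, ⟨h, by lia⟩), Or.inr rfl, ?_⟩
      simp only [Prod.ext_iff, Fin.ext_iff]
      lia

/-- The lattice points of the plus-shaped graph of side `2 * h + 1`. -/
def plusRegion (h : ℕ) : Finset (ℕ × ℕ) :=
  rect 0 (2 * h + 1) (h - 1) (h + 2) ∪ rect (h - 1) (h + 2) 0 (2 * h + 1)

lemma mem_plusRegion {p : ℕ × ℕ} : p ∈ plusRegion h ↔
    (p.1 < 2 * h + 1 ∧ h - 1 ≤ p.2 ∧ p.2 < h + 2) ∨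
      (h - 1 ≤ p.1 ∧ p.1 < h + 2) ∧ p.2 < 2 * h + 1 := by
  simp only [plusRegion, Finset.mem_union, mem_rect]
  lia

/-- The plus-shaped graph as a region in the square lattice. -/
def plusEmbedding (h : ℕ) : plusGraph (2 * h + 1) ↪g squareLattice :=
  (gridEmbedding _ _).comp (SimpleGraph.Embedding.induce _)

lemma range_plusEmbedding (hh : 1 ≤ h) : Set.range (plusEmbedding h) = plusRegion h := by
  ext ⟨x, y⟩
  rw [Finset.mem_coe, mem_plusRegion]
  constructor
  · rintro ⟨⟨v, hv⟩, heq⟩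
    obtain ⟨rfl, rfl⟩ : (v.1 : ℕ) = x ∧ (v.2 : ℕ) = y := Prod.mk.inj heq
    have := mem_plusSet_iff.1 hv
    lia
  · intro hp
    exact ⟨⟨(⟨x, by lia⟩, ⟨y, by lia⟩), mem_plusSet_iff.2 (by simp only; lia)⟩, rfl⟩

lemma isSimplyConn_plusRegion (hh : 1 ≤ h) : IsSimplyConn (plusRegion h) := by
  refine (isSimplyConn_rect _ _ _ _).union (isSimplyConn_rect _ _ _ _) ?_ ?_
  · rintro ⟨x, y, _ | _⟩ <;>
      simp only [LatEdge.src, LatEdge.tgt, cond_true, cond_false, Finset.mem_union, mem_rect] <;>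
      omega
  · have inter_eq : (rect 0 (2 * h + 1) (h - 1) (h + 2) ∩ rect (h - 1) (h + 2) 0 (2 * h + 1) :
        Set (ℕ × ℕ)) = rect (h - 1) (h + 2) (h - 1) (h + 2) := by
      ext p
      simp only [Set.mem_inter_iff, Finset.mem_coe, mem_rect]
      lia
    rw [inter_eq]
    exact isContiguous_rect (by lia) (by lia)

lemma isContiguous_plusRegion_sdiff_singleton (hh : 1 ≤ h) (p : ℕ × ℕ) :
    IsContiguous squareLattice (plusRegion h \ {p}) := by
  rw [plusRegion, Finset.coe_union, Set.union_sdiff_distrib]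
  refine (SimpleGraph.induce_union_connected
    (isContiguous_rect_sdiff_singleton (by lia) (by lia) p)
    (isContiguous_rect_sdiff_singleton (by lia) (by lia) p) ?_).preconnected
  obtain ⟨o, ho, hop⟩ : ∃ o ∈ ({(h, h), (h - 1, h)} : Finset (ℕ × ℕ)), o ≠ p :=
    Finset.exists_mem_ne (by rw [Finset.card_pair (by simp; lia)]; exact one_lt_two) p
  refine ⟨o, ?_⟩
  simp only [Set.mem_inter_iff, Set.mem_sdiff, Finset.mem_coe, mem_rect, Set.mem_singleton_iff,
    hop]
  rcases (by simpa using ho : o = (h, h) ∨ o = (h - 1, h)) with rfl | rfl <;> simp only <;> lia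

instance (h : ℕ) : Nonempty (plusSet (2 * h + 1)) :=
  ⟨⟨(⟨h, by lia⟩, ⟨h, by lia⟩), mem_plusSet_iff.2 (by simp)⟩⟩

lemma isContiguous_compl_singleton_plusGraph (h : ℕ) (v : plusSet (2 * h + 1)) :
    IsContiguous (plusGraph (2 * h + 1)) {v}ᶜ := by
  rcases Nat.eq_zero_or_pos h with rfl | hh
  · exact isContiguous_of_subsingleton fun u _ w _ =>
      Subtype.ext (Subsingleton.elim (α := Fin 1 × Fin 1) u.1 w.1)
  · exact isContiguous_compl_singleton_of_range (plusEmbedding h) (range_plusEmbedding hh)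
      (isContiguous_plusRegion_sdiff_singleton hh) v

lemma isContiguous_univ_plusGraph (h : ℕ) : IsContiguous (plusGraph (2 * h + 1)) Set.univ := by
  rcases Nat.eq_zero_or_pos h with rfl | hh
  · exact isContiguous_of_subsingleton fun u _ w _ =>
      Subtype.ext (Subsingleton.elim (α := Fin 1 × Fin 1) u.1 w.1)
  · refine isContiguous_univ_of_range (plusEmbedding h) (range_plusEmbedding hh) ?_
    have := isContiguous_plusRegion_sdiff_singleton hh (0, 2 * h + 1)
    rwa [Set.sdiff_singleton_eq_self (by simp [mem_plusRegion]; lia)] at this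

lemma isErgodicChain_partitionChain_plusGraph (h : ℕ) :
    IsErgodicChain (partitionChain (plusGraph (2 * h + 1))) (uniformDist _) :=
  isErgodicChain_partitionChain (isContiguous_univ_plusGraph h)
    (isPeelable_of_forall_compl_singleton (isContiguous_univ_plusGraph h)
      (isContiguous_compl_singleton_plusGraph h))

end Plus

/-! ### The arms of the plus -/

section Arms

variable {h : ℕ} {a a' : Fin 4}

/-- The point in row `r` and column `i` of the right, left, upper or lower arm of the plus, for
`a = 0, 1, 2, 3`, where the columns of an arm are numbered outwards from the center. -/
def armCell (h : ℕ) (a : Fin 4) (r : Fin 3) (i : ℕ) : ℕ × ℕ :=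
  match a with
  | 0 => (h + 2 + i, h - 1 + r)
  | 1 => (h - 2 - i, h - 1 + r)
  | 2 => (h - 1 + r, h + 2 + i)
  | 3 => (h - 1 + r, h - 2 - i)

/-- The arm `a` of the plus. -/
def arm (h : ℕ) (a : Fin 4) : Set (ℕ × ℕ) := {p | ∃ r, ∃ i < h - 1, armCell h a r i = p}

lemma eq_of_mem_arm {p : ℕ × ℕ} (hp : p ∈ arm h a) (hp' : p ∈ arm h a') : a = a' := by
  obtain ⟨r, i, hi, rfl⟩ := hp
  obtain ⟨r', i', _, heq⟩ := hp'
  fin_cases a <;> fin_cases a' <;> simp only [armCell, Prod.mk.injEq] at heq ⊢ <;> lia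

lemma mem_rect_or_exists_mem_arm {p : ℕ × ℕ} (hp : p ∈ plusRegion h) :
    p ∈ rect (h - 1) (h + 2) (h - 1) (h + 2) ∨ ∃ a, p ∈ arm h a := by
  obtain ⟨x, y⟩ := p
  rw [mem_plusRegion] at hp
  rw [mem_rect, or_iff_not_imp_left]
  intro hcenter
  obtain hx | hx | hy | hy : h + 2 ≤ x ∨ x < h - 1 ∨ h + 2 ≤ y ∨ y < h - 1 := by lia
  · exact ⟨0, ⟨y - (h - 1), by lia⟩, x - (h + 2), by lia, Prod.ext (by simp only [armCell]; lia)
      (by simp only [armCell]; lia)⟩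
  · exact ⟨1, ⟨y - (h - 1), by lia⟩, h - 2 - x, by lia, Prod.ext (by simp only [armCell]; lia)
      (by simp only [armCell]; lia)⟩
  · exact ⟨2, ⟨x - (h - 1), by lia⟩, y - (h + 2), by lia, Prod.ext (by simp only [armCell]; lia)
      (by simp only [armCell]; lia)⟩
  · exact ⟨3, ⟨x - (h - 1), by lia⟩, h - 2 - y, by lia, Prod.ext (by simp only [armCell]; lia)
      (by simp only [armCell]; lia)⟩

lemma isSquare_plusRegion_iff {x y : ℕ} : IsSquare (plusRegion h) (x, y) ↔
    (x < 2 * h ∧ h - 1 ≤ y ∧ y ≤ h) ∨ (h - 1 ≤ x ∧ x ≤ h) ∧ y < 2 * h := by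
  simp only [IsSquare, Prod.forall, Bool.forall_bool, corner, mem_plusRegion, Bool.toNat_true,
    Bool.toNat_false]
  lia

lemma horizontal_side_mem_outerEdges {x y : ℕ} (hx : x + 2 ≤ h ∨ h + 1 ≤ x)
    (hy : y = h - 1 ∨ y = h + 1) : s((x, y), (x + 1, y)) ∈ outerEdges (plusRegion h) := by
  refine mem_outerEdges_horizontal ?_
  simp only [isSquare_plusRegion_iff]
  lia

lemma vertical_side_mem_outerEdges {x y : ℕ} (hx : x = h - 1 ∨ x = h + 1)
    (hy : y + 2 ≤ h ∨ h + 1 ≤ y) : s((x, y), (x, y + 1)) ∈ outerEdges (plusRegion h) := by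
  refine mem_outerEdges_vertical ?_
  simp only [isSquare_plusRegion_iff]
  lia

lemma vertical_tip_mem_outerEdges {x : ℕ} (hh : 1 ≤ h) (hx : x = 0 ∨ x = 2 * h) (y : ℕ) :
    s((x, y), (x, y + 1)) ∈ outerEdges (plusRegion h) := by
  refine mem_outerEdges_vertical ?_
  simp only [isSquare_plusRegion_iff]
  lia

lemma horizontal_tip_mem_outerEdges {y : ℕ} (hh : 1 ≤ h) (hy : y = 0 ∨ y = 2 * h) (x : ℕ) :
    s((x, y), (x + 1, y)) ∈ outerEdges (plusRegion h) := by
  refine mem_outerEdges_horizontal ?_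
  simp only [isSquare_plusRegion_iff]
  lia

lemma armCell_side_mem_outerEdges (h : ℕ) (a : Fin 4) {r : Fin 3} (hr : r ≠ 1) {i : ℕ}
    (hi : i + 1 < h - 1) :
    s(armCell h a r i, armCell h a r (i + 1)) ∈ outerEdges (plusRegion h) := by
  have succ_eq : h - 2 - i = h - 2 - (i + 1) + 1 := by lia
  have hrow : h - 1 + (r : ℕ) = h - 1 ∨ h - 1 + (r : ℕ) = h + 1 := by lia
  fin_cases a <;> simp only [armCell]
  · exact horizontal_side_mem_outerEdges (by lia) hrow
  · rw [succ_eq, Sym2.eq_swap]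
    exact horizontal_side_mem_outerEdges (by lia) hrow
  · exact vertical_side_mem_outerEdges hrow (by lia)
  · rw [succ_eq, Sym2.eq_swap]
    exact vertical_side_mem_outerEdges hrow (by lia)

lemma armCell_tip_mem_outerEdges (h : ℕ) (a : Fin 4) {r : Fin 3} (hr : r ≠ 1) {i : ℕ}
    (hi : i + 1 = h - 1) : s(armCell h a r i, armCell h a 1 i) ∈ outerEdges (plusRegion h) := by
  have outer : s(armCell h a 0 i, armCell h a 1 i) ∈ outerEdges (plusRegion h) ∧
      s(armCell h a 1 i, armCell h a 2 i) ∈ outerEdges (plusRegion h) := by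
    fin_cases a
    · exact ⟨vertical_tip_mem_outerEdges (by lia) (by lia) _,
        vertical_tip_mem_outerEdges (by lia) (by lia) _⟩
    · exact ⟨vertical_tip_mem_outerEdges (by lia) (by lia) _,
        vertical_tip_mem_outerEdges (by lia) (by lia) _⟩
    · exact ⟨horizontal_tip_mem_outerEdges (by lia) (by lia) _,
        horizontal_tip_mem_outerEdges (by lia) (by lia) _⟩
    · exact ⟨horizontal_tip_mem_outerEdges (by lia) (by lia) _,
        horizontal_tip_mem_outerEdges (by lia) (by lia) _⟩
  obtain rfl | rfl : r = 0 ∨ r = 2 := by lia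
  exacts [outer.1, Sym2.eq_swap ▸ outer.2]

lemma isStrip_armCell (h : ℕ) (a : Fin 4) : IsStrip (plusRegion h) (h - 1) (armCell h a) where
  mem r i hi := by
    rw [mem_plusRegion]
    fin_cases a <;> simp only [armCell] <;> lia
  inj hi hi' heq := by
    fin_cases a <;> simp only [armCell, Prod.mk.injEq] at heq <;> lia
  side _ hr _ hi := armCell_side_mem_outerEdges h a hr hi
  tip _ hr _ hi := armCell_tip_mem_outerEdges h a hr hi
  sep r i hi hpos q hq hadj := by
    obtain ⟨x, y⟩ := q
    rw [squareLattice_adj_iff] at hadj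
    rw [mem_plusRegion] at hq
    simp only at hq
    fin_cases a <;> simp only [armCell] at hadj ⊢
    · exact ⟨⟨y - (h - 1), by lia⟩, x - (h + 2), by lia, by lia, Prod.ext (by lia) (by lia)⟩
    · exact ⟨⟨y - (h - 1), by lia⟩, h - 2 - x, by lia, by lia, Prod.ext (by lia) (by lia)⟩
    · exact ⟨⟨x - (h - 1), by lia⟩, y - (h + 2), by lia, by lia, Prod.ext (by lia) (by lia)⟩
    · exact ⟨⟨x - (h - 1), by lia⟩, h - 2 - y, by lia, by lia, Prod.ext (by lia) (by lia)⟩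

open Classical in
/-- The arms of the plus in which the two ends of some column have different colors. -/
def splitArms (h : ℕ) (χ : ℕ × ℕ → Bool) : Finset (Fin 4) :=
  {a | ∃ i < h - 1, χ (armCell h a 0 i) ≠ χ (armCell h a 2 i)}

variable {χ χ' : ℕ × ℕ → Bool}

lemma mem_splitArms : a ∈ splitArms h χ ↔
    ∃ i < h - 1, χ (armCell h a 0 i) ≠ χ (armCell h a 2 i) := by
  simp [splitArms]

lemma mem_splitArms_congr (hχ : (∀ p ∈ arm h a, χ p = χ' p) ∨ ∀ p ∈ arm h a, χ p = !χ' p) :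
    a ∈ splitArms h χ ↔ a ∈ splitArms h χ' := by
  rw [mem_splitArms, mem_splitArms]
  refine exists_congr fun i => and_congr_right fun hi => ?_
  rcases hχ with hχ | hχ <;> rw [hχ _ ⟨0, i, hi, rfl⟩, hχ _ ⟨2, i, hi, rfl⟩]
  rw [ne_eq, ne_eq, Bool.not_inj_iff]

/-- Each split arm contains an edge of the outer boundary at which the color changes. -/
lemma card_splitArms_le (hh : 1 ≤ h) (hχ : HasConnClasses (plusRegion h) χ) :
    (splitArms h χ).card ≤ 2 := by
  have exists_cut : ∀ a ∈ splitArms h χ, ∃ p q, p ∈ arm h a ∧ q ∈ arm h a ∧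
      s(p, q) ∈ outerCuts (plusRegion h) χ := fun a ha => by
    obtain ⟨i, hi, hne⟩ := mem_splitArms.1 ha
    obtain ⟨r, k, r', k', -, -, hk, hk', hcut⟩ :=
      (isStrip_armCell h a).exists_mem_outerCuts hi hne
    exact ⟨_, _, ⟨r, k, hk, rfl⟩, ⟨r', k', hk', rfl⟩, hcut⟩
  choose! p q hp hq hcut using exists_cut
  refine (Finset.card_le_card_of_injOn (fun a => s(p a, q a)) hcut fun a ha b hb heq => ?_).trans
    (card_outerCuts_le (isSimplyConn_plusRegion hh) hχ)
  rcases Sym2.eq_iff.1 heq with ⟨heq, -⟩ | ⟨heq, -⟩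
  · exact eq_of_mem_arm (hp a ha) (heq ▸ hp b hb)
  · exact eq_of_mem_arm (hp a ha) (heq ▸ hq b hb)

end Arms

/-! ### The two halves of the plus -/

section Halves

variable {h : ℕ}

/-- The reflection of the plus that exchanges its right and its left arm. -/
def plusReflect (h : ℕ) : plusGraph (2 * h + 1) ≃g plusGraph (2 * h + 1) where
  toEquiv := (Fin.revPerm.prodCongr (Equiv.refl _)).subtypeEquiv fun v => by
    simp only [mem_plusSet_iff, Equiv.prodCongr_apply, Prod.map_fst, Prod.map_snd,
      Fin.revPerm_apply, Fin.val_rev, Equiv.refl_apply]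
    lia
  map_rel_iff' {u v} := by
    refine gridGraph_adj_iff.trans (Iff.trans ?_ gridGraph_adj_iff.symm)
    simp only [Function.Embedding.subtype_apply, Equiv.subtypeEquiv_apply, Equiv.prodCongr_apply,
      Prod.map_fst, Prod.map_snd, Fin.revPerm_apply, Fin.val_rev, Equiv.refl_apply]
    lia

/-- The reflection of the plus that exchanges its rows and its columns. -/
def plusSwap (h : ℕ) : plusGraph (2 * h + 1) ≃g plusGraph (2 * h + 1) where
  toEquiv := (Equiv.prodComm _ _).subtypeEquiv fun v => by
    simp only [mem_plusSet_iff, Equiv.prodComm_apply, Prod.fst_swap, Prod.snd_swap]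
    exact or_comm
  map_rel_iff' := or_comm

lemma exists_plusEmbedding_eq (hh : 1 ≤ h) {p : ℕ × ℕ} (hp : p ∈ plusRegion h) :
    ∃ v, plusEmbedding h v = p := by
  rwa [← Set.mem_range, range_plusEmbedding hh, Finset.mem_coe]

lemma exists_adj_dist_lt (hh : 1 ≤ h) {p : ℕ × ℕ} (hp : p ∈ plusRegion h)
    (hle : p.1 ≤ h) (hne : p ≠ (h - 1, h)) : ∃ q ∈ plusRegion h, q.1 < h ∧ squareLattice.Adj p q ∧
      q.1.dist (h - 1) + q.2.dist h < p.1.dist (h - 1) + p.2.dist h := by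
  obtain ⟨x, y⟩ := p
  simp only [Prod.exists, mem_plusRegion, squareLattice_adj_iff, Nat.dist, ne_eq,
    Prod.mk.injEq] at *
  rcases lt_trichotomy x (h - 1) with hx | rfl | hx
  · exact ⟨x + 1, y, by lia⟩
  · rcases lt_or_gt_of_ne (hne ∘ And.intro rfl) with hy | hy
    · exact ⟨h - 1, y + 1, by lia⟩
    · exact ⟨h - 1, y - 1, by lia⟩
  · exact ⟨x - 1, y, by lia⟩

lemma isContiguous_of_left_half_subset (hh : 1 ≤ h) {B : Set (plusSet (2 * h + 1))}
    (hleft : ∀ v : plusSet (2 * h + 1), (v.1.1 : ℕ) < h → v ∈ B)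
    (hB : ∀ v ∈ B, (v.1.1 : ℕ) ≤ h) : IsContiguous (plusGraph (2 * h + 1)) B := by
  obtain ⟨o, ho⟩ := exists_plusEmbedding_eq hh (p := (h - 1, h)) (by rw [mem_plusRegion]; lia)
  refine isContiguous_of_rank o (fun v => (v.1.1 : ℕ).dist (h - 1) + (v.1.2 : ℕ).dist h)
    fun u hu => or_iff_not_imp_left.2 fun hne => ?_
  have hu_mem : plusEmbedding h u ∈ (plusRegion h : Set (ℕ × ℕ)) :=
    range_plusEmbedding hh ▸ Set.mem_range_self u
  obtain ⟨q, hq, hq_lt, hadj, hdist⟩ := exists_adj_dist_lt hh hu_mem (hB u hu)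
    (ho ▸ (plusEmbedding h).injective.ne hne)
  obtain ⟨w, rfl⟩ := exists_plusEmbedding_eq hh hq
  exact ⟨w, hleft w hq_lt, (plusEmbedding h).map_adj_iff.1 hadj, hdist⟩

/-- The part of the plus to the left of the middle column, together with the part `b` of the
middle column. -/
def leftSet (h : ℕ) (b : Finset (Fin (2 * h + 1))) : Set (plusSet (2 * h + 1)) :=
  {v | (v.1.1 : ℕ) < h ∨ (v.1.1 : ℕ) = h ∧ v.1.2 ∈ b}

/-- The part of the plus below the middle row, together with the part `b` of the middle row. -/
def lowerSet (h : ℕ) (b : Finset (Fin (2 * h + 1))) : Set (plusSet (2 * h + 1)) :=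
  plusSwap h ⁻¹' leftSet h b

lemma isContiguous_preimage_iff {V V' : Type*} {G : SimpleGraph V} {H : SimpleGraph V'}
    (e : G ≃g H) {B : Set V'} : IsContiguous G (e ⁻¹' B) ↔ IsContiguous H B := by
  rw [← isContiguous_image_iff e.toEmbedding]
  exact iff_of_eq (congrArg _ (Set.image_preimage_eq B e.surjective))

lemma isSplit_leftSet (hh : 1 ≤ h) (b : Finset (Fin (2 * h + 1))) :
    IsSplit (plusGraph (2 * h + 1)) (leftSet h b) := by
  refine ⟨isContiguous_of_left_half_subset hh (fun v => Or.inl) fun v hv => ?_, ?_⟩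
  · exact hv.elim le_of_lt fun hv => hv.1.le
  · have reflect_fst : ∀ v, ((plusReflect h v).1.1 : ℕ) = 2 * h + 1 - (v.1.1 + 1) := fun v => rfl
    rw [← isContiguous_preimage_iff (plusReflect h)]
    refine isContiguous_of_left_half_subset hh (fun v hv => ?_) fun v hv => ?_
    · rw [Set.mem_preimage, Set.mem_compl_iff, leftSet, Set.mem_ofPred_eq, reflect_fst]
      lia
    · have hv' : ¬ ((plusReflect h v).1.1 : ℕ) < h := fun hlt => hv (Or.inl hlt)
      rw [reflect_fst] at hv'
      lia

lemma isSplit_lowerSet (hh : 1 ≤ h) (b : Finset (Fin (2 * h + 1))) :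
    IsSplit (plusGraph (2 * h + 1)) (lowerSet h b) :=
  ⟨(isContiguous_preimage_iff _).2 (isSplit_leftSet hh b).1,
    (isContiguous_preimage_iff _).2 (isSplit_leftSet hh b).2⟩

lemma leftSet_injective (h : ℕ) : Function.Injective (leftSet h) := by
  intro b b' heq
  ext j
  simpa [leftSet] using Set.ext_iff.1 heq ⟨(⟨h, by lia⟩, j), mem_plusSet_iff.2 (by simp)⟩

lemma leftSet_ne_compl (hh : 1 ≤ h) (b b' : Finset (Fin (2 * h + 1))) :
    leftSet h b ≠ (leftSet h b')ᶜ := by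
  intro heq
  obtain ⟨v, hv⟩ := exists_plusEmbedding_eq hh (p := (h - 1, h)) (by rw [mem_plusRegion]; lia)
  have hlt : (v.1.1 : ℕ) < h := by
    have : (v.1.1 : ℕ) = h - 1 := congrArg Prod.fst hv
    lia
  exact (heq.le (Or.inl hlt : v ∈ leftSet h b)) (Or.inl hlt)

lemma partitionOf_leftSet_injective (hh : 1 ≤ h) : Function.Injective fun b =>
    partitionOf (plusGraph (2 * h + 1)) (leftSet h b) (isSplit_leftSet hh b) := fun b b' heq =>
  leftSet_injective h (((partitionOf_eq_iff _ _).1 heq).resolve_right (leftSet_ne_compl hh b b'))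

lemma partitionOf_lowerSet_injective (hh : 1 ≤ h) : Function.Injective fun b =>
    partitionOf (plusGraph (2 * h + 1)) (lowerSet h b) (isSplit_lowerSet hh b) := fun b b' heq => by
  have preimage_injective := (plusSwap h).surjective.preimage_injective
  rcases (partitionOf_eq_iff _ _).1 heq with heq | heq
  · exact leftSet_injective h (preimage_injective heq)
  · exact (leftSet_ne_compl hh b b' (preimage_injective heq)).elim

end Halves

/-! ### The bottleneck of the plus -/

section PlusBottleneck

variable {h : ℕ} {a : Fin 4} {A B : Set (plusSet (2 * h + 1))} {χ χ' : ℕ × ℕ → Bool}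

lemma mem_plusRegion_of_mem_arm {p : ℕ × ℕ} (hp : p ∈ arm h a) : p ∈ plusRegion h := by
  obtain ⟨r, i, hi, rfl⟩ := hp
  exact (isStrip_armCell h a).mem r i hi

lemma mem_splitArms_markColoring_congr (hh : 1 ≤ h)
    (hAB : (∀ u, plusEmbedding h u ∈ arm h a → (u ∈ A ↔ u ∈ B)) ∨
      ∀ u, plusEmbedding h u ∈ arm h a → (u ∈ A ↔ u ∉ B)) :
    a ∈ splitArms h (markColoring (plusEmbedding h) A) ↔
      a ∈ splitArms h (markColoring (plusEmbedding h) B) := by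
  refine mem_splitArms_congr (hAB.imp (fun hAB p hp => ?_) fun hAB p hp => ?_) <;>
    obtain ⟨u, rfl⟩ := exists_plusEmbedding_eq hh (mem_plusRegion_of_mem_arm hp)
  · exact (markColoring_eq_markColoring_iff _).2 (hAB u hp)
  · exact (markColoring_eq_not_markColoring_iff _).2 (hAB u hp)

lemma exists_forall_mem_splitArms_iff (hh : 1 ≤ h) (v : plusSet (2 * h + 1))
    (hAB : (∀ u, u ≠ v → (u ∈ A ↔ u ∈ B)) ∨ ∀ u, u ≠ v → (u ∈ A ↔ u ∉ B)) :
    ∃ a₀, ∀ a, a ≠ a₀ → (a ∈ splitArms h (markColoring (plusEmbedding h) A) ↔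
      a ∈ splitArms h (markColoring (plusEmbedding h) B)) := by
  obtain ⟨a₀, ha₀⟩ : ∃ a₀, ∀ a, a ≠ a₀ → plusEmbedding h v ∉ arm h a := by
    by_cases hv : ∃ a₀, plusEmbedding h v ∈ arm h a₀
    · obtain ⟨a₀, hv⟩ := hv
      exact ⟨a₀, fun a hne hva => hne (eq_of_mem_arm hva hv)⟩
    · exact ⟨0, fun a _ hva => hv ⟨a, hva⟩⟩
  refine ⟨a₀, fun a ha => mem_splitArms_markColoring_congr hh ?_⟩
  have ne_of_mem_arm : ∀ u, plusEmbedding h u ∈ arm h a → u ≠ v := fun u hu huv =>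
    ha₀ a ha (huv ▸ hu)
  exact hAB.imp (fun hAB u hu => hAB u (ne_of_mem_arm u hu))
    fun hAB u hu => hAB u (ne_of_mem_arm u hu)

/-- The coloring of the lattice points that marks one of the two pieces of the partition `p`. -/
def plusMark (p : ContigTwoPartition (plusGraph (2 * h + 1))) : ℕ × ℕ → Bool :=
  markColoring (plusEmbedding h) p.piece

lemma hasConnClasses_plusMark (hh : 1 ≤ h) (p : ContigTwoPartition (plusGraph (2 * h + 1))) :
    HasConnClasses (plusRegion h) (plusMark p) :=
  p.isSplit_piece.hasConnClasses_markColoring _ (range_plusEmbedding hh)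

lemma eq_of_plusMark_eq (hh : 1 ≤ h) {p p' : ContigTwoPartition (plusGraph (2 * h + 1))}
    (heq : ∀ q ∈ plusRegion h, plusMark p q = plusMark p' q) : p = p' := by
  have piece_eq : p.piece = p'.piece := by
    ext v
    refine (markColoring_eq_markColoring_iff _).1 (heq _ ?_)
    rw [← Finset.mem_coe, ← range_plusEmbedding hh]
    exact Set.mem_range_self v
  rw [← p.partitionOf_piece, ← p'.partitionOf_piece, partitionOf_eq_iff]
  exact Or.inl piece_eq

lemma splitArms_partitionOf (hh : 1 ≤ h) (hA : IsSplit (plusGraph (2 * h + 1)) A) :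
    splitArms h (plusMark (partitionOf _ A hA)) =
      splitArms h (markColoring (plusEmbedding h) A) := by
  ext a
  refine mem_splitArms_markColoring_congr hh ?_
  exact ((partitionOf_eq_iff _ _).1 (partitionOf _ A hA).partitionOf_piece).imp
    (fun heq u _ => Set.ext_iff.1 heq u) fun heq u _ => Set.ext_iff.1 heq u

lemma mem_splitArms_markColoring (hh : 2 ≤ h)
    (hA : ∀ u, plusEmbedding h u = armCell h a 0 0 → u ∈ A)
    (hA' : ∀ u, plusEmbedding h u = armCell h a 2 0 → u ∉ A) :
    a ∈ splitArms h (markColoring (plusEmbedding h) A) := by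
  obtain ⟨u, hu⟩ := exists_plusEmbedding_eq (by lia)
    ((isStrip_armCell h a).mem 0 0 (by lia))
  obtain ⟨w, hw⟩ := exists_plusEmbedding_eq (by lia)
    ((isStrip_armCell h a).mem 2 0 (by lia))
  refine mem_splitArms.2 ⟨0, by lia, ?_⟩
  rw [← hu, ← hw, ne_eq, Bool.eq_iff_iff, markColoring_eq_true_iff, markColoring_eq_true_iff]
  exact fun heq => hA' w hw (heq.1 (hA u hu))

lemma mem_splitArms_leftSet (hh : 2 ≤ h) (ha : a = 2 ∨ a = 3) (b : Finset (Fin (2 * h + 1))) :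
    a ∈ splitArms h (markColoring (plusEmbedding h) (leftSet h b)) := by
  refine mem_splitArms_markColoring hh (fun u hu => Or.inl ?_) fun u hu hmem => ?_
  · have : (u.1.1 : ℕ) = h - 1 := by
      rcases ha with rfl | rfl <;> exact congrArg Prod.fst hu
    lia
  · have : (u.1.1 : ℕ) = h - 1 + 2 := by
      rcases ha with rfl | rfl <;> exact congrArg Prod.fst hu
    rcases hmem with hlt | ⟨heq, -⟩ <;> lia

lemma mem_splitArms_lowerSet (hh : 2 ≤ h) (ha : a = 0 ∨ a = 1) (b : Finset (Fin (2 * h + 1))) :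
    a ∈ splitArms h (markColoring (plusEmbedding h) (lowerSet h b)) := by
  have swap_fst : ∀ u, ((plusSwap h u).1.1 : ℕ) = u.1.2 := fun u => rfl
  refine mem_splitArms_markColoring hh (fun u hu => Or.inl ?_) fun u hu hmem => ?_
  · have : (u.1.2 : ℕ) = h - 1 := by
      rcases ha with rfl | rfl <;> exact congrArg Prod.snd hu
    rw [swap_fst]
    lia
  · have : (u.1.2 : ℕ) = h - 1 + 2 := by
      rcases ha with rfl | rfl <;> exact congrArg Prod.snd hu
    rcases hmem with hlt | ⟨heq, -⟩
    · rw [swap_fst] at hlt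
      lia
    · rw [swap_fst] at heq
      lia

/-- The colors in the center of the plus together with the codes of the rows of its arms. -/
def plusCode (h : ℕ) (χ : ℕ × ℕ → Bool) :
    Finset (ℕ × ℕ) × (Fin 4 × Fin 3 → Bool × Finset ℕ) :=
  ({q ∈ rect (h - 1) (h + 2) (h - 1) (h + 2) | χ q = true},
    fun q => rowCode (stripRow χ (armCell h q.1) q.2) (h - 1))

lemma eq_of_plusCode_eq (heq : plusCode h χ = plusCode h χ') :
    ∀ q ∈ plusRegion h, χ q = χ' q := by
  intro q hq
  obtain ⟨center_eq, arms_eq⟩ := Prod.mk.inj heq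
  rcases mem_rect_or_exists_mem_arm hq with hq | ⟨a, r, i, hi, rfl⟩
  · have mem_iff := Finset.ext_iff.1 center_eq q
    simp only [Finset.mem_filter, hq, true_and] at mem_iff
    exact Bool.eq_iff_iff.2 mem_iff
  · exact eq_of_rowCode_eq (congrFun arms_eq (a, r)) i hi

/-- The possible codes of the rows of the arms if no arm other than `a` is split. -/
def armCodes (h : ℕ) (a : Fin 4) : Fin 4 × Fin 3 → Finset (Bool × Finset ℕ) :=
  Function.update (fun _ => rowCodes (h - 1) 8) (a, 1) (rowCodes (h - 1) (h - 1))

lemma plusCode_mem_armCodes (hh : 1 ≤ h) (hχ : HasConnClasses (plusRegion h) χ)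
    (hsplit : splitArms h χ ⊆ {a}) (q : Fin 4 × Fin 3) : (plusCode h χ).2 q ∈ armCodes h a q := by
  have hstrip := isStrip_armCell h q.1
  have hW := isSimplyConn_plusRegion hh
  by_cases hq : q = (a, 1)
  · subst hq
    rw [armCodes, Function.update_self]
    exact rowCode_mem_rowCodes_self _ _
  rw [armCodes, Function.update_of_ne hq]
  refine rowCode_mem_rowCodes ?_
  by_cases hr : q.2 = 1
  · have hqa : q.1 ≠ a := fun hqa => hq (Prod.ext hqa hr)
    simp only [hr]
    refine hstrip.card_changes_middle_le hW hχ fun i hi => ?_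
    by_contra hne
    exact hqa (Finset.mem_singleton.1 (hsplit (mem_splitArms.2 ⟨i, hi, hne⟩)))
  · exact (hstrip.card_changes_outer_le hW hχ hr).trans (by norm_num)

lemma prod_card_armCodes_le (hh : 1 ≤ h) (a : Fin 4) :
    ∏ q, (armCodes h a q).card ≤ 2 ^ h * (2 * h ^ 8) ^ 11 := by
  have card_update : (fun q => (armCodes h a q).card) =
      Function.update (fun _ => (rowCodes (h - 1) 8).card) (a, 1)
        (rowCodes (h - 1) (h - 1)).card := by
    ext q
    exact Function.apply_update (fun _ => Finset.card) _ _ _ q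
  have card_others : (Finset.univ \ {(a, (1 : Fin 3))}).card = 11 := by
    rw [Finset.card_univ_sdiff, Finset.card_singleton, Fintype.card_prod, Fintype.card_fin,
      Fintype.card_fin]
  rw [card_update, Finset.prod_update_of_mem (Finset.mem_univ _), Finset.prod_const, card_others]
  refine Nat.mul_le_mul ((card_rowCodes_self_le _).trans_eq ?_)
    (Nat.pow_le_pow_left ((card_rowCodes_le _ _).trans_eq ?_) _)
  · rw [← pow_succ', Nat.sub_add_cancel hh]
  · rw [Nat.sub_add_cancel hh]

open Classical in
/-- The states that split no arm other than `a`. -/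
def oneArmStates (h : ℕ) (a : Fin 4) : Finset (ContigTwoPartition (plusGraph (2 * h + 1))) :=
  {p | splitArms h (plusMark p) ⊆ {a}}

lemma card_oneArmStates_le (hh : 1 ≤ h) (a : Fin 4) :
    (oneArmStates h a).card ≤ 2 ^ 9 * (2 ^ h * (2 * h ^ 8) ^ 11) := by
  have card_center : (rect (h - 1) (h + 2) (h - 1) (h + 2)).card = 9 := by
    rw [rect, Finset.card_product, Nat.card_Ico, show h + 2 - (h - 1) = 3 by lia]
  calc (oneArmStates h a).card
      ≤ ((rect (h - 1) (h + 2) (h - 1) (h + 2)).powerset ×ˢ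
          Fintype.piFinset (armCodes h a)).card := by
        refine Finset.card_le_card_of_injOn (fun p => plusCode h (plusMark p)) (fun p hp => ?_)
          fun p _ p' _ heq => eq_of_plusMark_eq hh (eq_of_plusCode_eq heq)
        exact Finset.mem_product.2 ⟨Finset.mem_powerset.2 (Finset.filter_subset _ _),
          Fintype.mem_piFinset.2 (plusCode_mem_armCodes hh (hasConnClasses_plusMark hh p)
            (Finset.mem_filter.1 hp).2)⟩
    _ = 2 ^ 9 * ∏ q, (armCodes h a q).card := by
        rw [Finset.card_product, Finset.card_powerset, card_center, Fintype.card_piFinset]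
    _ ≤ 2 ^ 9 * (2 ^ h * (2 * h ^ 8) ^ 11) := Nat.mul_le_mul_left _ (prod_card_armCodes_le hh a)

/-- The states that split the upper and the lower arm. -/
def verticalStates (h : ℕ) : Finset (ContigTwoPartition (plusGraph (2 * h + 1))) :=
  {p | 2 ∈ splitArms h (plusMark p) ∧ 3 ∈ splitArms h (plusMark p)}

/-- The states that split at most one arm. -/
def bottleneckStates (h : ℕ) : Finset (ContigTwoPartition (plusGraph (2 * h + 1))) :=
  {p | (splitArms h (plusMark p)).card ≤ 1}

lemma mem_verticalStates {p : ContigTwoPartition (plusGraph (2 * h + 1))} :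
    p ∈ verticalStates h ↔ 2 ∈ splitArms h (plusMark p) ∧ 3 ∈ splitArms h (plusMark p) := by
  simp [verticalStates]

lemma mem_bottleneckStates {p : ContigTwoPartition (plusGraph (2 * h + 1))} :
    p ∈ bottleneckStates h ↔ (splitArms h (plusMark p)).card ≤ 1 := by
  simp [bottleneckStates]

lemma disjoint_verticalStates_bottleneckStates (h : ℕ) :
    Disjoint (verticalStates h) (bottleneckStates h) := by
  refine Finset.disjoint_left.2 fun p hp hp' => ?_
  obtain ⟨h₂, h₃⟩ := mem_verticalStates.1 hp
  exact absurd (Finset.card_le_one.1 (mem_bottleneckStates.1 hp') 2 h₂ 3 h₃) (by decide)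

lemma card_bottleneckStates_le (hh : 1 ≤ h) :
    (bottleneckStates h).card ≤ 2 ^ 22 * h ^ 88 * 2 ^ h := by
  classical
  have subset_biUnion : bottleneckStates h ⊆ Finset.univ.biUnion (oneArmStates h) := by
    intro p hp
    obtain ⟨a, ha⟩ := Finset.card_le_one_iff_subset_singleton.1 (mem_bottleneckStates.1 hp)
    exact Finset.mem_biUnion.2 ⟨a, Finset.mem_univ a, by simpa [oneArmStates] using ha⟩
  calc (bottleneckStates h).card ≤ ∑ a, (oneArmStates h a).card :=
        (Finset.card_le_card subset_biUnion).trans Finset.card_biUnion_le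
    _ ≤ ∑ _a : Fin 4, 2 ^ 9 * (2 ^ h * (2 * h ^ 8) ^ 11) :=
        Finset.sum_le_sum fun a _ => card_oneArmStates_le hh a
    _ = 2 ^ 22 * h ^ 88 * 2 ^ h := by
        rw [Finset.sum_const, Finset.card_univ, Fintype.card_fin, smul_eq_mul]
        ring

lemma subset_of_forall_mem_iff {α : Type*} {T T' : Finset α} {a₀ : α} (hT : T.card ≤ T'.card)
    (h : ∀ a, a ≠ a₀ → (a ∈ T ↔ a ∈ T')) : T ⊆ T' := by
  classical
  intro u hu
  by_contra hu'
  have u_eq : u = a₀ := by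
    by_contra hne
    exact hu' ((h u hne).1 hu)
  have subset_erase : T' ⊆ T.erase u := by
    intro w hw
    have hwu : w ≠ u := fun hwu => hu' (hwu ▸ hw)
    exact Finset.mem_erase.2 ⟨hwu, (h w (u_eq ▸ hwu)).2 hw⟩
  have card_le := Finset.card_le_card subset_erase
  have card_pos := Finset.card_pos.2 ⟨u, hu⟩
  rw [Finset.card_erase_of_mem hu] at card_le
  lia

lemma partitionChain_eq_zero_of_mem_verticalStates (hh : 1 ≤ h)
    {p p' : ContigTwoPartition (plusGraph (2 * h + 1))} (hp : p ∈ verticalStates h)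
    (hp' : p' ∉ verticalStates h ∪ bottleneckStates h) :
    partitionChain (plusGraph (2 * h + 1)) p p' = 0 := by
  rw [Finset.mem_union, not_or, mem_bottleneckStates, not_le] at hp'
  obtain ⟨hvert, hcard⟩ := hp'
  obtain ⟨h₂, h₃⟩ := mem_verticalStates.1 hp
  by_contra hne
  rcases exists_of_partitionChain_ne_zero hne with rfl | ⟨v, hv⟩
  · exact hvert hp
  · obtain ⟨a₀, ha₀⟩ := exists_forall_mem_splitArms_iff hh v hv
    have hsub := subset_of_forall_mem_iff
      ((card_splitArms_le hh (hasConnClasses_plusMark hh p)).trans hcard) ha₀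
    exact hvert (mem_verticalStates.2 ⟨hsub h₂, hsub h₃⟩)

lemma two_pow_le_card_verticalStates (hh : 2 ≤ h) :
    2 ^ (2 * h + 1) ≤ (verticalStates h).card := by
  refine two_pow_le_card_of_injective (partitionOf_leftSet_injective (by lia)) fun b => ?_
  rw [mem_verticalStates, splitArms_partitionOf (by lia)]
  exact ⟨mem_splitArms_leftSet hh (Or.inl rfl) b, mem_splitArms_leftSet hh (Or.inr rfl) b⟩

lemma two_pow_le_card_compl_verticalStates_union (hh : 2 ≤ h) :
    2 ^ (2 * h + 1) ≤ (verticalStates h ∪ bottleneckStates h)ᶜ.card := by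
  refine two_pow_le_card_of_injective (partitionOf_lowerSet_injective (by lia)) fun b => ?_
  have h₀ := mem_splitArms_lowerSet hh (Or.inl rfl) b
  have h₁ := mem_splitArms_lowerSet hh (Or.inr rfl) b
  have hcard := card_splitArms_le (by lia)
    ((isSplit_lowerSet (by lia) b).hasConnClasses_markColoring _
      (range_plusEmbedding (h := h) (by lia)))
  rw [Finset.mem_compl, Finset.mem_union, mem_verticalStates, mem_bottleneckStates,
    splitArms_partitionOf (by lia)]
  generalize splitArms h (markColoring (plusEmbedding h) (lowerSet h b)) = T at *
  revert T
  decide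

lemma hasBottleneck_partitionChain_plusGraph (hh : 2 ≤ h) :
    HasBottleneck (partitionChain (plusGraph (2 * h + 1))) (2 ^ (2 * h + 1))
      (2 ^ 22 * ((2 * h + 1 : ℕ) : ℝ) ^ 88 * (2 : ℝ) ^ (((2 * h + 1 : ℕ) : ℝ) / 2)) := by
  have hh₁ : 1 ≤ h := by lia
  refine ⟨verticalStates h, bottleneckStates h, disjoint_verticalStates_bottleneckStates h,
    fun p hp p' hp' => ?_, by exact_mod_cast two_pow_le_card_verticalStates hh,
    by exact_mod_cast two_pow_le_card_compl_verticalStates_union hh, ?_⟩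
  · have hzero := partitionChain_eq_zero_of_mem_verticalStates hh₁ hp (Finset.mem_compl.1 hp')
    exact ⟨hzero, (partitionChain_isSymm.apply p p').trans hzero⟩
  · calc ((bottleneckStates h).card : ℝ) ≤ 2 ^ 22 * (h : ℝ) ^ 88 * 2 ^ (h : ℝ) := by
          rw [Real.rpow_natCast]
          exact_mod_cast card_bottleneckStates_le hh₁
      _ ≤ 2 ^ 22 * ((2 * h + 1 : ℕ) : ℝ) ^ 88 * (2 : ℝ) ^ (((2 * h + 1 : ℕ) : ℝ) / 2) := by
          gcongr
          · lia
          · norm_num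
          · push_cast
            linarith

end PlusBottleneck

/-! ### Bandwidth -/

section Bandwidth

section Labeling

variable {V : Type*} [Fintype V] {G : SimpleGraph V}

lemma val_sub_val_le_of_strictMono {n : ℕ} {f : Fin n → ℕ} (hf : StrictMono f) (i j : Fin n) :
    (j : ℕ) - i ≤ f j - f i := by
  rw [← Fin.card_Ico, ← Nat.card_Ico]
  refine Finset.card_le_card_of_injOn f (fun m hm => ?_) hf.injective.injOn
  obtain ⟨him, hmj⟩ := Finset.mem_Ico.1 hm
  exact Finset.mem_Ico.2 ⟨hf.monotone him, hf hmj⟩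

lemma exists_strictMono_comp_symm {L : V → ℕ} (hL : Function.Injective L) :
    ∃ σ : V ≃ Fin (Fintype.card V), StrictMono (L ∘ σ.symm) := by
  let _ := LinearOrder.lift' L hL
  have L_strictMono : StrictMono L := fun _ _ huv => huv
  exact ⟨(Fintype.orderIsoFinOfCardEq V rfl).symm.toEquiv,
    L_strictMono.comp (Fintype.orderIsoFinOfCardEq V rfl).strictMono⟩

lemma bandwidth_le_of_injective {L : V → ℕ} (hL : Function.Injective L) {b : ℕ}
    (h : ∀ u v, G.Adj u v → L v ≤ L u + b) : bandwidth G ≤ b := by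
  obtain ⟨σ, hσ⟩ := exists_strictMono_comp_symm hL
  have gap_le : ∀ u v, G.Adj u v → (σ v : ℕ) ≤ σ u + b := by
    intro u v huv
    have label_gap := val_sub_val_le_of_strictMono hσ (σ u) (σ v)
    simp only [Function.comp_apply, Equiv.symm_apply_apply] at label_gap
    have := h u v huv
    lia
  refine Nat.sInf_le ⟨σ, fun u v huv => abs_le.2 ?_⟩
  have := gap_le u v huv
  have := gap_le v u huv.symm
  lia

lemma exists_labeling_bandwidth (G : SimpleGraph V) : ∃ σ : V ≃ Fin (Fintype.card V),
    ∀ u v, G.Adj u v → |((σ u : ℕ) : ℤ) - ((σ v : ℕ) : ℤ)| ≤ (bandwidth G : ℤ) := by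
  refine Nat.sInf_mem (s := {b : ℕ | ∃ σ : V ≃ Fin (Fintype.card V), ∀ u v, G.Adj u v →
    |((σ u : ℕ) : ℤ) - ((σ v : ℕ) : ℤ)| ≤ (b : ℤ)})
    ⟨Fintype.card V, Fintype.equivFin V, fun u v _ => abs_le.2 ?_⟩
  omega

end Labeling

lemma two_lt_abs_sub_of_notMem {V : Type*} {L : V → ℤ} (hL : Function.Injective L) {c w : V}
    {N : Finset V} (hN : ∀ x ∈ N, |L x - L c| ≤ 2) (hcard : N.card = 4) (hc : c ∉ N) (hw : w ∉ N)
    (hwc : w ≠ c) : 2 < |L w - L c| := by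
  classical
  by_contra! hle
  have image_subset : (insert w (insert c N)).image L ⊆ Finset.Icc (L c - 2) (L c + 2) := by
    refine Finset.image_subset_iff.2 fun x hx => ?_
    have hx_le : |L x - L c| ≤ 2 := by
      rcases Finset.mem_insert.1 hx with rfl | hx
      · exact hle
      rcases Finset.mem_insert.1 hx with rfl | hx
      · simp
      · exact hN x hx
    rw [abs_le] at hx_le
    exact Finset.mem_Icc.2 (by lia)
  have card_le := Finset.card_le_card image_subset
  rw [Finset.card_image_of_injective _ hL, Int.card_Icc, Finset.card_insert_of_notMem
    (by simp [hw, hwc]), Finset.card_insert_of_notMem hc] at card_le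
  lia

/- The neighbors of the center take all four labels at distance at most `2` from its label, so a
corner has a label further away, on the same side as both neighbors that it shares with the center.
Hence all neighbors of the center are on one side, where there are only two labels. -/
lemma exists_two_lt_abs_sub_gridGraph {L : Fin 3 × Fin 3 → ℤ} (hL : Function.Injective L) :
    ∃ u v, (gridGraph 3 3).Adj u v ∧ 2 < |L u - L v| := by
  by_contra! hle
  have adj_le : ∀ u v : Fin 3 × Fin 3, (((u.1.1 + 1 = v.1.1 ∨ v.1.1 + 1 = u.1.1) ∧ u.2.1 = v.2.1) ∨
      (u.2.1 + 1 = v.2.1 ∨ v.2.1 + 1 = u.2.1) ∧ u.1.1 = v.1.1) → |L u - L v| ≤ 2 :=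
    fun u v huv => hle u v (gridGraph_adj_iff.2 huv)
  have far_of_corner : ∀ w ∈ ({(0, 0), (2, 0)} : Finset (Fin 3 × Fin 3)),
      2 < |L w - L (1, 1)| := by
    intro w hw
    refine two_lt_abs_sub_of_notMem hL (N := {(0, 1), (1, 0), (2, 1), (1, 2)})
      (fun x hx => adj_le x (1, 1) ?_) (by decide) (by decide) ?_ ?_ <;>
    · revert hw
      decide +revert
  have same_side : ∀ w x y : Fin 3 × Fin 3, 2 < |L w - L (1, 1)| → |L w - L x| ≤ 2 →
      |L w - L y| ≤ 2 → (L (1, 1) < L x ↔ L (1, 1) < L y) := by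
    intro w x y hw hx hy
    rw [abs_le] at hx hy
    rw [lt_abs] at hw
    lia
  have side_left := same_side (0, 0) (0, 1) (1, 0) (far_of_corner _ (by decide))
    (adj_le _ _ (by decide)) (adj_le _ _ (by decide))
  have side_right := same_side (2, 0) (1, 0) (2, 1) (far_of_corner _ (by decide))
    (adj_le _ _ (by decide)) (adj_le _ _ (by decide))
  have near₀ := abs_le.1 (adj_le (0, 1) (1, 1) (by decide))
  have near₁ := abs_le.1 (adj_le (1, 0) (1, 1) (by decide))
  have near₂ := abs_le.1 (adj_le (2, 1) (1, 1) (by decide))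
  have ne_center₀ : L (0, 1) ≠ L (1, 1) := hL.ne (by decide)
  have ne_center₁ : L (1, 0) ≠ L (1, 1) := hL.ne (by decide)
  have ne_center₂ : L (2, 1) ≠ L (1, 1) := hL.ne (by decide)
  have ne₀₁ : L (0, 1) ≠ L (1, 0) := hL.ne (by decide)
  have ne₀₂ : L (0, 1) ≠ L (2, 1) := hL.ne (by decide)
  have ne₁₂ : L (1, 0) ≠ L (2, 1) := hL.ne (by decide)
  omega

lemma three_le_bandwidth_gridGraph {ℓ : ℕ} (hℓ : 3 ≤ ℓ) : 3 ≤ bandwidth (gridGraph 3 ℓ) := by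
  obtain ⟨σ, hσ⟩ := exists_labeling_bandwidth (gridGraph 3 ℓ)
  let block : Fin 3 × Fin 3 → Fin 3 × Fin ℓ := fun v => (v.1, Fin.castLE hℓ v.2)
  have block_injective : Function.Injective block :=
    Function.injective_id.prodMap (Fin.castLE_injective hℓ)
  obtain ⟨u, v, huv, hlt⟩ := exists_two_lt_abs_sub_gridGraph
    (L := fun v => ((σ (block v) : ℕ) : ℤ))
    (Nat.cast_injective.comp (Fin.val_injective.comp (σ.injective.comp block_injective)))
  have block_adj : (gridGraph 3 ℓ).Adj (block u) (block v) :=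
    gridGraph_adj_iff.2 (by simpa [block] using gridGraph_adj_iff.1 huv)
  exact_mod_cast hlt.trans_le (hσ _ _ block_adj)

lemma bandwidth_gridGraph_le (k ℓ : ℕ) : bandwidth (gridGraph k ℓ) ≤ k := by
  refine bandwidth_le_of_injective (L := fun v => finProdFinEquiv (v.2, v.1))
    (Fin.val_injective.comp (finProdFinEquiv.injective.comp Prod.swap_injective))
    fun u v huv => ?_
  have := u.1.2
  simp only [finProdFinEquiv_apply_val]
  rcases gridGraph_adj_iff.1 huv with ⟨_, hsnd⟩ | ⟨hsnd | hsnd, hfst⟩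
  · rw [hsnd]
    lia
  · rw [← hsnd, hfst]
    lia
  · rw [← hsnd, hfst]
    lia

lemma bandwidth_gridGraph {ℓ : ℕ} (hℓ : 3 ≤ ℓ) : bandwidth (gridGraph 3 ℓ) = 3 :=
  (bandwidth_gridGraph_le 3 ℓ).antisymm (three_le_bandwidth_gridGraph hℓ)

/-- The labels of the plus that witness its bandwidth: the nine points of the center row by row,
then twelve labels for the points at each distance from the center, three for each arm. The labels
of the left and the right arm alternate, as otherwise an end of a row of the center would be too far
from its neighbor in the arm. -/
def plusLabel (h : ℕ) (p : ℕ × ℕ) : ℕ :=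
  if p.2 + 1 < h then 9 + 12 * (h - 2 - p.2) + (p.1 + 1 - h)
  else if h + 1 < p.2 then 18 + 12 * (p.2 - (h + 2)) + (p.1 + 1 - h)
  else if p.1 + 1 < h then 12 + 12 * (h - 2 - p.1) + 2 * (p.2 + 1 - h)
  else if h + 1 < p.1 then 13 + 12 * (p.1 - (h + 2)) + 2 * (p.2 + 1 - h)
  else 3 * (p.2 + 1 - h) + (p.1 + 1 - h)

lemma eq_of_plusLabel_eq {h : ℕ} {p q : ℕ × ℕ}
    (hp : (h ≤ p.1 + 1 ∧ p.1 ≤ h + 1) ∨ (h ≤ p.2 + 1 ∧ p.2 ≤ h + 1))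
    (hq : (h ≤ q.1 + 1 ∧ q.1 ≤ h + 1) ∨ (h ≤ q.2 + 1 ∧ q.2 ≤ h + 1))
    (heq : plusLabel h p = plusLabel h q) : p = q := by
  unfold plusLabel at heq
  refine Prod.ext ?_ ?_ <;> split_ifs at heq <;> omega

lemma plusLabel_le_add {h : ℕ} {p q : ℕ × ℕ}
    (hp : (h ≤ p.1 + 1 ∧ p.1 ≤ h + 1) ∨ (h ≤ p.2 + 1 ∧ p.2 ≤ h + 1))
    (hq : (h ≤ q.1 + 1 ∧ q.1 ≤ h + 1) ∨ (h ≤ q.2 + 1 ∧ q.2 ≤ h + 1))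
    (hpq : squareLattice.Adj p q) : plusLabel h q ≤ plusLabel h p + 12 := by
  rw [squareLattice_adj_iff] at hpq
  unfold plusLabel
  split_ifs <;> omega

lemma bandwidth_plusGraph_le (h : ℕ) : bandwidth (plusGraph (2 * h + 1)) ≤ 12 := by
  refine bandwidth_le_of_injective (L := fun v => plusLabel h (plusEmbedding h v))
    (fun u v huv => (plusEmbedding h).injective ?_) fun u v huv => ?_
  · exact eq_of_plusLabel_eq (mem_plusSet_iff.1 u.2) (mem_plusSet_iff.1 v.2) huv
  · exact plusLabel_le_add (mem_plusSet_iff.1 u.2) (mem_plusSet_iff.1 v.2)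
      ((plusEmbedding h).map_adj_iff.2 huv)

end Bandwidth

/-! ### Mixing times -/

section Mixing

lemma card_plusSet_le (h : ℕ) : Fintype.card (plusSet (2 * h + 1)) ≤ 6 * (2 * h + 1) := by
  let middle : Finset (Fin (2 * h + 1)) := {x | h ≤ x.1 + 1 ∧ x.1 ≤ h + 1}
  have card_middle_le : middle.card ≤ 3 := by
    calc middle.card ≤ (Finset.Icc (h - 1) (h + 1)).card :=
          Finset.card_le_card_of_injOn Fin.val (fun x hx => by
            have := (Finset.mem_filter.1 hx).2
            exact Finset.mem_Icc.2 (by lia)) Fin.val_injective.injOn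
      _ ≤ 3 := by
          rw [Nat.card_Icc]
          lia
  have subset_union : plusSet (2 * h + 1) ⊆
      (middle ×ˢ Finset.univ ∪ Finset.univ ×ˢ middle : Finset _) := by
    intro v hv
    simpa [middle] using mem_plusSet_iff.1 hv
  rw [← Nat.card_eq_fintype_card, Nat.card_coe_set_eq]
  calc (plusSet (2 * h + 1)).ncard
      ≤ (middle ×ˢ Finset.univ ∪ Finset.univ ×ˢ middle).card := by
        rw [← Set.ncard_coe_finset]
        exact Set.ncard_le_ncard subset_union
    _ ≤ middle.card * (2 * h + 1) + (2 * h + 1) * middle.card := by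
        refine (Finset.card_union_le _ _).trans_eq ?_
        rw [Finset.card_product, Finset.card_product, Finset.card_univ, Fintype.card_fin]
    _ ≤ 6 * (2 * h + 1) := by nlinarith

lemma eventually_mul_pow_mul_exp_le (K : ℝ) {ε a b : ℝ} (k : ℕ) (hε : 0 < ε) (hab : a < b) :
    ∀ᶠ x : ℝ in Filter.atTop, K * x ^ k * Real.exp (a * x) ≤ ε * Real.exp (b * x) := by
  have pow_isLittleO := (isLittleO_pow_exp_pos_mul_atTop k (sub_pos.2 hab)).const_mul_left K
  filter_upwards [pow_isLittleO.bound hε] with x hx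
  rw [Real.norm_of_nonneg (Real.exp_pos _).le] at hx
  calc K * x ^ k * Real.exp (a * x) ≤ ε * Real.exp ((b - a) * x) * Real.exp (a * x) :=
        mul_le_mul_of_nonneg_right ((Real.le_norm_self _).trans hx) (Real.exp_pos _).le
    _ = ε * Real.exp (b * x) := by
        rw [mul_assoc, ← Real.exp_add]
        ring_nf

lemma eventually_exp_mul_two_rpow_le (K : ℝ) {ε c r : ℝ} (k : ℕ) (hε : 0 < ε)
    (hcr : c + r * Real.log 2 < Real.log 2) : ∀ᶠ n : ℕ in Filter.atTop,
      Real.exp (c * n) * (K * (n : ℝ) ^ k * (2 : ℝ) ^ (r * n)) ≤ ε * 2 ^ n := by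
  filter_upwards [tendsto_natCast_atTop_atTop.eventually
    (eventually_mul_pow_mul_exp_le K k hε hcr)] with n hn
  rw [← Real.rpow_natCast 2 n, Real.rpow_def_of_pos two_pos, Real.rpow_def_of_pos two_pos]
  calc Real.exp (c * n) * (K * (n : ℝ) ^ k * Real.exp (Real.log 2 * (r * n)))
      = K * (n : ℝ) ^ k * Real.exp ((c + r * Real.log 2) * n) := by
        rw [add_mul, Real.exp_add, mul_left_comm, mul_comm (Real.log 2), mul_right_comm r]
    _ ≤ ε * Real.exp (Real.log 2 * n) := hn

lemma three_tenths_lt_half_log_two : 3 / 10 < Real.log 2 / 2 := by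
  linarith [Real.log_two_gt_d9]

lemma exp_le_mixingTime_colorChain_gridGraph {δ : ℝ} (hδ : δ < 1 / 2) :
    ∃ ℓ₀ : ℕ, ∀ ℓ : ℕ, ℓ₀ ≤ ℓ →
      ENNReal.ofReal (Real.exp (1 / 10 * (Fintype.card (Fin 3 × Fin ℓ) : ℝ))) ≤
        ((mixingTime (colorChain (gridGraph 3 ℓ) 2) (uniformDist _) δ : ℕ∞) : ℝ≥0∞) := by
  have exp_le := eventually_exp_mul_two_rpow_le (2 ^ 27) (c := 3 / 10) (r := 0) 24
    (sub_pos.2 hδ) (by linarith [three_tenths_lt_half_log_two])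
  refine Filter.eventually_atTop.1 ?_
  filter_upwards [exp_le, Filter.eventually_ge_atTop 1] with ℓ hle hℓ
  have : Nonempty (Fin 3 × Fin ℓ) := ⟨(0, ⟨0, hℓ⟩)⟩
  have hℓ₀ : (0 : ℝ) < ℓ := by exact_mod_cast hℓ
  refine (hasBottleneck_colorChain_gridGraph hℓ).le_mixingTime
    (mem_doublyStochastic_of_isSymm colorChain_mem_rowStochastic colorChain_isSymm)
    (by positivity) (by positivity) hδ.le ?_
  rw [zero_mul, Real.rpow_zero, mul_one] at hle
  convert hle using 3
  rw [Fintype.card_prod, Fintype.card_fin, Fintype.card_fin]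
  push_cast
  ring

lemma exp_le_mixingTime_partitionChain_plusGraph {δ : ℝ} (hδ : δ < 1 / 2) :
    ∃ ℓ₀ : ℕ, ∀ ℓ : ℕ, ℓ₀ ≤ ℓ → Odd ℓ →
      ENNReal.ofReal (Real.exp (1 / 20 * (Fintype.card (plusSet ℓ) : ℝ))) ≤
        ((mixingTime (partitionChain (plusGraph ℓ)) (uniformDist _) δ : ℕ∞) : ℝ≥0∞) := by
  have exp_le := eventually_exp_mul_two_rpow_le (2 ^ 22) (c := 3 / 10) (r := 1 / 2) 88
    (sub_pos.2 hδ) (by linarith [three_tenths_lt_half_log_two])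
  refine Filter.eventually_atTop.1 ?_
  filter_upwards [exp_le, Filter.eventually_ge_atTop 5] with ℓ hle hℓ hodd
  obtain ⟨h, rfl⟩ := hodd
  have card_le : (Fintype.card (plusSet (2 * h + 1)) : ℝ) ≤ 6 * ((2 * h + 1 : ℕ) : ℝ) := by
    exact_mod_cast card_plusSet_le h
  have exponent_le : 1 / 20 * (Fintype.card (plusSet (2 * h + 1)) : ℝ) ≤
      3 / 10 * ((2 * h + 1 : ℕ) : ℝ) := by linarith
  refine (ENNReal.ofReal_le_ofReal (Real.exp_le_exp.2 exponent_le)).trans ?_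
  refine (hasBottleneck_partitionChain_plusGraph (by lia)).le_mixingTime
    (mem_doublyStochastic_of_isSymm partitionChain_mem_rowStochastic partitionChain_isSymm)
    (by positivity) (by positivity) hδ.le ?_
  rwa [one_div_mul_eq_div] at hle

end Mixing

end ConnPart

end

theorem mainTheorem5 :
    ((∀ ℓ : ℕ, 3 ≤ ℓ → ConnPart.bandwidth (ConnPart.gridGraph 3 ℓ) = 3) ∧
      (∀ ℓ : ℕ, 1 ≤ ℓ →
        ConnPart.IsErgodicChain (ConnPart.colorChain (ConnPart.gridGraph 3 ℓ) 2)
          (ConnPart.uniformDist _)) ∧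
      (∃ c : ℝ, 0 < c ∧ ∀ δ : ℝ, 0 < δ → δ < 1 / 2 → ∃ ℓ₀ : ℕ, ∀ ℓ : ℕ, ℓ₀ ≤ ℓ →
        ENNReal.ofReal (Real.exp (c * (Fintype.card (Fin 3 × Fin ℓ) : ℝ))) ≤
          ((ConnPart.mixingTime (ConnPart.colorChain (ConnPart.gridGraph 3 ℓ) 2)
            (ConnPart.uniformDist _) δ : ℕ∞) : ENNReal)) ∧
      (∃ c K : ℝ, ∃ k ℓ₀ : ℕ, 0 < c ∧ ∀ ℓ : ℕ, ℓ₀ ≤ ℓ →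
        ConnPart.HasBottleneck (ConnPart.colorChain (ConnPart.gridGraph 3 ℓ) 2)
          (c * 2 ^ ℓ) (K * (ℓ : ℝ) ^ k))) ∧
    ((∀ ℓ : ℕ, Odd ℓ → ConnPart.bandwidth (ConnPart.plusGraph ℓ) ≤ 12) ∧
      (∀ ℓ : ℕ, Odd ℓ →
        ConnPart.IsErgodicChain (ConnPart.partitionChain (ConnPart.plusGraph ℓ))
          (ConnPart.uniformDist _)) ∧
      (∃ c : ℝ, 0 < c ∧ ∀ δ : ℝ, 0 < δ → δ < 1 / 2 → ∃ ℓ₀ : ℕ, ∀ ℓ : ℕ, ℓ₀ ≤ ℓ → Odd ℓ →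
        ENNReal.ofReal (Real.exp (c * (Fintype.card (ConnPart.plusSet ℓ) : ℝ))) ≤
          ((ConnPart.mixingTime (ConnPart.partitionChain (ConnPart.plusGraph ℓ))
            (ConnPart.uniformDist _) δ : ℕ∞) : ENNReal)) ∧
      (∃ c K : ℝ, ∃ k ℓ₀ : ℕ, 0 < c ∧ ∀ ℓ : ℕ, ℓ₀ ≤ ℓ → Odd ℓ →
        ConnPart.HasBottleneck (ConnPart.partitionChain (ConnPart.plusGraph ℓ))
          (c * 2 ^ ℓ) (K * (ℓ : ℝ) ^ k * (2 : ℝ) ^ ((ℓ : ℝ) / 2)))) := by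
  refine ⟨⟨fun ℓ => ConnPart.bandwidth_gridGraph,
    fun ℓ => ConnPart.isErgodicChain_colorChain_gridGraph (by norm_num),
    ⟨1 / 10, by norm_num, fun δ _ hδ => ConnPart.exp_le_mixingTime_colorChain_gridGraph hδ⟩,
    ⟨1, 2 ^ 27, 24, 1, one_pos, fun ℓ hℓ => ?_⟩⟩, ?_, ?_,
    ⟨1 / 20, by norm_num, fun δ _ hδ => ConnPart.exp_le_mixingTime_partitionChain_plusGraph hδ⟩,
    ⟨1, 2 ^ 22, 88, 5, one_pos, ?_⟩⟩
  · rw [one_mul]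
    exact ConnPart.hasBottleneck_colorChain_gridGraph hℓ
  · rintro ℓ ⟨h, rfl⟩
    exact ConnPart.bandwidth_plusGraph_le h
  · rintro ℓ ⟨h, rfl⟩
    exact ConnPart.isErgodicChain_partitionChain_plusGraph h
  · rintro ℓ hℓ ⟨h, rfl⟩
    rw [one_mul]
    exact ConnPart.hasBottleneck_partitionChain_plusGraph (by lia)
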